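/- Let $n\ge 1$, $\tau>0$, $\delta>0$, $\gamma>0$ with $\gamma\neq\frac1{4\tau}$, $s\in\mathbb R$, $j\in\{0,1,2\}$, and $n+2s+4+2j>0$. Consider on $\mathbb R^n$ the weakly damped Moore–Gibson–Thompson equation $$\tau\varphi_{ttt}+\varphi_{tt}-\Delta\varphi-(\delta+\tau)\Delta\varphi_t+\gamma\varphi_t=0\quad(t>0),\qquad (\varphi,\varphi_t,\varphi_{tt})|_{t=0}=(\varphi_0,\varphi_1,\varphi_2),$$ with data $\varphi_k\in H^{s+2-k}\cap L^1$ for $k=0,1,2$, and let $\varphi\in C([0,\infty),H^{s+2})\cap C^1([0,\infty),H^{s+1})\cap C^2([0,\infty),H^{s})$ be its Sobolev solution (the equation being understood in the sense of distributions). Put $$\Phi_0=\gamma\varphi_0+\varphi_1+\tau\varphi_2,\qquad P_{\Phi_0}=\int_{\mathbb R^n}\Phi_0\,dx,\qquad G(t,x)=\frac1\gamma\Big(\frac{\gamma}{4\pi t}\Big)^{n/2}e^{-\gamma|x|^2/(4t)},$$ so that $G(t,\cdot)$ is $\gamma^{-1}$ times the inverse Fourier transform of $e^{-|\xi|^2t/\gamma}$,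 and let $\|u\|_{\dot H^{r}}=\||D|^{r}u\|_{L^2}$. There are constants $C,c>0$ depending only on $n,\tau,\delta,\gamma,s,j$ such that, for all such data, the following hold. (i) If $n+2(s+2-j)>0$, then for all $t\ge 0$ $$\|\partial_t^j\varphi(t,\cdot)\|_{\dot H^{s+2-j}}\le C(1+t)^{-\frac{n+2s+4+2j}{4}}\,\|(\varphi_0,\varphi_1,\varphi_2)\|_{(H^{s+\max\{1,2-j\}}\cap L^1)\times(H^{s+1}\cap L^1)\times(H^{s}\cap L^1)},$$ and the same bound holds with the homogeneous Sobolev norms $\dot H$ of the data in place of the inhomogeneous ones. (ii) If $n+2(s+2-j)>0$, then, as $t\to\infty$, $$\big\|\partial_t^j\varphi(t,\cdot)-\partial_t^jG(t,\cdot)\,P_{\Phi_0}\big\|_{\dot H^{s+2-j}}=o\big(t^{-\frac{n+2s+4+2j}{4}}\big),\qquad \partial_t^jG=(-\gamma)^{-j}(-\Delta)^jG .$$ (iii) If $P_{\Phi_0}\neq0$, then for all sufficiently large $t$ (depending on the data) $$\|\partial_t^j\varphi(t,\cdot)\|_{\dot H^{s+2-j}}\ge c\,t^{-\frac{n+2s+4+2j}{4}}\,|P_{\Phi_0}|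 ,$$ where the left side is read as $+\infty$ if $\partial_t^j\varphi(t,\cdot)\notin\dot H^{s+2-j}$. -/

import Mathlib

open MeasureTheory Filter Topology
open scoped SchwartzMap FourierTransform Laplacian ENNReal

noncomputable section

/-- The Euclidean space `ℝⁿ`. -/
abbrev Rn (n : ℕ) : Type := EuclideanSpace ℝ (Fin n)

/-- The Fourier transform of the tempered distribution `u` is the function `g`
(in the convention `∫ exp (-2 π i x·ξ) u(x) dx`, so that `-Δ` has the symbol `(2 π |ξ|)²`). -/
def HasFourierFunction {n : ℕ} (u : 𝓢'(Rn n, ℂ)) (g : Rn n → ℂ) : Prop :=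
  ∀ θ : 𝓢(Rn n, ℂ), Integrable (fun ξ ↦ θ ξ * g ξ) ∧ (𝓕 u) θ = ∫ ξ, θ ξ * g ξ

/-- The norm `‖w û‖_{L²}`, for a weight `w` on the frequency side. Its value is `∞` if `û` is not a
function; if it is, the function is unique almost everywhere and the infimum is over one value. -/
def weightedFourierNorm {n : ℕ} (w : Rn n → ℝ) (u : 𝓢'(Rn n, ℂ)) : ℝ≥0∞ :=
  ⨅ (g : Rn n → ℂ) (_ : HasFourierFunction u g), eLpNorm (fun ξ ↦ (w ξ : ℂ) * g ξ) 2 volume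

/-- The inhomogeneous Sobolev norm `‖⟨D⟩^r u‖_{L²}` of order `r`. -/
def sobolevNorm {n : ℕ} (r : ℝ) (u : 𝓢'(Rn n, ℂ)) : ℝ≥0∞ :=
  weightedFourierNorm (fun ξ ↦ (1 + (2 * Real.pi * ‖ξ‖) ^ 2) ^ (r / 2)) u

/-- The homogeneous Sobolev norm `‖|D|^r u‖_{L²}` of order `r`. -/
def homSobolevNorm {n : ℕ} (r : ℝ) (u : 𝓢'(Rn n, ℂ)) : ℝ≥0∞ :=
  weightedFourierNorm (fun ξ ↦ (2 * Real.pi * ‖ξ‖) ^ r) u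

/-- `u ∈ C([0, ∞), H^r)`. -/
def ContinuousInSobolev {n : ℕ} (r : ℝ) (u : ℝ → 𝓢'(Rn n, ℂ)) : Prop :=
  ∀ t, 0 ≤ t → TemperedDistribution.MemSobolev r 2 (u t) ∧
    Tendsto (fun t' ↦ sobolevNorm r (u t' - u t)) (𝓝[Set.Ici 0] t) (𝓝 0)

/-- On `[0, ∞)`, `v` is the time derivative of `u`, as a limit of difference quotients in `H^r`
(one-sided at `t = 0`). -/
def HasTimeDerivInSobolev {n : ℕ} (r : ℝ) (u v : ℝ → 𝓢'(Rn n, ℂ)) : Prop :=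
  ∀ t, 0 ≤ t → Tendsto
    (fun t' ↦ sobolevNorm r ((((t' - t)⁻¹ : ℝ) : ℂ) • (u t' - u t) - v t))
    (𝓝[Set.Ici 0 \ {t}] t) (𝓝 0)

/-- `φ 0` is a Sobolev solution, in `C([0,∞), H^{s+2}) ∩ C¹([0,∞), H^{s+1}) ∩ C²([0,∞), H^s)`, of
`τ φ_ttt + φ_tt - Δφ - (δ + τ) Δφ_t + γ φ_t = 0` with the initial data `f 0`, `f 1`, `f 2`, and
`φ 1`, `φ 2` are its first two time derivatives. The equation holds for `t > 0` in the sense of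
distributions in `x`, that is, after pairing with every Schwartz function `θ`. -/
structure IsSobolevSolution {n : ℕ} (τ δ γ s : ℝ) (f : Fin 3 → 𝓢'(Rn n, ℂ))
    (φ : Fin 3 → ℝ → 𝓢'(Rn n, ℂ)) : Prop where
  cont : ∀ k : Fin 3, ContinuousInSobolev (s + 2 - (k : ℕ)) (φ k)
  deriv_zero : HasTimeDerivInSobolev (s + 1) (φ 0) (φ 1)
  deriv_one : HasTimeDerivInSobolev s (φ 1) (φ 2)
  equation : ∀ (θ : 𝓢(Rn n, ℂ)) (t : ℝ), 0 < t → ∃ d : ℂ,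
    HasDerivAt (fun r ↦ (φ 2 r) θ) d t ∧
      (τ : ℂ) * d + (φ 2 t) θ - (Δ (φ 0 t)) θ - ((δ + τ : ℝ) : ℂ) * (Δ (φ 1 t)) θ
        + (γ : ℂ) * (φ 1 t) θ = 0
  initial : ∀ k : Fin 3, φ k 0 = f k

/-- The data norm `‖(f 0, f 1, f 2)‖` in
`(X^{s + max(1, 2 - j)} ∩ L¹) × (X^{s + 1} ∩ L¹) × (X^s ∩ L¹)`,
where `N r` is the norm of `X^r` (homogeneous or inhomogeneous Sobolev). -/
def dataNorm {n : ℕ} (N : ℝ → 𝓢'(Rn n, ℂ) → ℝ≥0∞) (s : ℝ) (j : Fin 3)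
    (f : Fin 3 → Lp ℂ 1 (volume : Measure (Rn n))) : ℝ≥0∞ :=
  (N (s + max 1 (2 - ((j : ℕ) : ℝ))) (f 0 : 𝓢'(Rn n, ℂ)) + ‖f 0‖ₑ)
    + (N (s + 1) (f 1 : 𝓢'(Rn n, ℂ)) + ‖f 1‖ₑ)
    + (N s (f 2 : 𝓢'(Rn n, ℂ)) + ‖f 2‖ₑ)

/-- The Gaussian `G(t, x) = γ⁻¹ (γ / (4 π t))^{n/2} exp (-γ |x|² / (4 t))`, which is `γ⁻¹` times the
inverse Fourier transform of `exp (-t |ξ|² / γ)` (in the angular frequency `ξ`). -/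
def gaussianProfile (n : ℕ) (γ t : ℝ) (x : Rn n) : ℂ :=
  ((γ⁻¹ * (γ / (4 * Real.pi * t)) ^ ((n : ℝ) / 2) * Real.exp (-(γ * ‖x‖ ^ 2 / (4 * t))) : ℝ) : ℂ)

theorem memLp_gaussianProfile (n : ℕ) {γ t : ℝ} (hγ : 0 < γ) (ht : 0 < t) :
    MemLp (gaussianProfile n γ t) 1 volume := by
  rw [memLp_one_iff_integrable]
  have h := GaussianFourier.integrable_cexp_neg_mul_sq_norm_add (V := Rn n)
    (b := ((γ / (4 * t) : ℝ) : ℂ)) (by rw [Complex.ofReal_re]; positivity) 0 0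
  refine (h.const_mul
    ((γ⁻¹ * (γ / (4 * Real.pi * t)) ^ ((n : ℝ) / 2) : ℝ) : ℂ)).congr ?_
  filter_upwards with x
  simp only [gaussianProfile, Complex.ofReal_mul, Complex.ofReal_exp]
  congr 2
  push_cast
  ring

open Classical in
/-- The Gaussian `G(t, ·)` as a tempered distribution, for `t > 0` and `γ > 0`. -/
def gaussianDistribution (n : ℕ) (γ t : ℝ) : 𝓢'(Rn n, ℂ) :=
  if h : 0 < γ ∧ 0 < t then ((memLp_gaussianProfile n h.1 h.2).toLp (gaussianProfile n γ t) :
    Lp ℂ 1 (volume : Measure (Rn n))) else 0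

/-- `∂_t^j G(t, ·) = (-γ)^{-j} (-Δ)^j G(t, ·)`. -/
def diffusionProfile (n : ℕ) (γ : ℝ) (j : ℕ) (t : ℝ) : 𝓢'(Rn n, ℂ) :=
  (((-γ)⁻¹ ^ j : ℝ) : ℂ) • (fun u : 𝓢'(Rn n, ℂ) ↦ -Δ u)^[j] (gaussianDistribution n γ t)

/-- The moment `P_{Φ₀} = ∫ (γ φ₀ + φ₁ + τ φ₂) dx`. -/
def combinedMoment {n : ℕ} (τ γ : ℝ) (f : Fin 3 → Lp ℂ 1 (volume : Measure (Rn n))) : ℂ :=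
  ∫ x, ((γ : ℂ) * f 0 x + f 1 x + (τ : ℂ) * f 2 x)

/-- The rate `(n + 2 s + 4 + 2 j) / 4`. -/
def decayRate (n : ℕ) (s : ℝ) (j : Fin 3) : ℝ := (n + 2 * s + 4 + 2 * ((j : ℕ) : ℝ)) / 4

end

/-! On the Fourier side the equation decouples into scalar equations τu''' + u'' + (γ + (δ+τ)x)u' +
xu = 0, one for each x = |ξ|² (angular frequency). The characteristic polynomial has a real root -μ
with 0 < μ < 1/τ, and the remaining factor λ² + bλ + d is that of a damped oscillator. For small x
the root is slow, μ = x/γ + O(x²), while b and d stay away from 0. For x ≥ e all of μ, b, d are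
bounded below, and the strict inequality δ > 0 is what keeps b away from 0 as x → ∞. Hence each mode
is k·exp(-μt) plus a remainder that decays exponentially at a rate independent of x. The remainder
is estimated by a Lyapunov functional instead of explicit roots, so it is irrelevant whether the
other two roots are real, complex or equal (`IsModeSolution.remainder_decay`).

The slow amplitude k equals Φ̂₀/γ up to O(x). At low frequency the j-th derivative of a mode is
therefore (-x/γ)^j exp(-xt/γ) Φ̂₀(ξ)/γ, with an error bounded by x^(j+1) exp(-cxt) + exp(-ct)
(`exists_mode_asymptotics_low`). At high frequency there is exponential decay, with the gain of
regularity that explains the index max{1, 2-j} (`exists_mode_decay_high`).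

The rates come from the substitution ξ → ξ/√t: the L² norm of |ξ|^(s+2+j) exp(-c|ξ|²t) is a multiple
of t^(-(n+2s+4+2j)/4) (`eLpNorm_gaussianWeight`). This gives (i). For (ii), an extra factor x gains
t⁻¹, and Φ̂₀(ξ) may be replaced by its value P at 0 by continuity and dominated convergence. For
(iii), the norm is bounded below by its part on the annulus 1 ≤ √t|ξ| ≤ 2, where the slow mode
dominates; the annulus avoids the origin, so no integrability there is needed.

That a Sobolev solution is given by these modes almost everywhere is
`IsSobolevSolution.exists_ae_mode`. On a ball of frequencies multiplication by |ξ|² is bounded, so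
the equation is a linear ODE in L² of the ball. Its solution is unique and agrees with a flow built
in the bounded continuous functions, which can be evaluated at each ξ. -/

/-! ### Energy decay for a damped oscillator with an exponentially decaying force. -/

section DampedOscillator

/-- A nonnegative-rate linear differential inequality gives exponential decay. -/
theorem le_exp_mul_of_deriv_le {F F' : ℝ → ℝ} {m : ℝ} (hF : ∀ t, HasDerivAt F (F' t) t)
    (hF' : ∀ t, F' t ≤ -m * F t) {t : ℝ} (ht : 0 ≤ t) : F t ≤ Real.exp (-m * t) * F 0 := by
  have hd : ∀ r, HasDerivAt (fun r ↦ Real.exp (m * r) * F r)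
      (Real.exp (m * r) * (m * 1) * F r + Real.exp (m * r) * F' r) r := fun r ↦
    (((hasDerivAt_id r).const_mul m).exp).mul (hF r)
  have hanti : Antitone fun r ↦ Real.exp (m * r) * F r := by
    refine antitone_of_deriv_nonpos (fun r ↦ (hd r).differentiableAt) fun r ↦ ?_
    rw [(hd r).deriv]
    have := mul_le_mul_of_nonneg_left (hF' r) (Real.exp_pos (m * r)).le
    linarith
  have h := hanti ht
  simp only [mul_zero, Real.exp_zero, one_mul] at h
  rw [neg_mul, Real.exp_neg, inv_mul_eq_div, le_div_iff₀ (Real.exp_pos _), mul_comm]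
  exact h

/-- For v'' + bv' + dv = h, the left side is the derivative of ‖v'‖² + d‖v‖² + 2ε⟨v, v'⟩, with p =
‖v'‖, q = ‖v‖, H = ‖h‖, y = ⟨v, v'⟩, y₁ = ⟨v', h⟩, y₂ = ⟨v, h⟩. The ε-term supplies the damping
-2εdq² that the plain energy lacks; the two conditions on ε let its by-products be absorbed. -/
theorem oscillator_quadratic_estimate {b d ε p q H y y₁ y₂ : ℝ} (hε : 0 < ε) (hb : 4 * ε ≤ b)
    (hd : 2 * ε * b ≤ d) (hy : |y| ≤ q * p) (hy₁ : y₁ ≤ p * H) (hy₂ : y₂ ≤ q * H) :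
    2 * (y₁ - b * p ^ 2 - d * y) + d * (2 * y) + 2 * ε * (y₂ - b * y - d * q ^ 2 + p ^ 2) ≤
      -(ε / 2) * (p ^ 2 + d * q ^ 2 + 2 * ε * y) + 2 / ε * H ^ 2 := by
  have hb0 : 0 < b := by linarith
  have hε2 : 8 * ε ^ 2 ≤ d := by nlinarith
  have hqp : 0 ≤ q * p := (abs_nonneg y).trans hy
  have hy0 := (abs_le.1 hy).1
  -- All terms in y, including -ε²y from the right side. They consume half of the damping -2bp² and
  -- a quarter of -2εdq².
  have h1 : -(2 * ε * b - ε ^ 2) * y ≤ b * p ^ 2 + ε * (d / 2) * q ^ 2 := by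
    have hc : 0 ≤ 2 * ε * b - ε ^ 2 := by nlinarith
    have h2 := mul_le_mul_of_nonneg_left (neg_le.1 hy0) hc
    have h3 : (2 * ε * b - ε ^ 2) * (q * p) ≤ 2 * ε * b * (q * p) :=
      mul_le_mul_of_nonneg_right (by linarith [sq_nonneg ε]) hqp
    have h4 : 2 * ε * b * (q * p) ≤ b * p ^ 2 + ε ^ 2 * b * q ^ 2 := by
      have := mul_nonneg hb0.le (sq_nonneg (p - ε * q))
      linarith
    have h5 : ε ^ 2 * b * q ^ 2 ≤ ε * (d / 2) * q ^ 2 := by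
      have := mul_le_mul_of_nonneg_left hd hε.le
      exact mul_le_mul_of_nonneg_right (by linarith) (sq_nonneg q)
    linarith
  have h2 : 2 * (p * H) ≤ ε * p ^ 2 + 1 / ε * H ^ 2 := by
    have : ε * p ^ 2 + 1 / ε * H ^ 2 - 2 * (p * H) = (ε * p - H) ^ 2 / ε := by
      field_simp
      ring
    have h0 : 0 ≤ (ε * p - H) ^ 2 / ε := by positivity
    linarith
  have h3 : 2 * ε * (q * H) ≤ ε * d * q ^ 2 + 1 / ε * H ^ 2 := by
    have h4 : 2 * ε * (q * H) ≤ 8 * ε ^ 3 * q ^ 2 + 1 / (8 * ε) * H ^ 2 := by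
      have : 8 * ε ^ 3 * q ^ 2 + 1 / (8 * ε) * H ^ 2 - 2 * ε * (q * H)
          = (8 * ε ^ 2 * q - H) ^ 2 / (8 * ε) := by
        field_simp
        ring
      have h0 : 0 ≤ (8 * ε ^ 2 * q - H) ^ 2 / (8 * ε) := by positivity
      linarith
    have h5 : 8 * ε ^ 3 * q ^ 2 ≤ ε * d * q ^ 2 := by
      have := mul_le_mul_of_nonneg_left hε2 hε.le
      exact mul_le_mul_of_nonneg_right (by linarith) (sq_nonneg q)
    have h6 : 1 / (8 * ε) * H ^ 2 ≤ 1 / ε * H ^ 2 :=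
      mul_le_mul_of_nonneg_right (one_div_le_one_div_of_le hε (by linarith)) (sq_nonneg H)
    linarith
  have h5 : 2 / ε * H ^ 2 = 1 / ε * H ^ 2 + 1 / ε * H ^ 2 := by ring
  have h6 : 4 * ε * p ^ 2 ≤ b * p ^ 2 := mul_le_mul_of_nonneg_right hb (sq_nonneg p)
  have h7 := mul_le_mul_of_nonneg_left hy₂ (by positivity : 0 ≤ 2 * ε)
  have h8 : 0 ≤ ε * p ^ 2 := by positivity
  linarith

variable {V : Type*} [NormedAddCommGroup V] [InnerProductSpace ℝ V]

/-- The functional E + K‖h‖² decays at rate m. Since 8ε² ≤ d, the cross term in E is at most half of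
the energy, so E lies between 1/2 and 3/2 of it. -/
theorem damped_oscillator_energy_decay {b d ε m μ : ℝ} (hε : 0 < ε) (hb : 4 * ε ≤ b)
    (hd : 2 * ε * b ≤ d) (hm : 0 < m) (hmε : 2 * m ≤ ε) (hmμ : m ≤ μ) {v w h : ℝ → V}
    (hv : ∀ t, HasDerivAt v (w t) t) (hw : ∀ t, HasDerivAt w (h t - b • w t - d • v t) t)
    (hh : ∀ t, HasDerivAt h (-μ • h t) t) {t : ℝ} (ht : 0 ≤ t) :
    ‖w t‖ ^ 2 + d * ‖v t‖ ^ 2 ≤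
      Real.exp (-m * t) * (3 * (‖w 0‖ ^ 2 + d * ‖v 0‖ ^ 2) + 4 / (ε * m) * ‖h 0‖ ^ 2) := by
  have hb0 : 0 < b := by linarith
  have hd0 : 0 < d := lt_of_lt_of_le (by positivity) hd
  -- Chosen so that mK = 2/ε: the decay of K‖h‖² then pays for the forcing term (2/ε)‖h‖².
  set K : ℝ := 2 / (ε * m) with hK
  have hK0 : 0 < K := by positivity
  have hmK : m * K = 2 / ε := by rw [hK]; field_simp
  set E : ℝ → ℝ := fun r ↦ ‖w r‖ ^ 2 + d * ‖v r‖ ^ 2 + 2 * ε * inner ℝ (v r) (w r) with hE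
  have hcs : ∀ r, |inner ℝ (v r) (w r)| ≤ ‖v r‖ * ‖w r‖ := fun r ↦ abs_real_inner_le_norm _ _
  have hε2 : 8 * ε ^ 2 ≤ d := by nlinarith
  have hElow : ∀ r, (‖w r‖ ^ 2 + d * ‖v r‖ ^ 2) / 2 ≤ E r := fun r ↦ by
    have h1 := (abs_le.1 (hcs r)).1
    have h2 := mul_le_mul_of_nonneg_left h1 (by positivity : 0 ≤ 2 * ε)
    have h3 := sq_nonneg (‖w r‖ - 2 * ε * ‖v r‖)
    have h4 := mul_le_mul_of_nonneg_right hε2 (sq_nonneg ‖v r‖)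
    simp only [hE]
    nlinarith
  have hEup : ∀ r, E r ≤ 3 / 2 * (‖w r‖ ^ 2 + d * ‖v r‖ ^ 2) := fun r ↦ by
    have h1 := (abs_le.1 (hcs r)).2
    have h2 := mul_le_mul_of_nonneg_left h1 (by positivity : 0 ≤ 2 * ε)
    have h3 := sq_nonneg (‖w r‖ - 2 * ε * ‖v r‖)
    have h4 := mul_le_mul_of_nonneg_right hε2 (sq_nonneg ‖v r‖)
    simp only [hE]
    nlinarith
  have hE0 : ∀ r, 0 ≤ E r := fun r ↦ le_trans (by positivity) (hElow r)
  have hdE : ∀ r, HasDerivAt (fun r ↦ E r + K * ‖h r‖ ^ 2)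
      ((2 * inner ℝ (w r) (h r - b • w r - d • v r) + d * (2 * inner ℝ (v r) (w r))
        + 2 * ε * (inner ℝ (v r) (h r - b • w r - d • v r) + inner ℝ (w r) (w r)))
        + K * (2 * inner ℝ (h r) (-μ • h r))) r := fun r ↦
    ((((hw r).norm_sq).add (((hv r).norm_sq).const_mul d)).add
      (((hv r).inner ℝ (hw r)).const_mul (2 * ε))).add (((hh r).norm_sq).const_mul K)
  have key := le_exp_mul_of_deriv_le (m := m) hdE (fun r ↦ ?_) ht
  · have h1 := hElow t
    have h2 := hEup 0
    have h3 : (‖w t‖ ^ 2 + d * ‖v t‖ ^ 2) / 2 ≤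
        Real.exp (-m * t) * (3 / 2 * (‖w 0‖ ^ 2 + d * ‖v 0‖ ^ 2) + K * ‖h 0‖ ^ 2) := by
      refine le_trans ?_ (key.trans (mul_le_mul_of_nonneg_left (add_le_add_left h2 _)
        (Real.exp_pos _).le))
      have : 0 ≤ K * ‖h t‖ ^ 2 := by positivity
      linarith
    have h4 : 4 / (ε * m) = 2 * K := by rw [hK]; ring
    rw [h4]
    linarith
  · simp only [inner_sub_right, inner_smul_right, real_inner_self_eq_norm_sq, real_inner_comm (v r)]
    have hvw := hcs r
    have hE' : E r = ‖w r‖ ^ 2 + d * ‖v r‖ ^ 2 + 2 * ε * inner ℝ (v r) (w r) := rfl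
    have hE1 := hE0 r
    have hwh := (le_abs_self _).trans (abs_real_inner_le_norm (w r) (h r))
    have hvh := (le_abs_self _).trans (abs_real_inner_le_norm (v r) (h r))
    generalize ‖w r‖ = p at *
    generalize ‖v r‖ = q at *
    generalize ‖h r‖ = H at *
    generalize (inner ℝ (v r) (w r) : ℝ) = y at *
    generalize (inner ℝ (w r) (h r) : ℝ) = y1 at *
    generalize (inner ℝ (v r) (h r) : ℝ) = y2 at *
    have hnum := oscillator_quadratic_estimate hε hb hd hvw hwh hvh
    have hB : m * E r ≤ ε / 2 * E r := mul_le_mul_of_nonneg_right (by linarith) hE1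
    have h4 : 2 / ε * H ^ 2 - 2 * μ * K * H ^ 2 ≤ -m * (K * H ^ 2) := by
      have : m * (K * H ^ 2) ≤ μ * (K * H ^ 2) := mul_le_mul_of_nonneg_right hmμ (by positivity)
      rw [← hmK]
      linarith
    rw [hE'] at hB ⊢
    linarith

/-- The square root of the energy estimate, whence the halved rate. With y = 4/(εm), the factor (2 +
y)² dominates both coefficients 3 and y. -/
theorem damped_oscillator_decay {b d ε m μ : ℝ} (hε : 0 < ε) (hb : 4 * ε ≤ b)
    (hd : 2 * ε * b ≤ d) (hm : 0 < m) (hmε : 2 * m ≤ ε) (hmμ : m ≤ μ) {v w h : ℝ → V}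
    (hv : ∀ t, HasDerivAt v (w t) t) (hw : ∀ t, HasDerivAt w (h t - b • w t - d • v t) t)
    (hh : ∀ t, HasDerivAt h (-μ • h t) t) {t : ℝ} (ht : 0 ≤ t) :
    ‖w t‖ ≤ Real.exp (-(m / 2) * t) * ((2 + 4 / (ε * m)) * (‖w 0‖ + √d * ‖v 0‖ + ‖h 0‖)) ∧
    √d * ‖v t‖ ≤
      Real.exp (-(m / 2) * t) * ((2 + 4 / (ε * m)) * (‖w 0‖ + √d * ‖v 0‖ + ‖h 0‖)) := by
  have hd0 : 0 < d := lt_of_lt_of_le (by have : 0 < b := by linarith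
                                         positivity) hd
  have key := damped_oscillator_energy_decay hε hb hd hm hmε hmμ hv hw hh ht
  have hy : 0 < 4 / (ε * m) := by positivity
  set y := 4 / (ε * m)
  have he : Real.exp (-m * t) = Real.exp (-(m / 2) * t) ^ 2 := by
    rw [← Real.exp_nat_mul]; congr 1; push_cast; ring
  have hsq : ‖w t‖ ^ 2 + (√d * ‖v t‖) ^ 2 ≤
      (Real.exp (-(m / 2) * t) * ((2 + y) * (‖w 0‖ + √d * ‖v 0‖ + ‖h 0‖))) ^ 2 := by
    rw [mul_pow, Real.sq_sqrt hd0.le, mul_pow _ ((2 + y) * _), ← he]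
    refine key.trans (mul_le_mul_of_nonneg_left ?_ (Real.exp_pos _).le)
    have hD : d * ‖v 0‖ ^ 2 = (√d * ‖v 0‖) ^ 2 := by rw [mul_pow, Real.sq_sqrt hd0.le]
    rw [hD]
    have h1 : 0 ≤ ‖w 0‖ := norm_nonneg _
    have h2 : 0 ≤ √d * ‖v 0‖ := by positivity
    have h3 : 0 ≤ ‖h 0‖ := norm_nonneg _
    generalize ‖w 0‖ = p at *
    generalize √d * ‖v 0‖ = q at *
    generalize ‖h 0‖ = H at *
    have h5 : p ^ 2 + q ^ 2 + H ^ 2 ≤ (p + q + H) ^ 2 := by nlinarith [mul_nonneg h1 h2, mul_nonneg h1 h3, mul_nonneg h2 h3]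
    calc 3 * (p ^ 2 + q ^ 2) + y * H ^ 2 ≤ (2 + y) ^ 2 * (p ^ 2 + q ^ 2 + H ^ 2) := by
          have : 3 ≤ (2 + y) ^ 2 := by nlinarith
          have : y ≤ (2 + y) ^ 2 := by nlinarith
          nlinarith [sq_nonneg p, sq_nonneg q, sq_nonneg H]
      _ ≤ _ := by rw [mul_pow]; exact mul_le_mul_of_nonneg_left h5 (sq_nonneg _)
  have hR : 0 ≤ Real.exp (-(m / 2) * t) * ((2 + y) * (‖w 0‖ + √d * ‖v 0‖ + ‖h 0‖)) := by
    positivity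
  constructor
  · exact abs_le_of_sq_le_sq' (by nlinarith [sq_nonneg (√d * ‖v t‖)]) hR |>.2
  · exact abs_le_of_sq_le_sq' (by nlinarith [sq_nonneg ‖w t‖]) hR |>.2

end DampedOscillator

/-! ### The characteristic polynomial and the splitting off of its slow root. -/

section ModeEquation

/-- `u 0` solves `τ ∂³u + ∂²u + (γ + (δ + τ) x) ∂u + x u = 0`, with derivatives `u 1` and `u 2`.
This is the equation of a Fourier mode, with `x` the square of the angular frequency. -/
structure IsModeSolution (τ δ γ x : ℝ) (u : Fin 3 → ℝ → ℂ) : Prop where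
  deriv_zero : ∀ t, HasDerivAt (u 0) (u 1 t) t
  deriv_one : ∀ t, HasDerivAt (u 1) (u 2 t) t
  deriv_two : ∀ t, HasDerivAt (u 2)
    (-((τ : ℂ)⁻¹ * (u 2 t + ((γ + (δ + τ) * x : ℝ) : ℂ) * u 1 t + (x : ℂ) * u 0 t))) t

/-- The characteristic polynomial factors as `τ (λ + μ) (λ² + b λ + d)`. -/
structure IsModeFactorization (τ δ γ x μ b d : ℝ) : Prop where
  sum : b + μ = τ⁻¹
  mid : d + b * μ = (γ + (δ + τ) * x) / τ
  prod : d * μ = x / τ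

/-- The expression in `hneg` is the characteristic polynomial at -κ. At 0 it equals x > 0, so the
intermediate value theorem gives a root -μ with μ < κ, and division by λ + μ gives b and d. An upper
bound for μ is thereby reduced to a sign test, and it is also a lower bound for b = 1/τ - μ. -/
theorem exists_isModeFactorization_of_neg {τ δ γ x κ : ℝ} (hτ : 0 < τ) (hx : 0 < x) (hκ : 0 < κ)
    (hneg : κ ^ 2 * (1 - τ * κ) - γ * κ + x * (1 - (δ + τ) * κ) < 0) :
    ∃ μ b d, 0 < μ ∧ μ < κ ∧ IsModeFactorization τ δ γ x μ b d := by
  have hc : ContinuousOn (fun y : ℝ ↦ y ^ 2 * (1 - τ * y) - γ * y + x * (1 - (δ + τ) * y))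
      (Set.Icc 0 κ) := by fun_prop
  have hmem : (0 : ℝ) ∈ Set.Ioo (κ ^ 2 * (1 - τ * κ) - γ * κ + x * (1 - (δ + τ) * κ))
      ((0 : ℝ) ^ 2 * (1 - τ * 0) - γ * 0 + x * (1 - (δ + τ) * 0)) := ⟨hneg, by simpa using hx⟩
  obtain ⟨μ, ⟨hμ0, hμκ⟩, hμ⟩ := intermediate_value_Ioo' hκ.le hc hmem
  refine ⟨μ, τ⁻¹ - μ, (γ + (δ + τ) * x) / τ - (τ⁻¹ - μ) * μ, hμ0, hμκ, by ring, by ring, ?_⟩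
  simp only at hμ
  field_simp
  linarith

namespace IsModeFactorization

variable {τ δ γ x μ b d : ℝ}

theorem charpoly_eq (h : IsModeFactorization τ δ γ x μ b d) (hτ : 0 < τ) :
    γ * μ + (δ + τ) * x * μ = x + μ ^ 2 * (τ * b) := by
  have h1 := h.mid
  have h2 := h.prod
  rw [eq_div_iff hτ.ne'] at h1 h2
  linear_combination h2 - μ * h1

theorem le_mul (h : IsModeFactorization τ δ γ x μ b d) (hτ : 0 < τ) (hb : 0 < b) :
    x ≤ μ * (γ + (δ + τ) * x) := by
  have := h.charpoly_eq hτ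
  have : 0 ≤ μ ^ 2 * (τ * b) := by positivity
  linarith

/-- Here d = x/(τμ), and τμ ≤ 1 because b > 0. -/
theorem le_d (h : IsModeFactorization τ δ γ x μ b d) (hτ : 0 < τ) (hμ : 0 < μ) (hb : 0 < b)
    (hx : 0 < x) : x ≤ d := by
  have h1 := h.prod
  have h2 : μ ≤ τ⁻¹ := by linarith [h.sum]
  rw [eq_div_iff hτ.ne'] at h1
  have hd : 0 < d := by
    by_contra! hd
    have : d * μ * τ ≤ 0 := mul_nonpos_of_nonpos_of_nonneg
      (mul_nonpos_of_nonpos_of_nonneg hd hμ.le) hτ.le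
    linarith
  have h3 : μ * τ ≤ 1 := by rwa [← le_div_iff₀ hτ, one_div]
  rw [← h1, mul_assoc]
  exact mul_le_of_le_one_right hd.le h3

theorem d_le (h : IsModeFactorization τ δ γ x μ b d) (hμ : 0 < μ) (hb : 0 < b) :
    d ≤ (γ + (δ + τ) * x) / τ := by
  have := h.mid
  have : 0 < b * μ := by positivity
  linarith

end IsModeFactorization

/-- The test point is κ = (1-θ)/τ. Since δ > 0, there is room for κ in [1/(δ+τ), 1/τ): the condition
θ ≤ δ/(δ+τ) makes the coefficient of x nonpositive, and θ ≤ γτ/2 makes the rest negative. One κ thus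
serves all x and leaves the gap b ≥ θ/τ. The lower bound m for μ comes from μ ≥ x/(γ + (δ+τ)x),
which increases with x. -/
theorem exists_isModeFactorization_high {τ δ γ e : ℝ} (hτ : 0 < τ) (hδ : 0 < δ) (hγ : 0 < γ)
    (he : 0 < e) :
    ∃ Q ε m : ℝ, 0 < Q ∧ 0 < ε ∧ 0 < m ∧ 2 * m ≤ ε ∧ ∀ x, e ≤ x → ∃ μ b d,
      IsModeFactorization τ δ γ x μ b d ∧ 0 < μ ∧ 0 < b ∧ x ≤ d ∧ d ≤ Q * x ∧
      4 * ε ≤ b ∧ 2 * ε * b ≤ d ∧ m ≤ μ := by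
  set θ : ℝ := min (γ * τ / 2) (δ / (δ + τ)) with hθ
  have hθ0 : 0 < θ := by rw [hθ]; positivity
  have hθ1 : θ ≤ γ * τ / 2 := min_le_left _ _
  have hθ2 : θ * (δ + τ) ≤ δ := by
    rw [← le_div_iff₀ (by positivity)]; exact min_le_right _ _
  have hθ3 : θ < 1 := by nlinarith
  set ε : ℝ := min (θ / (4 * τ)) (e * τ / 2) with hε
  have hε0 : 0 < ε := by rw [hε]; positivity
  set m : ℝ := min (ε / 2) (e / (γ + (δ + τ) * e)) with hm
  have hm0 : 0 < m := by rw [hm]; positivity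
  refine ⟨(γ / e + (δ + τ)) / τ, ε, m, by positivity, hε0, hm0, ?_, fun x hx ↦ ?_⟩
  · have : m ≤ ε / 2 := min_le_left _ _
    linarith
  have hx0 : 0 < x := he.trans_le hx
  have hκ : 0 < (1 - θ) / τ := div_pos (by linarith) hτ
  obtain ⟨μ, b, d, hμ0, hμκ, hf⟩ := exists_isModeFactorization_of_neg (δ := δ) (γ := γ) hτ hx0 hκ
    (by
      have h1 : τ * ((1 - θ) / τ) = 1 - θ := by field_simp
      have h2 : 1 ≤ (δ + τ) * ((1 - θ) / τ) := by
        rw [mul_div_assoc', le_div_iff₀ hτ]; linarith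
      have h3 : (1 - θ) / τ * θ < γ := by
        rw [div_mul_eq_mul_div, div_lt_iff₀ hτ]; nlinarith
      have h4 := mul_lt_mul_of_pos_left h3 hκ
      have h5 : x * (1 - (δ + τ) * ((1 - θ) / τ)) ≤ 0 :=
        mul_nonpos_of_nonneg_of_nonpos hx0.le (by linarith)
      rw [h1]
      linarith)
  have hb : θ / τ ≤ b := by
    have := hf.sum
    rw [sub_div, one_div] at hμκ
    linarith
  have hb0 : 0 < b := lt_of_lt_of_le (by positivity) hb
  have hbτ : b ≤ τ⁻¹ := by linarith [hf.sum]
  have hxd := hf.le_d hτ hμ0 hb0 hx0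
  refine ⟨μ, b, d, hf, hμ0, hb0, hxd, ?_, ?_, ?_, ?_⟩
  · refine (hf.d_le hμ0 hb0).trans ?_
    rw [div_mul_eq_mul_div]
    have : γ ≤ γ / e * x := by
      rw [div_mul_eq_mul_div, le_div_iff₀ he]; exact mul_le_mul_of_nonneg_left hx hγ.le
    gcongr
    linarith
  · have : ε ≤ θ / (4 * τ) := min_le_left _ _
    refine le_trans ?_ hb
    calc 4 * ε ≤ 4 * (θ / (4 * τ)) := by linarith
      _ = θ / τ := by field_simp
  · have h1 : ε ≤ e * τ / 2 := min_le_right _ _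
    calc 2 * ε * b ≤ 2 * (e * τ / 2) * τ⁻¹ := by gcongr
      _ = e := by field_simp
      _ ≤ d := hx.trans hxd
  · have h1 : m ≤ e / (γ + (δ + τ) * e) := min_le_right _ _
    refine h1.trans ?_
    have h2 := hf.le_mul hτ hb0
    rw [div_le_iff₀ (by positivity)]
    have h3 : x * e ≤ μ * (γ + (δ + τ) * x) * e := mul_le_mul_of_nonneg_right h2 he.le
    have h4 : μ * γ * e ≤ μ * γ * x := mul_le_mul_of_nonneg_left hx (by positivity)
    have : x * e ≤ x * (μ * (γ + (δ + τ) * e)) := by linarith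
    exact le_of_mul_le_mul_left this hx0

/-- The test point 2x/γ is twice the expected root x/γ. As x → 0 one has b → 1/τ and d → γ/τ, and
the smallness of e keeps half of these limits. The quantity μ² - bμ + d is the quadratic factor at
-μ, by which the slow amplitude is divided. -/
theorem exists_isModeFactorization_low {τ δ γ : ℝ} (hτ : 0 < τ) (hδ : 0 < δ) (hγ : 0 < γ) :
    ∃ e K ε : ℝ, 0 < e ∧ e ≤ 1 ∧ 0 < K ∧ 0 < ε ∧ ∀ x, 0 < x → x ≤ e → ∃ μ b d,
      IsModeFactorization τ δ γ x μ b d ∧ 0 < μ ∧ 0 < b ∧ x / (2 * γ) ≤ μ ∧ μ ≤ 2 / γ * x ∧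
      |μ - x / γ| ≤ K * x ^ 2 ∧ γ / (2 * τ) ≤ μ ^ 2 - b * μ + d ∧ γ / (2 * τ) ≤ d ∧
      4 * ε ≤ b ∧ 2 * ε * b ≤ d := by
  set e : ℝ := min (min 1 (γ ^ 2 / 8)) (min (γ / (4 * τ)) (γ / (δ + τ))) with he
  have he0 : 0 < e := by rw [he]; positivity
  have he1 : e ≤ 1 := (min_le_left _ _).trans (min_le_left _ _)
  have he2 : e ≤ γ ^ 2 / 8 := (min_le_left _ _).trans (min_le_right _ _)
  have he3 : e ≤ γ / (4 * τ) := (min_le_right _ _).trans (min_le_left _ _)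
  have he4 : e ≤ γ / (δ + τ) := (min_le_right _ _).trans (min_le_right _ _)
  set ε : ℝ := min (1 / (8 * τ)) (γ / 4) with hε
  have hε0 : 0 < ε := by rw [hε]; positivity
  refine ⟨e, (4 / γ ^ 2 + 2 * (δ + τ) / γ) / γ, ε, he0, he1, by positivity, hε0,
    fun x hx0 hx ↦ ?_⟩
  have hx2 : 8 * x ≤ γ ^ 2 := by linarith
  have hx3 : x * (4 * τ) ≤ γ := by
    rw [← le_div_iff₀ (by positivity)]; exact hx.trans he3
  have hx4 : (δ + τ) * x ≤ γ := by
    rw [mul_comm, ← le_div_iff₀ (by positivity)]; exact hx.trans he4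
  obtain ⟨μ, b, d, hμ0, hμκ, hf⟩ := exists_isModeFactorization_of_neg (δ := δ) (γ := γ) hτ hx0
    (κ := 2 / γ * x) (by positivity) (by
      set y := 2 / γ * x with hy
      have hy0 : 0 < y := by positivity
      have hγy : γ * y = 2 * x := by rw [hy]; field_simp
      have h1 : y ^ 2 < x := by
        have : γ ^ 2 * y ^ 2 < γ ^ 2 * x := by
          rw [← mul_pow, hγy]
          nlinarith
        exact lt_of_mul_lt_mul_left this (by positivity)
      have h2 : 0 ≤ y ^ 2 * (τ * y) := by positivity
      have h3 : 0 ≤ x * ((δ + τ) * y) := by positivity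
      linarith)
  have hμτ : μ ≤ 1 / (2 * τ) := by
    refine hμκ.le.trans ?_
    rw [div_mul_eq_mul_div, div_le_div_iff₀ hγ (by positivity)]
    linarith
  have hτ2 : 1 / (2 * τ) + 1 / (2 * τ) = τ⁻¹ := by field_simp; norm_num
  have hb : 1 / (2 * τ) ≤ b := by linarith [hf.sum]
  have hb0 : 0 < b := lt_of_lt_of_le (by positivity) hb
  have hbτ : b ≤ τ⁻¹ := by linarith [hf.sum]
  have hbμ : b * μ ≤ γ / (4 * τ) := by
    calc b * μ ≤ τ⁻¹ * (2 / γ * x) := by gcongr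
      _ ≤ τ⁻¹ * (2 / γ * (γ ^ 2 / 8)) := by gcongr; linarith
      _ = γ / (4 * τ) := by field_simp; norm_num
  have hdlow : γ / τ - b * μ ≤ d := by
    have h1 := hf.mid
    have h2 : γ / τ ≤ (γ + (δ + τ) * x) / τ := by
      gcongr
      have : 0 ≤ (δ + τ) * x := by positivity
      linarith
    linarith
  have h4τ : γ / τ = 4 * (γ / (4 * τ)) := by field_simp
  have h2τ : γ / (2 * τ) = 2 * (γ / (4 * τ)) := by field_simp; norm_num
  have h0τ : 0 < γ / (4 * τ) := by positivity
  have hd : γ / (2 * τ) ≤ d := by linarith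
  refine ⟨μ, b, d, hf, hμ0, hb0, ?_, hμκ.le, ?_, ?_, hd, ?_, ?_⟩
  · have h1 := hf.le_mul hτ hb0
    rw [div_le_iff₀ (by positivity)]
    have : μ * (γ + (δ + τ) * x) ≤ μ * (2 * γ) := by gcongr; linarith
    linarith
  · have h1 := hf.charpoly_eq hτ
    -- The root equation solved for μ - x/γ; both terms of the numerator are O(x²) once μ = O(x).
    have h2 : μ - x / γ = (μ ^ 2 * (τ * b) - (δ + τ) * x * μ) / γ := by
      field_simp
      linarith
    rw [h2, abs_div, abs_of_pos hγ, div_mul_eq_mul_div]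
    gcongr
    have hτb : τ * b ≤ 1 := by
      calc τ * b ≤ τ * τ⁻¹ := by gcongr
        _ = 1 := by field_simp
    have h3 : μ ^ 2 * (τ * b) ≤ 4 / γ ^ 2 * x ^ 2 := by
      calc μ ^ 2 * (τ * b) ≤ (2 / γ * x) ^ 2 * 1 := by gcongr
        _ = _ := by ring
    have h4 : (δ + τ) * x * μ ≤ 2 * (δ + τ) / γ * x ^ 2 := by
      calc (δ + τ) * x * μ ≤ (δ + τ) * x * (2 / γ * x) := by gcongr
        _ = _ := by ring
    have h5 : 0 ≤ μ ^ 2 * (τ * b) := by positivity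
    have h6 : 0 ≤ (δ + τ) * x * μ := by positivity
    rw [abs_le]
    constructor <;> nlinarith
  · have := sq_nonneg μ
    linarith
  · have : ε ≤ 1 / (8 * τ) := min_le_left _ _
    refine le_trans ?_ hb
    calc 4 * ε ≤ 4 * (1 / (8 * τ)) := by linarith
      _ = _ := by field_simp; norm_num
  · have h1 : ε ≤ γ / 4 := min_le_right _ _
    calc 2 * ε * b ≤ 2 * (γ / 4) * τ⁻¹ := by gcongr
      _ = γ / (2 * τ) := by field_simp; norm_num
      _ ≤ d := hd

/-- Splitting off a multiple `k` of the real exponential mode, the remainder decays. -/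
theorem IsModeSolution.remainder_decay {τ δ γ x μ b d ε m : ℝ} {u : Fin 3 → ℝ → ℂ}
    (hu : IsModeSolution τ δ γ x u) (hτ : 0 < τ) (hf : IsModeFactorization τ δ γ x μ b d)
    (hμ : 0 < μ) (hε : 0 < ε) (hb : 4 * ε ≤ b) (hd : 2 * ε * b ≤ d) (hm : 0 < m)
    (hmε : 2 * m ≤ ε) (k : ℂ)
    (hk : m ≤ μ ∨ u 2 0 + b * u 1 0 + d * u 0 0 = k * ((μ ^ 2 - b * μ + d : ℝ) : ℂ)) {S : ℝ}
    (hS : ‖u 1 0 + μ * k‖ + √d * ‖u 0 0 - k‖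
      + ‖u 2 0 + b * u 1 0 + d * u 0 0 - k * ((μ ^ 2 - b * μ + d : ℝ) : ℂ)‖ ≤ S)
    {t : ℝ} (ht : 0 ≤ t) :
    √d * ‖u 0 t - k * ((Real.exp (-μ * t) : ℝ) : ℂ)‖ ≤
        Real.exp (-(m / 2) * t) * ((2 + 4 / (ε * m)) * S) ∧
      ‖u 1 t + μ * k * ((Real.exp (-μ * t) : ℝ) : ℂ)‖ ≤
        Real.exp (-(m / 2) * t) * ((2 + 4 / (ε * m)) * S) ∧
      ‖u 2 t - μ ^ 2 * k * ((Real.exp (-μ * t) : ℝ) : ℂ)‖ ≤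
        Real.exp (-(m / 2) * t) * ((1 + b + √d) * ((2 + 4 / (ε * m)) * S)) := by
  have hb0 : 0 < b := by linarith
  have hd0 : 0 < d := lt_of_lt_of_le (by positivity) hd
  have hτc : (τ : ℂ) ≠ 0 := by exact_mod_cast hτ.ne'
  have hsum : (b : ℂ) + μ = (τ : ℂ)⁻¹ := by exact_mod_cast congrArg (Complex.ofReal) hf.sum
  have hmid : (d : ℂ) + b * μ = (τ : ℂ)⁻¹ * ((γ + (δ + τ) * x : ℝ) : ℂ) := by
    have := congrArg (Complex.ofReal) hf.mid
    rw [div_eq_inv_mul] at this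
    exact_mod_cast this
  have hprod : (d : ℂ) * μ = (τ : ℂ)⁻¹ * x := by
    have := congrArg (Complex.ofReal) hf.prod
    rw [div_eq_inv_mul] at this
    exact_mod_cast this
  set D : ℂ := ((μ ^ 2 - b * μ + d : ℝ) : ℂ) with hD
  have hD' : D = (μ : ℂ) ^ 2 - b * μ + d := by rw [hD]; push_cast; ring
  set E : ℝ → ℂ := fun r ↦ ((Real.exp (-μ * r) : ℝ) : ℂ) with hE
  have hE0 : E 0 = 1 := by simp [hE]
  have hEd : ∀ r, HasDerivAt E (-(μ : ℂ) * E r) r := fun r ↦ by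
    have h1 : HasDerivAt (fun r : ℝ ↦ Real.exp (-μ * r)) (Real.exp (-μ * r) * (-μ * 1)) r :=
      ((hasDerivAt_id r).const_mul (-μ)).exp
    refine h1.ofReal_comp.congr_deriv ?_
    simp only [hE]
    push_cast
    ring
  -- Applying the quadratic factor to u leaves z' = -μz. After subtraction of k·exp(-μt), the
  -- difference v is an oscillator with force h = z - kD·exp(-μt), D being the quadratic factor at
  -- -μ.
  set z : ℝ → ℂ := fun r ↦ u 2 r + b * u 1 r + d * u 0 r with hz
  have hzd : ∀ r, HasDerivAt z (-(μ : ℂ) * z r) r := fun r ↦ by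
    refine (((hu.deriv_two r).add ((hu.deriv_one r).const_mul (b : ℂ))).add
      ((hu.deriv_zero r).const_mul (d : ℂ))).congr_deriv ?_
    simp only [hz]
    linear_combination (-(u 2 r)) * (-hsum) + u 1 r * hmid + u 0 r * hprod
  set v : ℝ → ℂ := fun r ↦ u 0 r - k * E r with hv
  set w : ℝ → ℂ := fun r ↦ u 1 r + μ * k * E r with hw
  set h : ℝ → ℂ := fun r ↦ z r - k * D * E r with hh
  have hvd : ∀ r, HasDerivAt v (w r) r := fun r ↦
    ((hu.deriv_zero r).sub ((hEd r).const_mul k)).congr_deriv (by simp only [hw]; ring)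
  have hwd : ∀ r, HasDerivAt w (h r - b • w r - d • v r) r := fun r ↦ by
    refine ((hu.deriv_one r).add ((hEd r).const_mul (μ * k))).congr_deriv ?_
    simp only [hw, hh, hv, hz, Complex.real_smul, hD']
    ring
  have hhd : ∀ r, HasDerivAt h (-μ • h r) r := fun r ↦ by
    refine ((hzd r).sub ((hEd r).const_mul (k * D))).congr_deriv ?_
    simp only [hh, Complex.real_smul]
    push_cast
    ring
  have hS' : ‖w 0‖ + √d * ‖v 0‖ + ‖h 0‖ ≤ S := by
    simpa only [hw, hv, hh, hz, hE0, mul_one] using hS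
  have hS0 : 0 ≤ S := le_trans (by positivity) hS'
  have hA : 1 ≤ 2 + 4 / (ε * m) := by
    have : 0 < 4 / (ε * m) := by positivity
    linarith
  have hexp : 0 < Real.exp (-(m / 2) * t) := Real.exp_pos _
  have main : ‖w t‖ ≤ Real.exp (-(m / 2) * t) * ((2 + 4 / (ε * m)) * S) ∧
      √d * ‖v t‖ ≤ Real.exp (-(m / 2) * t) * ((2 + 4 / (ε * m)) * S) ∧
      ‖h t‖ ≤ Real.exp (-(m / 2) * t) * S := by
    have hh0 : ‖h 0‖ ≤ S := le_trans (by
      have : 0 ≤ ‖w 0‖ + √d * ‖v 0‖ := by positivity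
      linarith) hS'
    -- Either the force decays at least at rate m, or k is the exact amplitude z(0)/D and the force
    -- vanishes identically. In the second case m may stand in for μ as the rate of the force, so a
    -- small μ does no harm.
    rcases hk with hk | hk
    · obtain ⟨h1, h2⟩ := damped_oscillator_decay hε hb hd hm hmε hk hvd hwd hhd ht
      refine ⟨h1.trans (by gcongr), h2.trans (by gcongr), ?_⟩
      have h3 : ‖h t‖ ^ 2 ≤ Real.exp (-m * t) * ‖h 0‖ ^ 2 := by
        refine le_exp_mul_of_deriv_le (fun r ↦ (hhd r).norm_sq) (fun r ↦ ?_) ht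
        rw [inner_smul_right, real_inner_self_eq_norm_sq]
        nlinarith [sq_nonneg ‖h r‖]
      have h4 : Real.exp (-m * t) = Real.exp (-(m / 2) * t) ^ 2 := by
        rw [← Real.exp_nat_mul]; congr 1; push_cast; ring
      rw [h4, ← mul_pow] at h3
      exact (abs_le_of_sq_le_sq' h3 (by positivity)).2.trans (by gcongr)
    · have hz0 : z 0 = k * D := hk
      have hhz : ∀ r, h r = 0 := by
        have hq : ∀ r, HasDerivAt (fun r ↦ h r * ((Real.exp (μ * r) : ℝ) : ℂ)) 0 r := fun r ↦ by
          have h1 : HasDerivAt (fun r : ℝ ↦ Real.exp (μ * r)) (Real.exp (μ * r) * (μ * 1)) r :=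
            ((hasDerivAt_id r).const_mul μ).exp
          refine ((hhd r).mul h1.ofReal_comp).congr_deriv ?_
          rw [Complex.real_smul]
          push_cast
          ring
        intro r
        have h2 := is_const_of_deriv_eq_zero (fun r ↦ (hq r).differentiableAt)
          (fun r ↦ (hq r).deriv) r 0
        have h3 : h 0 = 0 := by simp only [hh, hE0, hz0]; ring
        rw [h3, zero_mul] at h2
        exact (mul_eq_zero.1 h2).resolve_right (by exact_mod_cast (Real.exp_pos _).ne')
      obtain ⟨h1, h2⟩ := damped_oscillator_decay hε hb hd hm hmε le_rfl hvd hwd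
        (fun r ↦ (hhd r).congr_deriv (by simp [hhz r])) ht
      refine ⟨h1.trans (by gcongr), h2.trans (by gcongr), ?_⟩
      rw [hhz t, norm_zero]
      positivity
  obtain ⟨h1, h2, h3⟩ := main
  refine ⟨h2, h1, ?_⟩
  -- The second derivative is read off from the oscillator equation; this costs the factor 1 + b +
  -- √d.
  have h4 : u 2 t - μ ^ 2 * k * E t = h t - b * w t - d * v t := by
    simp only [hh, hz, hw, hv, hD']
    ring
  rw [h4]
  set B := Real.exp (-(m / 2) * t) * ((2 + 4 / (ε * m)) * S) with hB
  have hB3 : ‖h t‖ ≤ B := h3.trans (by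
    rw [hB]; gcongr; exact le_mul_of_one_le_left hS0 hA)
  calc ‖h t - b * w t - d * v t‖ ≤ ‖h t‖ + ‖(b : ℂ) * w t‖ + ‖(d : ℂ) * v t‖ :=
        (norm_sub_le _ _).trans (add_le_add_left (norm_sub_le _ _) _)
    _ = ‖h t‖ + b * ‖w t‖ + √d * (√d * ‖v t‖) := by
        rw [norm_mul, norm_mul, Complex.norm_real, Complex.norm_real, Real.norm_of_nonneg hb0.le,
          Real.norm_of_nonneg hd0.le, ← mul_assoc √d, Real.mul_self_sqrt hd0.le]
    _ ≤ B + b * B + √d * B := by gcongr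
    _ = _ := by rw [hB]; ring

end ModeEquation

/-! ### Exponential decay of modes away from frequency zero. -/

section ModeEstimates

theorem norm_le_of_norm_sub_le {A B : ℂ} {p q : ℝ} (h : ‖A - B‖ ≤ p) (hB : ‖B‖ ≤ q) :
    ‖A‖ ≤ p + q := by
  have := norm_add_le (A - B) B
  rw [sub_add_cancel] at this
  linarith

set_option maxHeartbeats 400000 in
/-- Exponential decay of the modes at large frequencies. -/
theorem exists_mode_decay_of_large {τ δ γ : ℝ} (hτ : 0 < τ) (hδ : 0 < δ) (hγ : 0 < γ) :
    ∃ N C c : ℝ, 0 < N ∧ 0 < C ∧ 0 < c ∧ ∀ ρ : ℝ, N ≤ ρ → ∀ u : Fin 3 → ℝ → ℂ,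
      IsModeSolution τ δ γ (ρ ^ 2) u → ∀ t : ℝ, 0 ≤ t →
      ρ ^ 2 * ‖u 0 t‖ ≤
          C * Real.exp (-c * t) * (ρ ^ 2 * ‖u 0 0‖ + ρ * ‖u 1 0‖ + ‖u 2 0‖) ∧
        ρ * ‖u 1 t‖ ≤ C * Real.exp (-c * t) * (ρ * ‖u 0 0‖ + ρ * ‖u 1 0‖ + ‖u 2 0‖) ∧
        ‖u 2 t‖ ≤ C * Real.exp (-c * t) * (ρ * ‖u 0 0‖ + ρ * ‖u 1 0‖ + ‖u 2 0‖) := by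
  obtain ⟨Q, ε, m, hQ, hε, hm, hmε, H⟩ := exists_isModeFactorization_high hτ hδ hγ one_pos
  -- Beyond N one has ρ ≥ 2/τ, hence bμ ≤ ρ²/4 and D ≥ ρ²/2, which controls k = z/D.
  set N : ℝ := 1 + 2 / τ with hN
  set ι : ℝ := τ⁻¹ with hι
  have hι0 : 0 < ι := by positivity
  set A : ℝ := 2 + 4 / (ε * m) with hA
  have hA0 : 0 < A := by positivity
  set B : ℝ := 2 * (1 + ι + Q) with hB
  have hB0 : 0 < B := by positivity
  set F : ℝ := 1 + ι * B + (1 + Q) * (2 * (1 + ι + 2 * ι ^ 2)) with hF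
  have hF0 : 0 < F := by positivity
  refine ⟨N, A * F * (3 + ι + Q) + B * (1 + ι + ι ^ 2), m / 2, by positivity, by positivity,
    by positivity, fun ρ hρN u hu t ht ↦ ?_⟩
  have hτ2 : 0 < 2 / τ := by positivity
  have hρ1 : 1 ≤ ρ := by linarith
  have hρ0 : 0 < ρ := by linarith
  have hρ2 : 1 ≤ ρ ^ 2 := one_le_pow₀ hρ1
  obtain ⟨μ, b, d, hf, hμ, hb, hxd, hdQ, hεb, hεd, hmμ⟩ := H (ρ ^ 2) hρ2
  have hμι : μ ≤ ι := by linarith [hf.sum]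
  have hbι : b ≤ ι := by linarith [hf.sum]
  have hd0 : 0 < d := lt_of_lt_of_le (by positivity) hxd
  have hsd1 : ρ ≤ √d := Real.le_sqrt_of_sq_le hxd
  have hsd2 : √d ≤ (1 + Q) * ρ := by
    refine Real.sqrt_le_iff.2 ⟨by positivity, hdQ.trans ?_⟩
    rw [mul_pow]
    gcongr
    linarith [sq_nonneg Q]
  have hD : ρ ^ 2 / 2 ≤ μ ^ 2 - b * μ + d := by
    have h1 : b * μ ≤ ι * ι := by gcongr
    have h2 : 2 * ι ≤ ρ := by
      have : 2 / τ = 2 * ι := by rw [hι]; ring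
      linarith
    have h3 : (2 * ι) ^ 2 ≤ ρ ^ 2 := by gcongr
    linarith [sq_nonneg μ]
  have hDpos : 0 < μ ^ 2 - b * μ + d := lt_of_lt_of_le (by positivity) hD
  set Dr : ℝ := μ ^ 2 - b * μ + d with hDr
  have hDc : (Dr : ℂ) ≠ 0 := by exact_mod_cast hDpos.ne'
  set z : ℂ := u 2 0 + b * u 1 0 + d * u 0 0 with hz
  set k : ℂ := z / Dr with hk
  have hkD : z = k * Dr := by rw [hk, div_mul_cancel₀ _ hDc]
  set α := ‖u 0 0‖ with hα
  set β := ‖u 1 0‖ with hβ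
  set ζ := ‖u 2 0‖ with hζ
  have hα0 : 0 ≤ α := norm_nonneg _
  have hβ0 : 0 ≤ β := norm_nonneg _
  have hζ0 : 0 ≤ ζ := norm_nonneg _
  set T := ρ * α + ρ * β + ζ with hT
  have hT0 : 0 ≤ T := by positivity
  have hραT : ρ * α ≤ T := by
    have : 0 ≤ ρ * β := by positivity
    linarith
  have hαρ : α ≤ ρ * α := le_mul_of_one_le_left hα0 hρ1
  have hβρ : β ≤ ρ * β := le_mul_of_one_le_left hβ0 hρ1
  have hnz : ‖z‖ ≤ ζ + ι * β + Q * ρ ^ 2 * α := by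
    refine (norm_add₃_le).trans ?_
    rw [norm_mul, norm_mul, Complex.norm_real, Complex.norm_real, Real.norm_of_nonneg hb.le,
      Real.norm_of_nonneg hd0.le]
    gcongr
  have hnk : ρ ^ 2 * ‖k‖ ≤ 2 * ‖z‖ := by
    have h1 : ‖z‖ = ‖k‖ * Dr := by
      rw [hkD, norm_mul, Complex.norm_real, Real.norm_of_nonneg hDpos.le]
    rw [h1]
    linarith [mul_le_mul_of_nonneg_left hD (norm_nonneg k)]
  have hk2 : ρ ^ 2 * ‖k‖ ≤ B * (ρ ^ 2 * α + β + ζ) := by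
    refine hnk.trans ?_
    have h1 : 0 ≤ ρ ^ 2 * α := by positivity
    have : 0 ≤ ι * ζ := by positivity
    have : 0 ≤ Q * ζ := by positivity
    have : 0 ≤ Q * β := by positivity
    have : 0 ≤ ι * (ρ ^ 2 * α) := by positivity
    rw [hB]
    linarith
  have hk1 : ρ * ‖k‖ ≤ B * T := by
    have h1 : ρ * (ρ * ‖k‖) ≤ ρ * (B * T) := by
      calc ρ * (ρ * ‖k‖) = ρ ^ 2 * ‖k‖ := by ring
        _ ≤ B * (ρ ^ 2 * α + β + ζ) := hk2
        _ ≤ B * (ρ * T) := by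
            gcongr
            have : ζ ≤ ρ * ζ := le_mul_of_one_le_left hζ0 hρ1
            have : ρ * β ≤ ρ * (ρ * β) := le_mul_of_one_le_left (by positivity) hρ1
            rw [hT]
            linarith
        _ = ρ * (B * T) := by ring
    exact le_of_mul_le_mul_left h1 hρ0
  -- In (u(0) - k)D the term d·u(0) cancels, so u(0) - k is O(ρ⁻²) relative to the data. This saves
  -- one power of ρ on `u 0 0` in the bounds for `u 1` and `u 2`, and is the source of the index
  -- max{1, 2-j}.
  have hv0 : ρ * (√d * ‖u 0 0 - k‖) ≤ (1 + Q) * (2 * (1 + ι + 2 * ι ^ 2)) * T := by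
    have h1 : (u 0 0 - k) * Dr = (μ ^ 2 - b * μ : ℂ) * u 0 0 - b * u 1 0 - u 2 0 := by
      rw [sub_mul, ← hkD, hz, hDr]
      push_cast
      ring
    have h2 : ‖u 0 0 - k‖ * Dr ≤ 2 * ι ^ 2 * α + ι * β + ζ := by
      have h3 : ‖u 0 0 - k‖ * Dr = ‖(u 0 0 - k) * Dr‖ := by
        rw [norm_mul, Complex.norm_real, Real.norm_of_nonneg hDpos.le]
      rw [h3, h1]
      refine (norm_sub_le _ _).trans (add_le_add ((norm_sub_le _ _).trans (add_le_add ?_ ?_)) le_rfl)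
      · rw [norm_mul]
        gcongr
        refine (norm_sub_le _ _).trans ?_
        rw [norm_pow, norm_mul, Complex.norm_real, Complex.norm_real, Real.norm_of_nonneg hb.le,
          Real.norm_of_nonneg hμ.le]
        have : μ ^ 2 ≤ ι ^ 2 := by gcongr
        have : b * μ ≤ ι * ι := by gcongr
        linarith
      · rw [norm_mul, Complex.norm_real, Real.norm_of_nonneg hb.le]
        gcongr
    have h4 : ρ ^ 2 * ‖u 0 0 - k‖ ≤ 2 * (2 * ι ^ 2 * α + ι * β + ζ) := by
      linarith [mul_le_mul_of_nonneg_left hD (norm_nonneg (u 0 0 - k))]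
    calc ρ * (√d * ‖u 0 0 - k‖) ≤ ρ * ((1 + Q) * ρ * ‖u 0 0 - k‖) := by gcongr
      _ = (1 + Q) * (ρ ^ 2 * ‖u 0 0 - k‖) := by ring
      _ ≤ (1 + Q) * (2 * (2 * ι ^ 2 * α + ι * β + ζ)) := by gcongr
      _ ≤ (1 + Q) * (2 * ((1 + ι + 2 * ι ^ 2) * T)) := by
          gcongr
          have h5 : 2 * ι ^ 2 * α ≤ 2 * ι ^ 2 * (ρ * α) := by gcongr
          have h6 : ι * β ≤ ι * (ρ * β) := by gcongr
          have h7 : 0 ≤ ι * (ρ * α) := by positivity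
          have h8 : 0 ≤ ι * ζ := by positivity
          have h9 : 0 ≤ 2 * ι ^ 2 * (ρ * β) := by positivity
          have h10 : 0 ≤ 2 * ι ^ 2 * ζ := by positivity
          have h11 : 0 ≤ ρ * α := by positivity
          have h12 : 0 ≤ ρ * β := by positivity
          rw [hT]
          linarith
      _ = _ := by ring
  have hw0 : ρ * ‖u 1 0 + μ * k‖ ≤ (1 + ι * B) * T := by
    calc ρ * ‖u 1 0 + μ * k‖ ≤ ρ * (β + ι * ‖k‖) := by
          gcongr
          refine (norm_add_le _ _).trans (add_le_add le_rfl ?_)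
          rw [norm_mul, Complex.norm_real, Real.norm_of_nonneg hμ.le]
          gcongr
      _ = ρ * β + ι * (ρ * ‖k‖) := by ring
      _ ≤ T + ι * (B * T) := by
          gcongr
          have : 0 ≤ ρ * α := by positivity
          linarith
      _ = _ := by ring
  set S := ‖u 1 0 + μ * k‖ + √d * ‖u 0 0 - k‖ with hSdef
  have hS0 : 0 ≤ S := by positivity
  have hρS : ρ * S ≤ F * T := by
    rw [hSdef, mul_add, hF]
    linarith
  obtain ⟨E0, E1, E2⟩ := hu.remainder_decay hτ hf hμ hε hεb hεd hm hmε k (Or.inr hkD)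
    (S := S) (by rw [← hz, hkD, sub_self, norm_zero, add_zero]) ht
  set X := Real.exp (-(m / 2) * t) with hX
  have hX0 : 0 < X := Real.exp_pos _
  have hEX : ‖((Real.exp (-μ * t) : ℝ) : ℂ)‖ ≤ X := by
    rw [Complex.norm_real, Real.norm_of_nonneg (Real.exp_pos _).le]
    exact Real.exp_le_exp.2 (mul_le_mul_of_nonneg_right (by linarith) ht)
  have hAS : ρ * (X * (A * S)) ≤ X * (A * (F * T)) := by
    calc ρ * (X * (A * S)) = X * (A * (ρ * S)) := by ring
      _ ≤ _ := by gcongr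
  have hAF : 0 ≤ A * F := by positivity
  have hBpos : 0 ≤ B * (1 + ι + ι ^ 2) := by positivity
  refine ⟨?_, ?_, ?_⟩
  · set T' := ρ ^ 2 * α + ρ * β + ζ with hT'
    have hTT' : T ≤ T' := by
      have : ρ * α ≤ ρ * (ρ * α) := le_mul_of_one_le_left (by positivity) hρ1
      rw [hT, hT']
      linarith
    have hT'0 : 0 ≤ T' := hT0.trans hTT'
    have h1 := norm_le_of_norm_sub_le le_rfl
      (show ‖k * ((Real.exp (-μ * t) : ℝ) : ℂ)‖ ≤ ‖k‖ * X by rw [norm_mul]; gcongr) (A := u 0 t)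
    calc ρ ^ 2 * ‖u 0 t‖
        ≤ ρ ^ 2 * (‖u 0 t - k * ((Real.exp (-μ * t) : ℝ) : ℂ)‖ + ‖k‖ * X) := by gcongr
      _ = ρ * (ρ * ‖u 0 t - k * ((Real.exp (-μ * t) : ℝ) : ℂ)‖) + ρ ^ 2 * ‖k‖ * X := by ring
      _ ≤ ρ * (√d * ‖u 0 t - k * ((Real.exp (-μ * t) : ℝ) : ℂ)‖)
          + B * (ρ ^ 2 * α + β + ζ) * X := by gcongr
      _ ≤ ρ * (X * (A * S)) + B * T' * X := by
          gcongr
          rw [hT']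
          linarith
      _ ≤ X * (A * (F * T')) + B * T' * X := add_le_add (hAS.trans (by gcongr)) le_rfl
      _ = (A * F * 1 + B * 1) * X * T' := by ring
      _ ≤ (A * F * (3 + ι + Q) + B * (1 + ι + ι ^ 2)) * X * T' := by
          gcongr
          · linarith
          · linarith [sq_nonneg ι]
  · have h1 := norm_le_of_norm_sub_le (p := X * (A * S)) (A := u 1 t) (B := -(μ * k * ((Real.exp (-μ * t) : ℝ) : ℂ)))
      (by rw [sub_neg_eq_add]; exact E1)
      (show _ ≤ ι * ‖k‖ * X by
        rw [norm_neg, norm_mul, norm_mul, Complex.norm_real, Real.norm_of_nonneg hμ.le]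
        gcongr)
    calc ρ * ‖u 1 t‖ ≤ ρ * (X * (A * S) + ι * ‖k‖ * X) := by gcongr
      _ = ρ * (X * (A * S)) + ι * (ρ * ‖k‖) * X := by ring
      _ ≤ X * (A * (F * T)) + ι * (B * T) * X := by gcongr
      _ = (A * F * 1 + B * ι) * X * T := by ring
      _ ≤ (A * F * (3 + ι + Q) + B * (1 + ι + ι ^ 2)) * X * T := by
          gcongr
          · linarith
          · linarith [sq_nonneg ι]
  · have h1 := norm_le_of_norm_sub_le E2
      (show _ ≤ ι ^ 2 * ‖k‖ * X by
        rw [norm_mul, norm_mul, norm_pow, Complex.norm_real, Real.norm_of_nonneg hμ.le]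
        gcongr)
    have h2 : 1 + b + √d ≤ (2 + ι + Q) * ρ := by
      have : ι ≤ ι * ρ := le_mul_of_one_le_right hι0.le hρ1
      linarith
    have h3 : ‖k‖ ≤ ρ * ‖k‖ := le_mul_of_one_le_left (norm_nonneg _) hρ1
    calc ‖u 2 t‖ ≤ X * ((1 + b + √d) * (A * S)) + ι ^ 2 * ‖k‖ * X := h1
      _ ≤ X * ((2 + ι + Q) * ρ * (A * S)) + ι ^ 2 * (ρ * ‖k‖) * X := by gcongr
      _ = (2 + ι + Q) * (ρ * (X * (A * S))) + ι ^ 2 * (ρ * ‖k‖) * X := by ring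
      _ ≤ (2 + ι + Q) * (X * (A * (F * T))) + ι ^ 2 * (B * T) * X := by gcongr
      _ = (A * F * (2 + ι + Q) + B * ι ^ 2) * X * T := by ring
      _ ≤ (A * F * (3 + ι + Q) + B * (1 + ι + ι ^ 2)) * X * T := by
          gcongr
          · linarith
          · linarith

/-- Exponential decay of the modes at frequencies in a bounded range away from zero. -/
theorem exists_mode_decay_of_mem_Icc {τ δ γ e N : ℝ} (hτ : 0 < τ) (hδ : 0 < δ) (hγ : 0 < γ)
    (he : 0 < e) (hN : 0 < N) :
    ∃ C c : ℝ, 0 < C ∧ 0 < c ∧ ∀ x : ℝ, e ≤ x → x ≤ N → ∀ u : Fin 3 → ℝ → ℂ,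
      IsModeSolution τ δ γ x u → ∀ t : ℝ, 0 ≤ t → ∀ j,
      ‖u j t‖ ≤ C * Real.exp (-c * t) * (‖u 0 0‖ + ‖u 1 0‖ + ‖u 2 0‖) := by
  obtain ⟨Q, ε, m, hQ, hε, hm, hmε, H⟩ := exists_isModeFactorization_high hτ hδ hγ he
  set ι : ℝ := τ⁻¹ with hι
  have hι0 : 0 < ι := by positivity
  set A : ℝ := 2 + 4 / (ε * m) with hA
  have hA0 : 0 < A := by positivity
  set F : ℝ := 2 + ι + √(Q * N) + Q * N with hF
  have hF0 : 0 < F := by positivity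
  set s := √e with hs
  have hs0 : 0 < s := Real.sqrt_pos.2 he
  set G : ℝ := 1 / s + (1 + ι + √(Q * N)) with hG
  have hG0 : 0 < G := by positivity
  refine ⟨G * (A * F), m / 2, by positivity, by positivity, fun x hex hxN u hu t ht j ↦ ?_⟩
  obtain ⟨μ, b, d, hf, hμ, hb, hxd, hdQ, hεb, hεd, hmμ⟩ := H x hex
  have hμι : μ ≤ ι := by linarith [hf.sum]
  have hbι : b ≤ ι := by linarith [hf.sum]
  have hd0 : 0 < d := by linarith
  have hdN : d ≤ Q * N := hdQ.trans (by gcongr)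
  have hsd : √d ≤ √(Q * N) := Real.sqrt_le_sqrt hdN
  have hsd' : s ≤ √d := Real.sqrt_le_sqrt (hex.trans hxd)
  set α := ‖u 0 0‖ with hα
  set β := ‖u 1 0‖ with hβ
  set ζ := ‖u 2 0‖ with hζ
  have hα0 : 0 ≤ α := norm_nonneg _
  have hβ0 : 0 ≤ β := norm_nonneg _
  have hζ0 : 0 ≤ ζ := norm_nonneg _
  set T := α + β + ζ with hT
  have hT0 : 0 ≤ T := by positivity
  have hS : ‖u 1 0 + μ * 0‖ + √d * ‖u 0 0 - 0‖
      + ‖u 2 0 + b * u 1 0 + d * u 0 0 - 0 * ((μ ^ 2 - b * μ + d : ℝ) : ℂ)‖ ≤ F * T := by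
    rw [mul_zero, add_zero, sub_zero, zero_mul, sub_zero]
    have h1 : ‖u 2 0 + b * u 1 0 + d * u 0 0‖ ≤ ζ + ι * β + Q * N * α := by
      refine (norm_add₃_le).trans ?_
      rw [norm_mul, norm_mul, Complex.norm_real, Complex.norm_real, Real.norm_of_nonneg hb.le,
        Real.norm_of_nonneg hd0.le]
      gcongr
    have h2 : √d * ‖u 0 0‖ ≤ √(Q * N) * α := by gcongr
    have h3 : 0 ≤ Q * N * β := by positivity
    have h4 : 0 ≤ Q * N * ζ := by positivity
    have h5 : 0 ≤ ι * α := by positivity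
    have h6 : 0 ≤ ι * ζ := by positivity
    have h7 : 0 ≤ √(Q * N) * β := by positivity
    have h8 : 0 ≤ √(Q * N) * ζ := by positivity
    rw [hF, hT]
    linarith
  -- On a bounded range μ ≥ m, so no slow mode needs to be split off: k = 0.
  obtain ⟨E0, E1, E2⟩ := hu.remainder_decay hτ hf hμ hε hεb hεd hm hmε 0 (Or.inl hmμ) hS ht
  simp only [mul_zero, zero_mul, sub_zero, add_zero] at E0 E1 E2
  set X := Real.exp (-(m / 2) * t) with hX
  have hX0 : 0 < X := Real.exp_pos _
  set Y := X * (A * (F * T)) with hY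
  have hY0 : 0 ≤ Y := by positivity
  have hgoal : G * (A * F) * X * T = G * Y := by rw [hY]; ring
  rw [hgoal]
  have hq0 : 0 ≤ √(Q * N) := Real.sqrt_nonneg _
  have hs1 : 0 ≤ 1 / s := by positivity
  have h1G : 1 ≤ G := by rw [hG]; linarith
  fin_cases j
  · have h1 : s * ‖u 0 t‖ ≤ Y := (mul_le_mul_of_nonneg_right hsd' (norm_nonneg _)).trans E0
    have h2 : ‖u 0 t‖ ≤ 1 / s * Y := by
      rw [one_div, inv_mul_eq_div, le_div_iff₀ hs0, mul_comm]
      exact h1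
    refine h2.trans ?_
    gcongr
    rw [hG]
    linarith
  · exact E1.trans (le_mul_of_one_le_left hY0 h1G)
  · refine E2.trans ?_
    have : X * ((1 + b + √d) * (A * (F * T))) = (1 + b + √d) * Y := by rw [hY]; ring
    rw [this]
    gcongr
    rw [hG]
    linarith

/-- Exponential decay of the modes away from frequency zero. -/
theorem exists_mode_decay_high {τ δ γ e : ℝ} (hτ : 0 < τ) (hδ : 0 < δ) (hγ : 0 < γ)
    (he : 0 < e) :
    ∃ C c : ℝ, 0 < C ∧ 0 < c ∧ ∀ ρ : ℝ, 0 < ρ → e ≤ ρ ^ 2 → ∀ u : Fin 3 → ℝ → ℂ,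
      IsModeSolution τ δ γ (ρ ^ 2) u → ∀ t : ℝ, 0 ≤ t →
      ρ ^ 2 * ‖u 0 t‖ ≤
          C * Real.exp (-c * t) * (ρ ^ 2 * ‖u 0 0‖ + ρ * ‖u 1 0‖ + ‖u 2 0‖) ∧
        ρ * ‖u 1 t‖ ≤ C * Real.exp (-c * t) * (ρ * ‖u 0 0‖ + ρ * ‖u 1 0‖ + ‖u 2 0‖) ∧
        ‖u 2 t‖ ≤ C * Real.exp (-c * t) * (ρ * ‖u 0 0‖ + ρ * ‖u 1 0‖ + ‖u 2 0‖) := by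
  obtain ⟨N, C₁, c₁, hN, hC₁, hc₁, H₁⟩ := exists_mode_decay_of_large hτ hδ hγ
  obtain ⟨C₂, c₂, hC₂, hc₂, H₂⟩ :=
    exists_mode_decay_of_mem_Icc hτ hδ hγ he (by positivity : 0 < N ^ 2)
  -- A lower bound for the weights 1, ρ, ρ² when ρ² ≥ e, while M is an upper bound when ρ ≤ N. On
  -- the bounded range the unweighted estimate therefore implies the weighted ones.
  set l : ℝ := min 1 (min e (√e)) with hl
  have hl0 : 0 < l := by rw [hl]; positivity
  set M : ℝ := 1 + N + N ^ 2 with hM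
  have hM0 : 0 < M := by positivity
  refine ⟨C₁ + C₂ * M / l, min c₁ c₂, by positivity, by positivity, fun ρ hρ hρe u hu t ht ↦ ?_⟩
  have hα0 : 0 ≤ ‖u 0 0‖ := norm_nonneg _
  have hβ0 : 0 ≤ ‖u 1 0‖ := norm_nonneg _
  have hζ0 : 0 ≤ ‖u 2 0‖ := norm_nonneg _
  have hexp₁ : Real.exp (-c₁ * t) ≤ Real.exp (-min c₁ c₂ * t) :=
    Real.exp_le_exp.2 (mul_le_mul_of_nonneg_right (neg_le_neg (min_le_left _ _)) ht)
  have hexp₂ : Real.exp (-c₂ * t) ≤ Real.exp (-min c₁ c₂ * t) :=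
    Real.exp_le_exp.2 (mul_le_mul_of_nonneg_right (neg_le_neg (min_le_right _ _)) ht)
  have hC : C₁ ≤ C₁ + C₂ * M / l := by
    have : 0 ≤ C₂ * M / l := by positivity
    linarith
  rcases le_total N ρ with hNρ | hNρ
  · obtain ⟨h0, h1, h2⟩ := H₁ ρ hNρ u hu t ht
    exact ⟨h0.trans (by gcongr), h1.trans (by gcongr), h2.trans (by gcongr)⟩
  · have hl1 : l ≤ 1 := min_le_left _ _
    have hlρ2 : l ≤ ρ ^ 2 := (min_le_right _ _).trans ((min_le_left _ _).trans hρe)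
    have hlρ : l ≤ ρ :=
      (min_le_right _ _).trans ((min_le_right _ _).trans (Real.sqrt_le_iff.2 ⟨hρ.le, hρe⟩))
    have hρ2 : ρ ^ 2 ≤ N ^ 2 := by gcongr
    have key : ∀ j q T, 0 ≤ q → q ≤ M →
        l * (‖u 0 0‖ + ‖u 1 0‖ + ‖u 2 0‖) ≤ T →
        q * ‖u j t‖ ≤ (C₁ + C₂ * M / l) * Real.exp (-min c₁ c₂ * t) * T := by
      intro j q T hq hqM hT
      have hT0 : 0 ≤ T := le_trans (by positivity) hT
      calc q * ‖u j t‖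
          ≤ M * (C₂ * Real.exp (-c₂ * t) * (‖u 0 0‖ + ‖u 1 0‖ + ‖u 2 0‖)) := by
            gcongr
            exact H₂ _ hρe hρ2 u hu t ht j
        _ = C₂ * M / l * Real.exp (-c₂ * t) * (l * (‖u 0 0‖ + ‖u 1 0‖ + ‖u 2 0‖)) := by
            field_simp
        _ ≤ _ := by
            gcongr
            linarith
    have a0 := mul_le_mul_of_nonneg_right hlρ2 hα0
    have a1 := mul_le_mul_of_nonneg_right hlρ hα0
    have a2 := mul_le_mul_of_nonneg_right hlρ hβ0
    have a3 := mul_le_mul_of_nonneg_right hl1 hζ0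
    refine ⟨key 0 _ _ (by positivity) ?_ (by linarith), key 1 _ _ hρ.le ?_ (by linarith), ?_⟩
    · rw [hM]; linarith
    · rw [hM]; nlinarith
    · have := key 2 1 _ zero_le_one ?_ (by linarith : _ ≤ ρ * ‖u 0 0‖ + ρ * ‖u 1 0‖ + ‖u 2 0‖)
      · rwa [one_mul] at this
      · rw [hM]; nlinarith

end ModeEstimates

/-! ### Diffusive asymptotics of the modes at low frequency. -/

section ModeAsymptotics

theorem abs_exp_neg_sub_exp_neg_le {a b l : ℝ} (ha : l ≤ a) (hb : l ≤ b) :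
    |Real.exp (-a) - Real.exp (-b)| ≤ |a - b| * Real.exp (-l) := by
  wlog hab : a ≤ b generalizing a b with H
  · rw [abs_sub_comm, abs_sub_comm a b]
    exact H hb ha (le_of_not_ge hab)
  have h1 : Real.exp (-b) ≤ Real.exp (-a) := Real.exp_le_exp.2 (by linarith)
  rw [abs_of_nonneg (by linarith), abs_of_nonpos (by linarith)]
  have h2 : Real.exp (-b) = Real.exp (-a) * Real.exp (a - b) := by
    rw [← Real.exp_add]; congr 1; ring
  have h3 := Real.add_one_le_exp (a - b)
  have h4 : Real.exp (-a) ≤ Real.exp (-l) := Real.exp_le_exp.2 (by linarith)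
  calc Real.exp (-a) - Real.exp (-b) = Real.exp (-a) * (1 - Real.exp (a - b)) := by rw [h2]; ring
    _ ≤ Real.exp (-a) * (-(a - b)) := by gcongr; linarith
    _ ≤ Real.exp (-l) * (-(a - b)) := by gcongr; linarith
    _ = _ := by ring

/-- Comparison of the slow mode with the diffusive one, in scalar form. -/
theorem slow_mode_sub_diffusive_le {γ K x μ t : ℝ} (hγ : 0 < γ) (hK : 0 < K) (hx : 0 < x)
    (hμ1 : x / (2 * γ) ≤ μ) (hμ2 : μ ≤ 2 / γ * x) (hμ3 : |μ - x / γ| ≤ K * x ^ 2)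
    (ht : 0 ≤ t) (j : Fin 3) :
    |(-μ) ^ (j : ℕ) * Real.exp (-μ * t) - (-(x / γ)) ^ (j : ℕ) * Real.exp (-(x / γ) * t)| ≤
      (K * (1 + 3 / γ) + (1 + 1 / γ + 1 / γ ^ 2) * (4 * γ * K)) *
        (x ^ ((j : ℕ) + 1) * Real.exp (-(1 / (4 * γ)) * x * t)) := by
  set ν := x / γ with hν
  have hν0 : 0 < ν := by positivity
  have hμ0 : 0 < μ := lt_of_lt_of_le (by positivity) hμ1
  set X := Real.exp (-(1 / (4 * γ)) * x * t) with hX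
  have hX0 : 0 < X := Real.exp_pos _
  have hl : x / (2 * γ) ≤ ν := by
    rw [hν]; gcongr; linarith
  -- The decay exp(-xt/(2γ)) is split into two equal factors X: one absorbs the factor xt produced
  -- by the difference of the exponents, the other is kept.
  have hXX : Real.exp (-(x / (2 * γ) * t)) = X * X := by
    rw [hX, ← Real.exp_add]; congr 1; field_simp; ring
  have hX1 : X ≤ 1 := by
    rw [hX, Real.exp_le_one_iff, neg_mul, neg_mul, neg_nonpos]; positivity
  have hEμ : Real.exp (-μ * t) ≤ X := by
    have h1 : Real.exp (-μ * t) ≤ Real.exp (-(x / (2 * γ) * t)) := by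
      rw [neg_mul]
      exact Real.exp_le_exp.2 (neg_le_neg (mul_le_mul_of_nonneg_right hμ1 ht))
    rw [hXX] at h1
    exact h1.trans (mul_le_of_le_one_right hX0.le hX1)
  have hdiff : |Real.exp (-μ * t) - Real.exp (-ν * t)| ≤ 4 * γ * K * x * X := by
    have h1 := abs_exp_neg_sub_exp_neg_le (mul_le_mul_of_nonneg_right hμ1 ht)
      (mul_le_mul_of_nonneg_right hl ht)
    rw [← neg_mul, ← neg_mul, ← sub_mul, abs_mul, abs_of_nonneg ht, hXX] at h1
    have h2 : x * t * X ≤ 4 * γ := by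
      have h3 := Real.add_one_le_exp (1 / (4 * γ) * x * t)
      have h4 : X * Real.exp (1 / (4 * γ) * x * t) = 1 := by
        rw [hX, ← Real.exp_add]; simp
      have h5 : x * t = 4 * γ * (1 / (4 * γ) * x * t) := by field_simp
      calc x * t * X = 4 * γ * (X * (1 / (4 * γ) * x * t)) := by rw [h5]; ring
        _ ≤ 4 * γ * (X * Real.exp (1 / (4 * γ) * x * t)) := by gcongr; linarith
        _ = 4 * γ := by rw [h4, mul_one]
    calc _ ≤ |μ - ν| * t * (X * X) := h1
      _ ≤ K * x ^ 2 * t * (X * X) := by gcongr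
      _ = K * x * X * (x * t * X) := by ring
      _ ≤ K * x * X * (4 * γ) := by gcongr
      _ = _ := by ring
  have hpow : |(-μ) ^ (j : ℕ) - (-ν) ^ (j : ℕ)| ≤ K * (1 + 3 / γ) * x ^ ((j : ℕ) + 1) := by
    fin_cases j
    · simp only [pow_zero, sub_self, abs_zero]; positivity
    · simp only [pow_one]
      rw [neg_sub_neg, abs_sub_comm]
      refine hμ3.trans ?_
      have : 0 ≤ K * (3 / γ) * x ^ 2 := by positivity
      norm_num
      linarith
    · have h1 : (-μ) ^ 2 - (-ν) ^ 2 = (μ - ν) * (μ + ν) := by ring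
      simp only [h1, abs_mul]
      rw [abs_of_pos (by positivity : 0 < μ + ν)]
      have h2 : μ + ν ≤ 3 / γ * x := by
        have : ν = 1 / γ * x := by rw [hν]; ring
        have : 3 / γ * x = 2 / γ * x + 1 / γ * x := by ring
        linarith
      calc |μ - ν| * (μ + ν) ≤ K * x ^ 2 * (3 / γ * x) := by gcongr
        _ = K * (3 / γ) * x ^ 3 := by ring
        _ ≤ K * (1 + 3 / γ) * x ^ 3 := by gcongr; linarith
  have hνpow : |(-ν) ^ (j : ℕ)| ≤ (1 + 1 / γ + 1 / γ ^ 2) * x ^ (j : ℕ) := by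
    rw [abs_pow, abs_neg, abs_of_pos hν0, hν, div_eq_mul_one_div, mul_pow, mul_comm]
    gcongr
    have h1 : 0 < 1 / γ := by positivity
    have h2 : 0 < 1 / γ ^ 2 := by positivity
    fin_cases j
    · simp only [pow_zero]; linarith
    · simp only [pow_one]; linarith
    · simp only [div_pow, one_pow]; linarith
  have hsplit : (-μ) ^ (j : ℕ) * Real.exp (-μ * t) - (-ν) ^ (j : ℕ) * Real.exp (-ν * t) =
      ((-μ) ^ (j : ℕ) - (-ν) ^ (j : ℕ)) * Real.exp (-μ * t)
        + (-ν) ^ (j : ℕ) * (Real.exp (-μ * t) - Real.exp (-ν * t)) := by ring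
  rw [hsplit]
  calc _ ≤ |(-μ) ^ (j : ℕ) - (-ν) ^ (j : ℕ)| * Real.exp (-μ * t)
        + |(-ν) ^ (j : ℕ)| * |Real.exp (-μ * t) - Real.exp (-ν * t)| := by
        refine (abs_add_le _ _).trans (le_of_eq ?_)
        rw [abs_mul, abs_mul, abs_of_pos (Real.exp_pos (-μ * t))]
    _ ≤ K * (1 + 3 / γ) * x ^ ((j : ℕ) + 1) * X
        + (1 + 1 / γ + 1 / γ ^ 2) * x ^ (j : ℕ) * (4 * γ * K * x * X) := by gcongr
    _ = _ := by ring

/-- Since τb = 1 - τμ, τd = γ + (δ+τ)x - τbμ and μ = O(x), the numerator times τ is γa₀ + a₁ + τa₂ +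
O(x), and the denominator times τ is γ + O(x). This is the origin of the combination Φ₀. -/
theorem slow_amplitude_sub_le {τ δ γ x μ b d : ℝ} (hτ : 0 < τ) (hδ : 0 < δ) (hγ : 0 < γ)
    (hx : 0 < x) (hx1 : x ≤ 1) (hf : IsModeFactorization τ δ γ x μ b d) (hμ : 0 < μ) (hb : 0 < b)
    (hμ2 : μ ≤ 2 / γ * x) (hD : γ / (2 * τ) ≤ μ ^ 2 - b * μ + d) (a₀ a₁ a₂ : ℂ) :
    ‖(a₂ + b * a₁ + d * a₀) / ((μ ^ 2 - b * μ + d : ℝ) : ℂ) - (γ * a₀ + a₁ + τ * a₂) / γ‖ ≤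
      (γ * (2 * τ / γ + (δ + τ) + 2 / γ)
        + (γ + 1 + τ) * (4 * τ / γ ^ 2 + 4 / γ + (δ + τ))) * (2 / γ ^ 2) * x *
        (‖a₀‖ + ‖a₁‖ + ‖a₂‖) := by
  set D : ℝ := μ ^ 2 - b * μ + d with hDdef
  have hτb1 : τ * b = 1 - τ * μ := by
    have := hf.sum
    field_simp at this
    linarith
  have hτd : τ * d = γ + (δ + τ) * x - τ * b * μ := by
    have := hf.mid
    field_simp at this
    linarith
  have hτb : τ * b ≤ 1 := by
    have : 0 < τ * μ := by positivity
    linarith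
  have hτb0 : 0 < τ * b := by positivity
  have hD0 : 0 < D := lt_of_lt_of_le (by positivity) hD
  have hτD : γ / 2 ≤ τ * D := by
    have := mul_le_mul_of_nonneg_left hD hτ.le
    have h2 : τ * (γ / (2 * τ)) = γ / 2 := by field_simp
    linarith
  have hα : 0 ≤ ‖a₀‖ := norm_nonneg _
  have hβ : 0 ≤ ‖a₁‖ := norm_nonneg _
  have hζ : 0 ≤ ‖a₂‖ := norm_nonneg _
  set T := ‖a₀‖ + ‖a₁‖ + ‖a₂‖ with hT
  have hT0 : 0 ≤ T := by positivity
  have hbμx : τ * b * μ ≤ 2 / γ * x := by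
    calc τ * b * μ ≤ 1 * (2 / γ * x) := by gcongr
      _ = _ := one_mul _
  have hbμ0 : 0 < τ * b * μ := by positivity
  have hδx : 0 < (δ + τ) * x := by positivity
  have h1 : ‖((-(τ * μ) : ℝ) : ℂ) * a₁ + (((δ + τ) * x - τ * b * μ : ℝ) : ℂ) * a₀‖ ≤
      (2 * τ / γ + (δ + τ) + 2 / γ) * x * T := by
    refine (norm_add_le _ _).trans ?_
    rw [norm_mul, norm_mul, Complex.norm_real, Complex.norm_real, Real.norm_eq_abs,
      Real.norm_eq_abs, abs_neg, abs_of_pos (by positivity : 0 < τ * μ)]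
    have h2 : τ * μ ≤ 2 * τ / γ * x := by
      calc τ * μ ≤ τ * (2 / γ * x) := by gcongr
        _ = _ := by ring
    have h3 : |(δ + τ) * x - τ * b * μ| ≤ (δ + τ) * x + 2 / γ * x := by
      rw [abs_le]; constructor <;> linarith
    have hαT : ‖a₀‖ ≤ T := by rw [hT]; linarith
    have hβT : ‖a₁‖ ≤ T := by rw [hT]; linarith
    calc _ ≤ 2 * τ / γ * x * T + ((δ + τ) * x + 2 / γ * x) * T := by gcongr
      _ = _ := by ring
  have h2 : |τ * D - γ| ≤ (4 * τ / γ ^ 2 + 4 / γ + (δ + τ)) * x := by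
    have h3 : τ * D - γ = τ * μ ^ 2 + (δ + τ) * x - 2 * (τ * b * μ) := by
      rw [hDdef]; linear_combination hτd
    have h4 : τ * μ ^ 2 ≤ 4 * τ / γ ^ 2 * x := by
      calc τ * μ ^ 2 ≤ τ * (2 / γ * x) ^ 2 := by gcongr
        _ = 4 * τ / γ ^ 2 * (x * x) := by ring
        _ ≤ 4 * τ / γ ^ 2 * x := by gcongr; exact mul_le_of_le_one_left hx.le hx1
    have h5 : 0 < τ * μ ^ 2 := by positivity
    have h6 : (4 * τ / γ ^ 2 + 4 / γ + (δ + τ)) * x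
        = 4 * τ / γ ^ 2 * x + 2 * (2 / γ * x) + (δ + τ) * x := by ring
    rw [h3, h6, abs_le]
    constructor <;> linarith
  have hW : ‖γ * a₀ + a₁ + τ * a₂‖ ≤ (γ + 1 + τ) * T := by
    refine (norm_add₃_le).trans ?_
    rw [norm_mul, norm_mul, Complex.norm_real, Complex.norm_real, Real.norm_of_nonneg hγ.le,
      Real.norm_of_nonneg hτ.le, hT]
    have : 0 ≤ γ * ‖a₁‖ := by positivity
    have : 0 ≤ γ * ‖a₂‖ := by positivity
    have : 0 ≤ τ * ‖a₁‖ := by positivity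
    have : 0 ≤ τ * ‖a₀‖ := by positivity
    linarith
  have hDc : (D : ℂ) ≠ 0 := by exact_mod_cast hD0.ne'
  have hγc : (γ : ℂ) ≠ 0 := by exact_mod_cast hγ.ne'
  have hτc : (τ : ℂ) ≠ 0 := by exact_mod_cast hτ.ne'
  have hz : (τ : ℂ) * (a₂ + b * a₁ + d * a₀) - (γ * a₀ + a₁ + τ * a₂) =
      ((-(τ * μ) : ℝ) : ℂ) * a₁ + (((δ + τ) * x - τ * b * μ : ℝ) : ℂ) * a₀ := by
    have e1 : (τ : ℂ) * b = 1 - τ * μ := by exact_mod_cast congrArg Complex.ofReal hτb1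
    have e2 : (τ : ℂ) * d = γ + (δ + τ) * x - τ * b * μ := by
      exact_mod_cast congrArg Complex.ofReal hτd
    push_cast
    linear_combination a₁ * e1 + a₀ * e2
  have hkey : (a₂ + b * a₁ + d * a₀) / (D : ℂ) - (γ * a₀ + a₁ + τ * a₂) / γ =
      (γ * (((-(τ * μ) : ℝ) : ℂ) * a₁ + (((δ + τ) * x - τ * b * μ : ℝ) : ℂ) * a₀)
        - (γ * a₀ + a₁ + τ * a₂) * ((τ * D - γ : ℝ) : ℂ)) / ((γ * (τ * D) : ℝ) : ℂ) := by
    rw [← hz]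
    push_cast
    field_simp
    ring
  rw [hkey, norm_div, Complex.norm_real, Real.norm_of_nonneg (by positivity)]
  have hden : γ ^ 2 / 2 ≤ γ * (τ * D) := by
    have := mul_le_mul_of_nonneg_left hτD hγ.le
    linarith
  rw [div_le_iff₀ (by positivity)]
  set P := γ * (2 * τ / γ + (δ + τ) + 2 / γ)
        + (γ + 1 + τ) * (4 * τ / γ ^ 2 + 4 / γ + (δ + τ)) with hP
  have hP0 : 0 < P := by positivity
  calc _ ≤ γ * ((2 * τ / γ + (δ + τ) + 2 / γ) * x * T)
        + (γ + 1 + τ) * T * ((4 * τ / γ ^ 2 + 4 / γ + (δ + τ)) * x) := by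
        refine (norm_sub_le _ _).trans (add_le_add ?_ ?_)
        · rw [norm_mul, Complex.norm_real, Real.norm_of_nonneg hγ.le]
          gcongr
        · rw [norm_mul, Complex.norm_real, Real.norm_eq_abs]
          gcongr
    _ = P * (2 / γ ^ 2) * x * T * (γ ^ 2 / 2) := by rw [hP]; field_simp
    _ ≤ P * (2 / γ ^ 2) * x * T * (γ * (τ * D)) := by gcongr

set_option maxHeartbeats 1000000 in
/-- Low frequency modes are diffusive up to a higher power of the frequency and an exponentially
decaying remainder. -/
theorem exists_mode_asymptotics_low {τ δ γ : ℝ} (hτ : 0 < τ) (hδ : 0 < δ) (hγ : 0 < γ) :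
    ∃ e C c : ℝ, 0 < e ∧ e ≤ 1 ∧ 0 < C ∧ 0 < c ∧ ∀ x : ℝ, 0 < x → x ≤ e →
      ∀ u : Fin 3 → ℝ → ℂ, IsModeSolution τ δ γ x u → ∀ t : ℝ, 0 ≤ t → ∀ j : Fin 3,
      ‖u j t - (((-(x / γ)) ^ (j : ℕ) * Real.exp (-(x / γ) * t) : ℝ) : ℂ) *
          ((γ * u 0 0 + u 1 0 + τ * u 2 0) / γ)‖ ≤
        C * (x ^ ((j : ℕ) + 1) * Real.exp (-c * x * t) + Real.exp (-c * t)) *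
          (‖u 0 0‖ + ‖u 1 0‖ + ‖u 2 0‖) := by
  obtain ⟨e, K, ε, he, he1, hK, hε, H⟩ := exists_isModeFactorization_low hτ hδ hγ
  set P : ℝ := (γ * (2 * τ / γ + (δ + τ) + 2 / γ)
        + (γ + 1 + τ) * (4 * τ / γ ^ 2 + 4 / γ + (δ + τ))) * (2 / γ ^ 2) with hP
  have hP0 : 0 < P := by positivity
  set W : ℝ := (γ + 1 + τ) / γ with hW
  have hW0 : 0 < W := by positivity
  set q : ℝ := √((γ + (δ + τ)) / τ) with hq
  have hq0 : 0 ≤ q := Real.sqrt_nonneg _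
  set F : ℝ := 1 + 2 / γ * (P + W) + q * (1 + (P + W)) with hF
  have hF0 : 0 < F := by positivity
  set A : ℝ := 2 + 4 / (ε * (ε / 2)) with hA
  have hA0 : 0 < A := by positivity
  set s : ℝ := √(γ / (2 * τ)) with hs
  have hs0 : 0 < s := Real.sqrt_pos.2 (by positivity)
  set G : ℝ := 1 / s + (1 + τ⁻¹ + q) with hG
  have hG0 : 0 < G := by positivity
  set R : ℝ := K * (1 + 3 / γ) + (1 + 1 / γ + 1 / γ ^ 2) * (4 * γ * K) with hR
  have hR0 : 0 < R := by positivity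
  set Z : ℝ := 1 + 2 / γ + 4 / γ ^ 2 with hZ
  have hZ0 : 0 < Z := by positivity
  set c : ℝ := min (ε / 4) (1 / (4 * γ)) with hc
  have hc0 : 0 < c := by rw [hc]; positivity
  refine ⟨e, G * (A * F) + Z * P + R * W, c, he, he1, by positivity, hc0,
    fun x hx hxe u hu t ht j ↦ ?_⟩
  obtain ⟨μ, b, d, hf, hμ, hb, hμ1, hμ2, hμ3, hD, hdlow, hεb, hεd⟩ := H x hx hxe
  have hx1 : x ≤ 1 := hxe.trans he1
  have hkk := slow_amplitude_sub_le hτ hδ hγ hx hx1 hf hμ hb hμ2 hD (u 0 0) (u 1 0) (u 2 0)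
  rw [← hP] at hkk
  have hslow := slow_mode_sub_diffusive_le hγ hK hx hμ1 hμ2 hμ3 ht j
  rw [← hR] at hslow
  set Dr : ℝ := μ ^ 2 - b * μ + d with hDr
  have hDpos : 0 < Dr := lt_of_lt_of_le (by positivity) hD
  have hDc : (Dr : ℂ) ≠ 0 := by exact_mod_cast hDpos.ne'
  set z : ℂ := u 2 0 + b * u 1 0 + d * u 0 0 with hz
  set k : ℂ := z / Dr with hk
  have hkD : z = k * Dr := by rw [hk, div_mul_cancel₀ _ hDc]
  set k₀ : ℂ := (γ * u 0 0 + u 1 0 + τ * u 2 0) / γ with hk₀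
  have hα : 0 ≤ ‖u 0 0‖ := norm_nonneg _
  have hβ : 0 ≤ ‖u 1 0‖ := norm_nonneg _
  have hζ : 0 ≤ ‖u 2 0‖ := norm_nonneg _
  set T := ‖u 0 0‖ + ‖u 1 0‖ + ‖u 2 0‖ with hT
  have hT0 : 0 ≤ T := by positivity
  have hk₀T : ‖k₀‖ ≤ W * T := by
    rw [hk₀, norm_div, Complex.norm_real, Real.norm_of_nonneg hγ.le, hW, div_mul_eq_mul_div]
    gcongr
    refine (norm_add₃_le).trans ?_
    rw [norm_mul, norm_mul, Complex.norm_real, Complex.norm_real, Real.norm_of_nonneg hγ.le,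
      Real.norm_of_nonneg hτ.le, hT]
    have : 0 ≤ γ * ‖u 1 0‖ := by positivity
    have : 0 ≤ γ * ‖u 2 0‖ := by positivity
    have : 0 ≤ τ * ‖u 1 0‖ := by positivity
    have : 0 ≤ τ * ‖u 0 0‖ := by positivity
    linarith
  have hkT : ‖k‖ ≤ (P + W) * T := by
    have h1 := norm_le_of_norm_sub_le hkk hk₀T
    have h2 : P * x * T ≤ P * 1 * T := by gcongr
    linarith
  have hd0 : 0 < d := lt_of_lt_of_le (by positivity) hdlow
  have hdq : √d ≤ q := by
    refine Real.sqrt_le_sqrt ((hf.d_le hμ hb).trans ?_)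
    gcongr
    exact mul_le_of_le_one_right (by positivity) hx1
  have hsd : s ≤ √d := Real.sqrt_le_sqrt hdlow
  have hbτ : b ≤ τ⁻¹ := by linarith [hf.sum]
  have hμγ : μ ≤ 2 / γ := hμ2.trans (mul_le_of_le_one_right (by positivity) hx1)
  have hS : ‖u 1 0 + μ * k‖ + √d * ‖u 0 0 - k‖ + ‖z - k * (Dr : ℂ)‖ ≤ F * T := by
    rw [hkD, sub_self, norm_zero, add_zero]
    have h1 : ‖u 1 0 + μ * k‖ ≤ ‖u 1 0‖ + 2 / γ * ((P + W) * T) := by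
      refine (norm_add_le _ _).trans (add_le_add le_rfl ?_)
      rw [norm_mul, Complex.norm_real, Real.norm_of_nonneg hμ.le]
      gcongr
    have h2 : √d * ‖u 0 0 - k‖ ≤ q * (T + (P + W) * T) := by
      gcongr
      refine (norm_sub_le _ _).trans (add_le_add ?_ hkT)
      linarith
    have h3 : ‖u 1 0‖ ≤ T := by linarith
    have h4 : F * T = T + 2 / γ * ((P + W) * T) + q * (T + (P + W) * T) := by rw [hF]; ring
    linarith
  -- Here μ is of order x and cannot serve as a uniform rate, so the exact amplitude k = z/D is
  -- subtracted and the oscillator alone fixes the rate ε/4.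
  obtain ⟨E0, E1, E2⟩ := hu.remainder_decay hτ hf hμ hε hεb hεd (m := ε / 2) (by positivity)
    (by linarith) k (Or.inr hkD) hS ht
  rw [← hA] at E0 E1 E2
  have hexp1 : Real.exp (-(ε / 2 / 2) * t) ≤ Real.exp (-c * t) := by
    refine Real.exp_le_exp.2 (mul_le_mul_of_nonneg_right (neg_le_neg ?_) ht)
    refine (min_le_left _ _).trans (by linarith)
  set X := Real.exp (-(ε / 2 / 2) * t) with hX
  have hX0 : 0 < X := Real.exp_pos _
  set Y := X * (A * (F * T)) with hY
  have hY0 : 0 ≤ Y := by positivity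
  set E : ℂ := ((Real.exp (-μ * t) : ℝ) : ℂ) with hE
  have hs1 : 0 < 1 / s := by positivity
  have hτi : 0 < τ⁻¹ := by positivity
  have h1G : 1 ≤ G := by rw [hG]; linarith
  have hrem : ‖u j t - (((-μ) ^ (j : ℕ) * Real.exp (-μ * t) : ℝ) : ℂ) * k‖ ≤ G * Y := by
    fin_cases j
    · have h0 : u 0 t - (((-μ) ^ 0 * Real.exp (-μ * t) : ℝ) : ℂ) * k = u 0 t - k * E := by
        rw [hE]; push_cast; ring
      simp only [Fin.zero_eta, h0]
      have h1 : s * ‖u 0 t - k * E‖ ≤ Y :=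
        (mul_le_mul_of_nonneg_right hsd (norm_nonneg _)).trans E0
      have h2 : ‖u 0 t - k * E‖ ≤ 1 / s * Y := by
        rw [one_div, inv_mul_eq_div, le_div_iff₀ hs0, mul_comm]
        exact h1
      refine h2.trans ?_
      gcongr
      rw [hG]
      linarith
    · have h0 : u 1 t - (((-μ) ^ 1 * Real.exp (-μ * t) : ℝ) : ℂ) * k = u 1 t + μ * k * E := by
        rw [hE]; push_cast; ring
      simp only [Fin.mk_one, h0]
      exact E1.trans (le_mul_of_one_le_left hY0 h1G)
    · have h0 : u 2 t - (((-μ) ^ 2 * Real.exp (-μ * t) : ℝ) : ℂ) * k = u 2 t - μ ^ 2 * k * E := by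
        rw [hE]; push_cast; ring
      simp only [Fin.reduceFinMk, h0]
      refine E2.trans ?_
      have : X * ((1 + b + √d) * (A * (F * T))) = (1 + b + √d) * Y := by rw [hY]; ring
      rw [this]
      gcongr
      rw [hG]
      linarith
  have hexp2 : Real.exp (-(1 / (4 * γ)) * x * t) ≤ Real.exp (-c * x * t) := by
    refine Real.exp_le_exp.2 (mul_le_mul_of_nonneg_right (mul_le_mul_of_nonneg_right
      (neg_le_neg (min_le_right _ _)) hx.le) ht)
  have hexp3 : Real.exp (-μ * t) ≤ Real.exp (-c * x * t) := by
    refine Real.exp_le_exp.2 (mul_le_mul_of_nonneg_right ?_ ht)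
    rw [neg_mul]
    refine neg_le_neg (le_trans ?_ hμ1)
    calc c * x ≤ 1 / (4 * γ) * x := by gcongr; exact min_le_right _ _
      _ ≤ 1 / (2 * γ) * x := by gcongr; norm_num
      _ = _ := by ring
  set V := x ^ ((j : ℕ) + 1) * Real.exp (-c * x * t) with hV
  have hV0 : 0 < V := by positivity
  have hmid : ‖(((-μ) ^ (j : ℕ) * Real.exp (-μ * t) : ℝ) : ℂ) * (k - k₀)‖ ≤ Z * P * V * T := by
    rw [norm_mul, Complex.norm_real, Real.norm_eq_abs, abs_mul, abs_pow, abs_neg, abs_of_pos hμ,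
      abs_of_pos (Real.exp_pos _)]
    have h1 : μ ^ (j : ℕ) ≤ Z * x ^ (j : ℕ) := by
      calc μ ^ (j : ℕ) ≤ (2 / γ * x) ^ (j : ℕ) := by gcongr
        _ = (2 / γ) ^ (j : ℕ) * x ^ (j : ℕ) := by rw [mul_pow]
        _ ≤ Z * x ^ (j : ℕ) := by
            gcongr
            have h1 : 0 < 2 / γ := by positivity
            have h2 : 0 < 4 / γ ^ 2 := by positivity
            rw [hZ]
            fin_cases j
            · simp only [pow_zero]; linarith
            · simp only [pow_one]; linarith
            · simp only [div_pow]; norm_num; linarith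
    calc μ ^ (j : ℕ) * Real.exp (-μ * t) * ‖k - k₀‖
        ≤ Z * x ^ (j : ℕ) * Real.exp (-c * x * t) * (P * x * T) := by gcongr
      _ = _ := by rw [hV]; ring
  have hlast : ‖((((-μ) ^ (j : ℕ) * Real.exp (-μ * t) -
      (-(x / γ)) ^ (j : ℕ) * Real.exp (-(x / γ) * t) : ℝ)) : ℂ) * k₀‖ ≤ R * W * V * T := by
    rw [norm_mul, Complex.norm_real, Real.norm_eq_abs]
    calc _ ≤ R * V * (W * T) := by
          gcongr
          exact hslow.trans (by rw [hV]; gcongr)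
      _ = _ := by ring
  -- Three errors: the fast remainder, the slow amplitude k against Φ̂₀/γ, and the slow root μ
  -- against x/γ.
  have hsplit : u j t - (((-(x / γ)) ^ (j : ℕ) * Real.exp (-(x / γ) * t) : ℝ) : ℂ) * k₀ =
      (u j t - (((-μ) ^ (j : ℕ) * Real.exp (-μ * t) : ℝ) : ℂ) * k)
      + (((-μ) ^ (j : ℕ) * Real.exp (-μ * t) : ℝ) : ℂ) * (k - k₀)
      + ((((-μ) ^ (j : ℕ) * Real.exp (-μ * t) -
      (-(x / γ)) ^ (j : ℕ) * Real.exp (-(x / γ) * t) : ℝ)) : ℂ) * k₀ := by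
    rw [Complex.ofReal_sub]; ring
  rw [hsplit]
  have hGY : G * Y ≤ G * (A * F) * Real.exp (-c * t) * T := by
    calc G * Y = G * (A * F) * X * T := by rw [hY]; ring
      _ ≤ _ := by gcongr
  calc _ ≤ G * Y + Z * P * V * T + R * W * V * T :=
        (norm_add₃_le).trans (add_le_add (add_le_add hrem hmid) hlast)
    _ ≤ G * (A * F) * Real.exp (-c * t) * T + Z * P * V * T + R * W * V * T := by linarith
    _ ≤ (G * (A * F) + Z * P + R * W) * (V + Real.exp (-c * t)) * T := by
        have e0 := Real.exp_pos (-c * t)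
        have h1 : 0 ≤ G * (A * F) * V * T := by positivity
        have h2 : 0 ≤ Z * P * Real.exp (-c * t) * T := by positivity
        have h3 : 0 ≤ R * W * Real.exp (-c * t) * T := by positivity
        linarith

end ModeAsymptotics

/-! ### Linear flows with a bounded generator, and the passage from weak to strong derivatives. -/

section AbstractModeSystem

variable {E : Type*} [NormedAddCommGroup E] [NormedSpace ℝ E]

/-- The generator of the first order system of the mode equation, with a bounded operator `M` in
place of the squared frequency. -/
noncomputable def modeGenerator (τ δ γ : ℝ) (M : E →L[ℝ] E) : (Fin 3 → E) →L[ℝ] (Fin 3 → E) :=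
  ContinuousLinearMap.pi ![ContinuousLinearMap.proj 1, ContinuousLinearMap.proj 2,
    -(τ⁻¹ • (ContinuousLinearMap.proj 2 + γ • ContinuousLinearMap.proj 1
      + (δ + τ) • M ∘L ContinuousLinearMap.proj 1 + M ∘L ContinuousLinearMap.proj 0))]

@[simp]
theorem modeGenerator_apply_two (τ δ γ : ℝ) (M : E →L[ℝ] E) (w : Fin 3 → E) :
    modeGenerator τ δ γ M w 2 =
      -(τ⁻¹ • (w 2 + γ • w 1 + (δ + τ) • M (w 1) + M (w 0))) := rfl

theorem exists_linear_flow [CompleteSpace E] (G : E →L[ℝ] E) (a : E) :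
    ∃ U : ℝ → E, U 0 = a ∧ ∀ t, HasDerivAt U (G (U t)) t := by
  refine ⟨fun t ↦ NormedSpace.exp (t • G) a, by simp [NormedSpace.exp_zero], fun t ↦ ?_⟩
  exact ((ContinuousLinearMap.apply ℝ E a).hasFDerivAt.comp_hasDerivAt t
    (hasDerivAt_exp_smul_const' (𝕂 := ℝ) G t))

/-- A bounded generator is Lipschitz, so Grönwall's inequality applies; one-sided derivatives on [0,
∞) are enough. -/
theorem linear_flow_unique (G : E →L[ℝ] E) {U W : ℝ → E} (h0 : U 0 = W 0)
    (hU : ∀ t, 0 ≤ t → HasDerivWithinAt U (G (U t)) (Set.Ici 0) t)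
    (hW : ∀ t, 0 ≤ t → HasDerivWithinAt W (G (W t)) (Set.Ici 0) t) {t : ℝ} (ht : 0 ≤ t) :
    U t = W t := by
  refine ODE_solution_unique_of_mem_Icc_right (v := fun _ ↦ G) (s := fun _ ↦ Set.univ)
    (K := ‖G‖₊) (a := 0) (b := t) (fun _ _ ↦ G.lipschitz.lipschitzOnWith) ?_ ?_
    (fun _ _ ↦ Set.mem_univ _) ?_ ?_ (fun _ _ ↦ Set.mem_univ _) h0 ⟨ht, le_rfl⟩
  · exact fun r hr ↦ ((hU r hr.1).continuousWithinAt).mono Set.Icc_subset_Ici_self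
  · exact fun r hr ↦ (hU r hr.1).mono (Set.Ici_subset_Ici.2 hr.1)
  · exact fun r hr ↦ ((hW r hr.1).continuousWithinAt).mono Set.Icc_subset_Ici_self
  · exact fun r hr ↦ (hW r hr.1).mono (Set.Ici_subset_Ici.2 hr.1)

/-- A continuous function with a continuous derivative in the weak sense, with respect to a
separating family of functionals, is differentiable. -/
theorem hasDerivWithinAt_of_separating [CompleteSpace E] {ι : Type*} (ℓ : ι → E →L[ℝ] ℂ)
    (hℓ : ∀ y, (∀ i, ℓ i y = 0) → y = 0) {w v : ℝ → E} (hw : ContinuousOn w (Set.Ici 0))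
    (hv : ContinuousOn v (Set.Ici 0))
    (h : ∀ i t, 0 < t → HasDerivAt (fun r ↦ ℓ i (w r)) (ℓ i (v t)) t) {t : ℝ} (ht : 0 ≤ t) :
    HasDerivWithinAt w (v t) (Set.Ici 0) t := by
  -- The constant extension to negative times is continuous on the whole line, so its primitive is
  -- differentiable at 0 too, where the weak equation is not assumed.
  set v' : ℝ → E := fun r ↦ v (max r 0) with hv'
  have hv'c : Continuous v' := hv.comp_continuous (by fun_prop) fun r ↦ Set.mem_Ici.2 (le_max_right _ _)
  have hv'v : ∀ r, 0 ≤ r → v' r = v r := fun r hr ↦ by rw [hv']; simp [hr]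
  have heq : ∀ r ∈ Set.Ici (0 : ℝ), w r = w 0 + ∫ y in (0 : ℝ)..r, v' y := fun r hr ↦ by
    rw [← sub_eq_zero]
    refine hℓ _ fun i ↦ ?_
    have hInt : ∫ y in (0 : ℝ)..r, ℓ i (v' y) = ℓ i (w r) - ℓ i (w 0) := by
      refine intervalIntegral.integral_eq_sub_of_hasDerivAt_of_le hr
        (f := fun y ↦ ℓ i (w y)) ?_ ?_ ?_
      · exact (ℓ i).continuous.comp_continuousOn (hw.mono Set.Icc_subset_Ici_self)
      · intro y hy
        rw [hv'v y hy.1.le]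
        exact h i y hy.1
      · exact ((ℓ i).continuous.comp hv'c).intervalIntegrable _ _
    rw [(ℓ i).intervalIntegral_comp_comm (hv'c.intervalIntegrable _ _)] at hInt
    rw [map_sub, map_add, hInt]
    ring
  have hd : HasDerivAt (fun r ↦ w 0 + ∫ y in (0 : ℝ)..r, v' y) (v t) t := by
    rw [← hv'v t ht]
    exact ((hv'c.integral_hasStrictDerivAt 0 t).hasDerivAt).const_add _
  exact hd.hasDerivWithinAt.congr heq (heq t ht)

end AbstractModeSystem

/-! ### Distributions whose Fourier transform is a function. -/

section FourierFunctions

variable {n : ℕ}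

namespace HasFourierFunction

theorem locallyIntegrable {u : 𝓢'(Rn n, ℂ)} {g : Rn n → ℂ} (h : HasFourierFunction u g) :
    LocallyIntegrable g := by
  rw [MeasureTheory.locallyIntegrable_iff]
  intro k hk
  obtain ⟨R, hR0, hR⟩ := hk.isBounded.subset_closedBall_lt 0 0
  let b : ContDiffBump (0 : Rn n) := ⟨R, R + 1, hR0, by linarith⟩
  have hb₁ : HasCompactSupport (Complex.ofRealCLM ∘ b) := b.hasCompactSupport.comp_left rfl
  have hb₂ : ContDiff ℝ (↑(⊤ : ℕ∞)) (Complex.ofRealCLM ∘ b) :=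
    Complex.ofRealCLM.contDiff.comp b.contDiff
  have hi := (h (hb₁.toSchwartzMap hb₂)).1
  refine (hi.integrableOn (s := k)).congr_fun (fun ξ hξ ↦ ?_) hk.measurableSet
  have : b ξ = 1 := b.one_of_mem_closedBall (hR hξ)
  simp [this]

/-- The fundamental lemma of the calculus of variations, applied to smooth compactly supported test
functions. It makes the infimum in `weightedFourierNorm` a single value. -/
theorem ae_unique {u : 𝓢'(Rn n, ℂ)} {g₁ g₂ : Rn n → ℂ} (h₁ : HasFourierFunction u g₁)
    (h₂ : HasFourierFunction u g₂) : g₁ =ᵐ[volume] g₂ := by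
  have hae := ae_eq_zero_of_integral_contDiff_smul_eq_zero
    (h₁.locallyIntegrable.sub h₂.locallyIntegrable) (fun θ hθ₁ hθ₂ ↦ ?_)
  · filter_upwards [hae] with ξ hξ
    exact sub_eq_zero.1 hξ
  · have hb₁ : HasCompactSupport (Complex.ofRealCLM ∘ θ) := hθ₂.comp_left rfl
    have hb₂ : ContDiff ℝ (↑(⊤ : ℕ∞)) (Complex.ofRealCLM ∘ θ) :=
      Complex.ofRealCLM.contDiff.comp hθ₁
    have e₁ := h₁ (hb₁.toSchwartzMap hb₂)
    have e₂ := h₂ (hb₁.toSchwartzMap hb₂)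
    have : ∀ ξ, θ ξ • (g₁ - g₂) ξ = (hb₁.toSchwartzMap hb₂) ξ * g₁ ξ
        - (hb₁.toSchwartzMap hb₂) ξ * g₂ ξ := fun ξ ↦ by
      simp [mul_sub]
    simp_rw [this]
    rw [integral_sub e₁.1 e₂.1, ← e₁.2, ← e₂.2, sub_self]

theorem weightedFourierNorm_eq {u : 𝓢'(Rn n, ℂ)} {g : Rn n → ℂ} (h : HasFourierFunction u g)
    (w : Rn n → ℝ) :
    weightedFourierNorm w u = eLpNorm (fun ξ ↦ (w ξ : ℂ) * g ξ) 2 volume := by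
  refine le_antisymm (iInf₂_le g h) (le_iInf₂ fun g' h' ↦ le_of_eq ?_)
  refine eLpNorm_congr_ae ?_
  filter_upwards [h.ae_unique h'] with ξ hξ
  rw [hξ]

theorem congr_ae {u : 𝓢'(Rn n, ℂ)} {g₁ g₂ : Rn n → ℂ} (h : HasFourierFunction u g₁)
    (hg : g₁ =ᵐ[volume] g₂) : HasFourierFunction u g₂ := fun θ ↦ by
  have : (fun ξ ↦ θ ξ * g₁ ξ) =ᵐ[volume] fun ξ ↦ θ ξ * g₂ ξ := by
    filter_upwards [hg] with ξ hξ
    rw [hξ]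
  exact ⟨(h θ).1.congr this, (h θ).2.trans (integral_congr_ae this)⟩

theorem sub {u v : 𝓢'(Rn n, ℂ)} {g k : Rn n → ℂ} (hu : HasFourierFunction u g)
    (hv : HasFourierFunction v k) : HasFourierFunction (u - v) (fun ξ ↦ g ξ - k ξ) := fun θ ↦ by
  simp only [mul_sub]
  refine ⟨(hu θ).1.sub (hv θ).1, ?_⟩
  rw [integral_sub (hu θ).1 (hv θ).1, ← (hu θ).2, ← (hv θ).2]
  rfl

theorem smul {u : 𝓢'(Rn n, ℂ)} {g : Rn n → ℂ} (hu : HasFourierFunction u g) (c : ℂ) :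
    HasFourierFunction (c • u) (fun ξ ↦ c * g ξ) := fun θ ↦ by
  simp only [mul_left_comm _ c]
  refine ⟨(hu θ).1.const_mul c, ?_⟩
  rw [integral_const_mul, ← (hu θ).2]
  rfl

theorem neg {u : 𝓢'(Rn n, ℂ)} {g : Rn n → ℂ} (hu : HasFourierFunction u g) :
    HasFourierFunction (-u) (fun ξ ↦ -g ξ) := fun θ ↦ by
  simp only [mul_neg]
  refine ⟨(hu θ).1.neg, ?_⟩
  rw [integral_neg, ← (hu θ).2]
  rfl

theorem laplacian {u : 𝓢'(Rn n, ℂ)} {g : Rn n → ℂ} (hu : HasFourierFunction u g) :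
    HasFourierFunction (Δ u) (fun ξ ↦ -(((2 * Real.pi * ‖ξ‖) ^ 2 : ℝ) : ℂ) * g ξ) := fun θ ↦ by
  have hgrowth : (fun ξ : Rn n ↦ ((‖ξ‖ ^ 2 : ℝ) : ℂ)).HasTemperateGrowth := by fun_prop
  set θ' : 𝓢(Rn n, ℂ) := SchwartzMap.smulLeftCLM ℂ (fun ξ : Rn n ↦ ((‖ξ‖ ^ 2 : ℝ) : ℂ)) θ with hθ'
  have hθ : ∀ ξ, θ ξ * (-(((2 * Real.pi * ‖ξ‖) ^ 2 : ℝ) : ℂ) * g ξ) =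
      (-(2 * Real.pi) ^ 2 : ℂ) * (θ' ξ * g ξ) := fun ξ ↦ by
    rw [hθ', SchwartzMap.smulLeftCLM_apply_apply hgrowth, smul_eq_mul]
    push_cast
    ring
  simp_rw [hθ]
  refine ⟨(hu θ').1.const_mul _, ?_⟩
  rw [integral_const_mul, ← (hu θ').2, TemperedDistribution.laplacian_eq_fourierMultiplierCLM,
    TemperedDistribution.fourier_apply]
  simp only [TemperedDistribution.fourierMultiplierCLM_apply]
  have : ((-(2 * Real.pi) ^ 2 : ℝ) • 𝓕⁻ (TemperedDistribution.smulLeftCLM ℂ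
      (fun x : Rn n ↦ ((‖x‖ ^ 2 : ℝ) : ℂ)) (𝓕 u))) (𝓕 θ) =
      (-(2 * Real.pi) ^ 2 : ℝ) • (𝓕⁻ (TemperedDistribution.smulLeftCLM ℂ
      (fun x : Rn n ↦ ((‖x‖ ^ 2 : ℝ) : ℂ)) (𝓕 u))) (𝓕 θ) := rfl
  rw [this, TemperedDistribution.fourierInv_apply, FourierTransform.fourierInv_fourier_eq,
    TemperedDistribution.smulLeftCLM_apply_apply, Complex.real_smul, ← hθ']
  push_cast
  rfl

end HasFourierFunction

/-- Fubini's theorem moves the Fourier transform from the test function to f; integrability against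
θ holds because the transform of f is bounded and continuous. -/
theorem hasFourierFunction_of_Lp_one (f : Lp ℂ 1 (volume : Measure (Rn n))) :
    HasFourierFunction (f : 𝓢'(Rn n, ℂ)) (Real.Lp.fourierTransform f) := fun θ ↦ by
  have hf : Integrable (f : Rn n → ℂ) := L1.integrable_coeFn f
  refine ⟨θ.integrable.mul_bdd (c := ‖Real.Lp.fourierTransform f‖)
    (Real.Lp.fourierTransform f).continuous.aestronglyMeasurable
    (Eventually.of_forall fun ξ ↦ (Real.Lp.fourierTransform f).norm_coe_le_norm ξ), ?_⟩
  rw [TemperedDistribution.fourier_apply, Lp.toTemperedDistribution_apply]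
  have := VectorFourier.integral_fourierIntegral_smul_eq_flip (μ := volume) (ν := volume)
    (L := innerₗ (Rn n)) (f := θ) (g := (f : Rn n → ℂ)) Real.continuous_fourierChar
    (by exact continuous_inner) θ.integrable hf
  simp only [smul_eq_mul, flip_innerₗ] at this ⊢
  exact this

theorem memLp_two_schwartz (θ : 𝓢(Rn n, ℂ)) : MemLp θ 2 volume := θ.memLp 2

/-- `MemSobolev` uses the weight 1 + ‖ξ‖², the norms of this file use 1 + (2π‖ξ‖)². Their quotient
lies between 1 and 1 + (2π)², so the two descriptions agree up to a constant for every order r. -/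
theorem exists_hasFourierFunction_of_memSobolev {r : ℝ} {u : 𝓢'(Rn n, ℂ)}
    (hu : TemperedDistribution.MemSobolev r 2 u) :
    ∃ g : Rn n → ℂ, HasFourierFunction u g ∧
      MemLp (fun ξ ↦ (((1 + (2 * Real.pi * ‖ξ‖) ^ 2) ^ (r / 2) : ℝ) : ℂ) * g ξ) 2 volume := by
  obtain ⟨f', hf'⟩ := TemperedDistribution.memSobolev_iff_exists_smulLeftCLM_fourier.1 hu
  have hg₁ : (fun ξ : Rn n ↦ (((1 + ‖ξ‖ ^ 2) ^ (r / 2) : ℝ) : ℂ)).HasTemperateGrowth := by fun_prop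
  have hg₂ : (fun ξ : Rn n ↦ (((1 + ‖ξ‖ ^ 2) ^ (-r / 2) : ℝ) : ℂ)).HasTemperateGrowth := by
    fun_prop
  have hcancel : ∀ ξ : Rn n, (1 + ‖ξ‖ ^ 2) ^ (r / 2) * (1 + ‖ξ‖ ^ 2) ^ (-r / 2) = 1 := fun ξ ↦ by
    rw [← Real.rpow_add (by positivity)]
    ring_nf
    exact Real.rpow_zero _
  refine ⟨fun ξ ↦ (((1 + ‖ξ‖ ^ 2) ^ (-r / 2) : ℝ) : ℂ) * f' ξ, fun θ ↦ ?_, ?_⟩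
  · set θ' : 𝓢(Rn n, ℂ) :=
      SchwartzMap.smulLeftCLM ℂ (fun ξ : Rn n ↦ (((1 + ‖ξ‖ ^ 2) ^ (-r / 2) : ℝ) : ℂ)) θ with hθ'
    have hθ : ∀ ξ, θ ξ * ((((1 + ‖ξ‖ ^ 2) ^ (-r / 2) : ℝ) : ℂ) * f' ξ) = θ' ξ * f' ξ := fun ξ ↦ by
      rw [hθ', SchwartzMap.smulLeftCLM_apply_apply hg₂, smul_eq_mul]
      ring
    simp_rw [hθ]
    refine ⟨(memLp_two_schwartz θ').integrable_mul (Lp.memLp f'), ?_⟩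
    have h1 : (f' : 𝓢'(Rn n, ℂ)) θ' = ∫ ξ, θ' ξ * f' ξ := by
      rw [Lp.toTemperedDistribution_apply]
      rfl
    rw [← h1, ← hf', TemperedDistribution.smulLeftCLM_apply_apply]
    congr 1
    ext ξ
    rw [SchwartzMap.smulLeftCLM_apply_apply hg₁, hθ', SchwartzMap.smulLeftCLM_apply_apply hg₂,
      smul_smul, ← Complex.ofReal_mul, hcancel, Complex.ofReal_one, one_smul]
  · have hb : ∀ ξ : Rn n, (1 + (2 * Real.pi * ‖ξ‖) ^ 2) ^ (r / 2) * (1 + ‖ξ‖ ^ 2) ^ (-r / 2) ≤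
        ((1 + (2 * Real.pi) ^ 2)) ^ |r / 2| := fun ξ ↦ by
      have hq : (1 + (2 * Real.pi * ‖ξ‖) ^ 2) ^ (r / 2) * (1 + ‖ξ‖ ^ 2) ^ (-r / 2) =
          ((1 + (2 * Real.pi * ‖ξ‖) ^ 2) / (1 + ‖ξ‖ ^ 2)) ^ (r / 2) := by
        rw [neg_div, Real.rpow_neg (by positivity), Real.div_rpow (by positivity) (by positivity)]
        rfl
      have h2π : 1 ≤ (2 * Real.pi) ^ 2 := one_le_pow₀ (by linarith [Real.pi_gt_three])
      have h1 : 1 ≤ (1 + (2 * Real.pi * ‖ξ‖) ^ 2) / (1 + ‖ξ‖ ^ 2) := by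
        rw [le_div_iff₀ (by positivity), mul_pow]
        nlinarith [sq_nonneg ‖ξ‖]
      have h2 : (1 + (2 * Real.pi * ‖ξ‖) ^ 2) / (1 + ‖ξ‖ ^ 2) ≤ 1 + (2 * Real.pi) ^ 2 := by
        rw [div_le_iff₀ (by positivity), mul_pow]
        nlinarith [sq_nonneg ‖ξ‖]
      rw [hq]
      calc _ ≤ ((1 + (2 * Real.pi * ‖ξ‖) ^ 2) / (1 + ‖ξ‖ ^ 2)) ^ |r / 2| :=
            Real.rpow_le_rpow_of_exponent_le h1 (le_abs_self _)
        _ ≤ _ := Real.rpow_le_rpow (by positivity) h2 (abs_nonneg _)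
    refine ((Lp.memLp f').const_mul (((1 + (2 * Real.pi) ^ 2) ^ |r / 2| : ℝ) : ℂ)).mono ?_ ?_
    · have hc₁ : Continuous fun ξ : Rn n ↦ (((1 + (2 * Real.pi * ‖ξ‖) ^ 2) ^ (r / 2) : ℝ) : ℂ) := by
        refine Complex.continuous_ofReal.comp (Continuous.rpow_const (by fun_prop) fun ξ ↦ ?_)
        exact Or.inl (by positivity)
      exact hc₁.aestronglyMeasurable.mul
        (hg₂.1.continuous.aestronglyMeasurable.mul (Lp.aestronglyMeasurable f'))
    · refine Eventually.of_forall fun ξ ↦ ?_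
      rw [← mul_assoc, ← Complex.ofReal_mul, norm_mul, norm_mul, Complex.norm_real,
        Complex.norm_real, Real.norm_of_nonneg (by positivity), Real.norm_of_nonneg (by positivity)]
      exact mul_le_mul_of_nonneg_right (hb ξ) (norm_nonneg _)

/-- With b = γ/(4t), the transform of exp(-b‖x‖²) carries the factor (π/b)^(n/2), which the
normalisation (γ/(4πt))^(n/2) cancels. -/
theorem hasFourierFunction_gaussianDistribution {γ t : ℝ} (hγ : 0 < γ) (ht : 0 < t) :
    HasFourierFunction (gaussianDistribution n γ t)
      (fun ξ ↦ ((γ⁻¹ * Real.exp (-((2 * Real.pi * ‖ξ‖) ^ 2 / γ) * t) : ℝ) : ℂ)) := by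
  rw [gaussianDistribution, dif_pos ⟨hγ, ht⟩]
  refine (hasFourierFunction_of_Lp_one _).congr_ae (Eventually.of_forall fun ξ ↦ ?_)
  rw [Real.fourierTransform_toLp]
  set b : ℝ := γ / (4 * t) with hb
  have hb0 : 0 < b := by positivity
  set A : ℝ := γ⁻¹ * (γ / (4 * Real.pi * t)) ^ ((n : ℝ) / 2) with hA
  have h1 : gaussianProfile n γ t =
      fun x ↦ (A : ℂ) • Complex.exp (-(b : ℂ) * (‖x‖ : ℂ) ^ 2) := by
    funext x
    rw [gaussianProfile, Complex.ofReal_mul, ← hA, smul_eq_mul, Complex.ofReal_exp]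
    congr 2
    rw [hb]
    push_cast
    ring
  have h2 := fourier_gaussian_innerProductSpace (V := Rn n) (b := (b : ℂ)) (by simpa using hb0) ξ
  rw [h1]
  have h3 : 𝓕 (fun x : Rn n ↦ (A : ℂ) • Complex.exp (-(b : ℂ) * (‖x‖ : ℂ) ^ 2)) ξ =
      (A : ℂ) * 𝓕 (fun x : Rn n ↦ Complex.exp (-(b : ℂ) * (‖x‖ : ℂ) ^ 2)) ξ := by
    rw [Real.fourier_eq, Real.fourier_eq, ← integral_const_mul]
    congr 1
    funext x
    rw [smul_comm, smul_eq_mul]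
  rw [h3, h2, finrank_euclideanSpace_fin]
  have h4 : ((Real.pi : ℂ) / (b : ℂ)) ^ ((n : ℂ) / 2) =
      (((Real.pi / b) ^ ((n : ℝ) / 2) : ℝ) : ℂ) := by
    rw [Complex.ofReal_cpow (by positivity)]
    push_cast
    rfl
  have h5 : Complex.exp (-(Real.pi : ℂ) ^ 2 * (‖ξ‖ : ℂ) ^ 2 / (b : ℂ)) =
      ((Real.exp (-((2 * Real.pi * ‖ξ‖) ^ 2 / γ) * t) : ℝ) : ℂ) := by
    rw [Complex.ofReal_exp]
    congr 1
    have : -Real.pi ^ 2 * ‖ξ‖ ^ 2 / b = -((2 * Real.pi * ‖ξ‖) ^ 2 / γ) * t := by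
      rw [hb]; field_simp; ring
    exact_mod_cast congrArg Complex.ofReal this
  rw [h4, h5, ← Complex.ofReal_mul, ← Complex.ofReal_mul]
  congr 1
  rw [← mul_assoc, hA, mul_assoc γ⁻¹, ← Real.mul_rpow (by positivity) (by positivity)]
  have h6 : γ / (4 * Real.pi * t) * (Real.pi / b) = 1 := by
    rw [hb]; field_simp
  rw [h6, Real.one_rpow, mul_one]

theorem hasFourierFunction_diffusionProfile {γ t : ℝ} (hγ : 0 < γ) (ht : 0 < t) (j : ℕ) :
    HasFourierFunction (diffusionProfile n γ j t)
      (fun ξ ↦ (((-((2 * Real.pi * ‖ξ‖) ^ 2 / γ)) ^ j *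
        Real.exp (-((2 * Real.pi * ‖ξ‖) ^ 2 / γ) * t) : ℝ) : ℂ) * ((γ⁻¹ : ℝ) : ℂ)) := by
  have hiter : ∀ j : ℕ, HasFourierFunction
      ((fun u : 𝓢'(Rn n, ℂ) ↦ -Δ u)^[j] (gaussianDistribution n γ t))
      (fun ξ ↦ ((((2 * Real.pi * ‖ξ‖) ^ 2) ^ j *
        (γ⁻¹ * Real.exp (-((2 * Real.pi * ‖ξ‖) ^ 2 / γ) * t)) : ℝ) : ℂ)) := by
    intro j
    induction j with
    | zero =>
      refine (hasFourierFunction_gaussianDistribution hγ ht).congr_ae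
        (Eventually.of_forall fun ξ ↦ ?_)
      simp
    | succ j ih =>
      rw [Function.iterate_succ_apply']
      refine ih.laplacian.neg.congr_ae (Eventually.of_forall fun ξ ↦ ?_)
      push_cast
      ring
  refine ((hiter j).smul _).congr_ae (Eventually.of_forall fun ξ ↦ ?_)
  simp only
  rw [← Complex.ofReal_mul, ← Complex.ofReal_mul]
  congr 1
  have : (-((2 * Real.pi * ‖ξ‖) ^ 2 / γ)) ^ j = (-γ)⁻¹ ^ j * ((2 * Real.pi * ‖ξ‖) ^ 2) ^ j := by
    rw [← mul_pow]
    congr 1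
    field_simp
  rw [this]
  ring

end FourierFunctions

/-! ### Restriction to a ball of frequencies, where -Δ becomes a bounded operator. -/

section Localization

variable {n : ℕ}

/-- Lebesgue measure on the ball of radius `R` in frequency space. -/
noncomputable abbrev ballMeasure (n : ℕ) (R : ℝ) : Measure (Rn n) :=
  volume.restrict (Metric.ball 0 R)

instance isFiniteMeasure_ballMeasure (R : ℝ) : IsFiniteMeasure (ballMeasure n R) :=
  ⟨by simpa using measure_ball_lt_top⟩

/-- On the ball a Sobolev weight of any order is bounded below by a positive constant. Every Sobolev
norm, whatever its order, thus controls L² of the ball, and the three different orders in the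
solution class can be handled in one space. -/
theorem enorm_le_sobolevNorm_of_ae_eq (R r : ℝ) {u : 𝓢'(Rn n, ℂ)} {g : Rn n → ℂ}
    (hu : HasFourierFunction u g) {y : Lp ℂ 2 (ballMeasure n R)} (hy : y =ᵐ[ballMeasure n R] g) :
    ‖y‖ₑ ≤ ENNReal.ofReal ((1 + (2 * Real.pi * R) ^ 2) ^ |r / 2|) * sobolevNorm r u := by
  rw [sobolevNorm, hu.weightedFourierNorm_eq, Lp.enorm_def, eLpNorm_congr_ae hy]
  refine le_trans ?_ (mul_le_mul_right (eLpNorm_mono_measure _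
    (Measure.restrict_le_self (s := Metric.ball 0 R))) _)
  refine eLpNorm_le_mul_eLpNorm_of_ae_le_mul ?_ 2
  refine (ae_restrict_iff' measurableSet_ball).2 (Eventually.of_forall fun ξ hξ ↦ ?_)
  rw [norm_mul, Complex.norm_real, Real.norm_of_nonneg (by positivity), ← mul_assoc]
  refine le_mul_of_one_le_left (norm_nonneg _) ?_
  have hξ' : ‖ξ‖ ≤ R := (mem_ball_zero_iff.1 hξ).le
  set a : ℝ := 1 + (2 * Real.pi * ‖ξ‖) ^ 2 with ha
  have ha1 : 1 ≤ a := by rw [ha]; linarith [sq_nonneg (2 * Real.pi * ‖ξ‖)]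
  have hab : a ≤ 1 + (2 * Real.pi * R) ^ 2 := by rw [ha]; gcongr
  calc (1 : ℝ) ≤ a ^ (|r / 2| + r / 2) :=
        Real.one_le_rpow ha1 (by linarith [neg_abs_le (r / 2)])
    _ = a ^ |r / 2| * a ^ (r / 2) := Real.rpow_add (by linarith) _ _
    _ ≤ _ := by gcongr

theorem memLp_ballMeasure_of_memSobolev (R : ℝ) {r : ℝ} {g : Rn n → ℂ}
    (hg : MemLp (fun ξ ↦ (((1 + (2 * Real.pi * ‖ξ‖) ^ 2) ^ (r / 2) : ℝ) : ℂ) * g ξ) 2 volume) :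
    MemLp g 2 (ballMeasure n R) := by
  set F := fun ξ : Rn n ↦ (((1 + (2 * Real.pi * ‖ξ‖) ^ 2) ^ (r / 2) : ℝ) : ℂ) * g ξ with hF
  have hcont : Continuous fun ξ : Rn n ↦ (((1 + (2 * Real.pi * ‖ξ‖) ^ 2) ^ (-(r / 2)) : ℝ) : ℂ) := by
    refine Complex.continuous_ofReal.comp (Continuous.rpow_const (by fun_prop) fun ξ ↦ ?_)
    exact Or.inl (by positivity)
  have hgF : g = fun ξ ↦ (((1 + (2 * Real.pi * ‖ξ‖) ^ 2) ^ (-(r / 2)) : ℝ) : ℂ) * F ξ := by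
    funext ξ
    rw [hF, ← mul_assoc, ← Complex.ofReal_mul, ← Real.rpow_add (by positivity), neg_add_cancel,
      Real.rpow_zero, Complex.ofReal_one, one_mul]
  rw [hgF]
  refine ((hg.restrict _).const_mul
    (((1 + (2 * Real.pi * R) ^ 2) ^ |r / 2| : ℝ) : ℂ)).mono
    (hcont.aestronglyMeasurable.mul (hg.restrict _).1) ?_
  refine (ae_restrict_iff' measurableSet_ball).2 (Eventually.of_forall fun ξ hξ ↦ ?_)
  rw [norm_mul _ (F ξ), norm_mul _ (F ξ), Complex.norm_real, Complex.norm_real,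
    Real.norm_of_nonneg (by positivity), Real.norm_of_nonneg (by positivity)]
  have hξ' : ‖ξ‖ ≤ R := (mem_ball_zero_iff.1 hξ).le
  set a : ℝ := 1 + (2 * Real.pi * ‖ξ‖) ^ 2 with ha
  have ha1 : 1 ≤ a := by rw [ha]; linarith [sq_nonneg (2 * Real.pi * ‖ξ‖)]
  have hab : a ≤ 1 + (2 * Real.pi * R) ^ 2 := by rw [ha]; gcongr
  refine mul_le_mul_of_nonneg_right ?_ (norm_nonneg _)
  calc a ^ (-(r / 2)) ≤ a ^ |r / 2| := Real.rpow_le_rpow_of_exponent_le ha1 (neg_le_abs _)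
    _ ≤ _ := by gcongr

/-- Testing an `L²` function on a ball against a Schwartz function. -/
noncomputable def ballPairing (R : ℝ) (θ : 𝓢(Rn n, ℂ)) : Lp ℂ 2 (ballMeasure n R) →L[ℝ] ℂ :=
  ((ContinuousLinearMap.mul ℂ ℂ).lpPairing (ballMeasure n R) 2 2
    (((memLp_two_schwartz θ).restrict _).toLp θ)).restrictScalars ℝ

theorem ballPairing_apply (R : ℝ) (θ : 𝓢(Rn n, ℂ)) (y : Lp ℂ 2 (ballMeasure n R)) :
    ballPairing R θ y = ∫ ξ, θ ξ * y ξ ∂(ballMeasure n R) := by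
  rw [ballPairing, ContinuousLinearMap.coe_restrictScalars',
    ContinuousLinearMap.lpPairing_eq_integral]
  refine integral_congr_ae ?_
  filter_upwards [((memLp_two_schwartz θ).restrict (Metric.ball 0 R)).coeFn_toLp] with ξ hξ
  rw [hξ]
  rfl

/-- The support condition turns the integral over the ball into one over the whole space. Testing
the equation against 𝓕 θ thereby becomes testing its Fourier transform against θ inside the ball. -/
theorem ballPairing_eq_fourier {R : ℝ} {θ : 𝓢(Rn n, ℂ)} (hθ : tsupport θ ⊆ Metric.ball 0 R)
    {u : 𝓢'(Rn n, ℂ)} {g : Rn n → ℂ} (hu : HasFourierFunction u g)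
    {y : Lp ℂ 2 (ballMeasure n R)} (hy : y =ᵐ[ballMeasure n R] g) :
    ballPairing R θ y = u (𝓕 θ) := by
  rw [← TemperedDistribution.fourier_apply, (hu θ).2, ballPairing_apply]
  have h1 : ∫ ξ, θ ξ * y ξ ∂(ballMeasure n R) = ∫ ξ, θ ξ * g ξ ∂(ballMeasure n R) := by
    refine integral_congr_ae ?_
    filter_upwards [hy] with ξ hξ
    rw [hξ]
  rw [h1]
  refine setIntegral_eq_integral_of_forall_compl_eq_zero fun ξ hξ ↦ ?_
  rw [image_eq_zero_of_notMem_tsupport fun h ↦ hξ (hθ h), zero_mul]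

theorem eq_zero_of_ballPairing_eq_zero {R : ℝ} {y : Lp ℂ 2 (ballMeasure n R)}
    (hy : ∀ θ : {θ : 𝓢(Rn n, ℂ) // tsupport θ ⊆ Metric.ball 0 R}, ballPairing R θ.1 y = 0) :
    y = 0 := by
  rw [Lp.eq_zero_iff_ae_eq_zero]
  refine (ae_restrict_iff' measurableSet_ball).2 ?_
  refine Metric.isOpen_ball.ae_eq_zero_of_integral_contDiff_smul_eq_zero
    (f := (y : Rn n → ℂ)) ?_ fun θ hθ₁ hθ₂ hθ₃ ↦ ?_
  · have : IntegrableOn (y : Rn n → ℂ) (Metric.ball 0 R) := (Lp.memLp y).integrable (by norm_num)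
    exact this.locallyIntegrableOn
  · have hb₁ : HasCompactSupport (Complex.ofRealCLM ∘ θ) := hθ₂.comp_left rfl
    have hb₂ : ContDiff ℝ (↑(⊤ : ℕ∞)) (Complex.ofRealCLM ∘ θ) :=
      Complex.ofRealCLM.contDiff.comp hθ₁
    have hsupp : tsupport (hb₁.toSchwartzMap hb₂) ⊆ Metric.ball 0 R := by
      refine subset_trans (closure_mono fun ξ hξ ↦ ?_) hθ₃
      simpa using hξ
    have h := hy ⟨_, hsupp⟩
    rw [ballPairing_apply] at h
    rw [← h, eq_comm]
    have h1 : ∫ ξ, (hb₁.toSchwartzMap hb₂) ξ * y ξ ∂(ballMeasure n R) =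
        ∫ ξ, (hb₁.toSchwartzMap hb₂) ξ * y ξ :=
      setIntegral_eq_integral_of_forall_compl_eq_zero fun ξ hξ ↦ by
        rw [image_eq_zero_of_notMem_tsupport fun h ↦ hξ (hsupp h), zero_mul]
    rw [h1]
    rfl

/-- The symbol of `-Δ`, truncated to a bounded function outside the ball of radius `R`. -/
noncomputable def truncatedSymbol (n : ℕ) (R : ℝ) : BoundedContinuousFunction (Rn n) ℂ :=
  BoundedContinuousFunction.ofNormedAddCommGroup
    (fun ξ ↦ ((min ((2 * Real.pi * ‖ξ‖) ^ 2) ((2 * Real.pi * R) ^ 2) : ℝ) : ℂ))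
    (Complex.continuous_ofReal.comp (by fun_prop)) ((2 * Real.pi * R) ^ 2) fun ξ ↦ by
      rw [Complex.norm_real, Real.norm_of_nonneg (by positivity)]
      exact min_le_right _ _

theorem truncatedSymbol_apply {R : ℝ} {ξ : Rn n} (hξ : ξ ∈ Metric.ball 0 R) :
    truncatedSymbol n R ξ = (((2 * Real.pi * ‖ξ‖) ^ 2 : ℝ) : ℂ) := by
  have hξ' : ‖ξ‖ ≤ R := (mem_ball_zero_iff.1 hξ).le
  have : min ((2 * Real.pi * ‖ξ‖) ^ 2) ((2 * Real.pi * R) ^ 2) = (2 * Real.pi * ‖ξ‖) ^ 2 :=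
    min_eq_left (by gcongr)
  exact congrArg Complex.ofReal this

/-- Multiplication by the truncated symbol on `L²` of a ball. -/
noncomputable def ballMul (n : ℕ) (R : ℝ) :
    Lp ℂ 2 (ballMeasure n R) →L[ℝ] Lp ℂ 2 (ballMeasure n R) :=
  ((ContinuousLinearMap.mul ℂ ℂ).holderL (ballMeasure n R) ∞ 2 2
    ((truncatedSymbol n R).memLp_top.toLp _)).restrictScalars ℝ

theorem ballMul_apply (R : ℝ) (y : Lp ℂ 2 (ballMeasure n R)) :
    ballMul n R y =ᵐ[ballMeasure n R] fun ξ ↦ truncatedSymbol n R ξ * y ξ := by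
  rw [ballMul, ContinuousLinearMap.coe_restrictScalars', ContinuousLinearMap.holderL_apply_apply]
  filter_upwards [(ContinuousLinearMap.mul ℂ ℂ).coeFn_holder (r := 2)
    ((truncatedSymbol n R).memLp_top.toLp _) y,
    (truncatedSymbol n R).memLp_top.coeFn_toLp (μ := ballMeasure n R)] with ξ h1 h2
  rw [h1, h2]
  rfl

theorem ballMul_ae_eq_symbol (R : ℝ) {y : Lp ℂ 2 (ballMeasure n R)} {g : Rn n → ℂ}
    (hy : y =ᵐ[ballMeasure n R] g) :
    ballMul n R y =ᵐ[ballMeasure n R] fun ξ ↦ (((2 * Real.pi * ‖ξ‖) ^ 2 : ℝ) : ℂ) * g ξ := by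
  filter_upwards [ballMul_apply R y, hy, ae_restrict_mem measurableSet_ball] with ξ h1 h2 h3
  rw [h1, h2, truncatedSymbol_apply h3]

theorem ballMul_toLp (R : ℝ) (a : BoundedContinuousFunction (Rn n) ℂ) :
    ballMul n R (BoundedContinuousFunction.toLp 2 (ballMeasure n R) ℝ a) =
      BoundedContinuousFunction.toLp 2 (ballMeasure n R) ℝ (truncatedSymbol n R * a) := by
  refine Lp.ext ?_
  filter_upwards [ballMul_apply R (BoundedContinuousFunction.toLp 2 (ballMeasure n R) ℝ a),
    BoundedContinuousFunction.coeFn_toLp 2 (ballMeasure n R) ℝ a,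
    BoundedContinuousFunction.coeFn_toLp 2 (ballMeasure n R) ℝ (truncatedSymbol n R * a)]
    with ξ h1 h2 h3
  rw [h1, h2, h3]
  rfl

end Localization

/-! ### Sobolev solutions are given by modes at almost every frequency. -/

section Representation

variable {n : ℕ}

/-- A Sobolev-continuous family is continuous in `L²` of a ball on the frequency side. -/
theorem ContinuousInSobolev.continuousOn_ball {r R : ℝ} {u : ℝ → 𝓢'(Rn n, ℂ)}
    (hu : ContinuousInSobolev r u) {g : ℝ → Rn n → ℂ}
    (hg : ∀ t, 0 ≤ t → HasFourierFunction (u t) (g t)) {w : ℝ → Lp ℂ 2 (ballMeasure n R)}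
    (hw : ∀ t, 0 ≤ t → w t =ᵐ[ballMeasure n R] g t) : ContinuousOn w (Set.Ici 0) := by
  intro t ht
  rw [ContinuousWithinAt, tendsto_iff_edist_tendsto_0]
  have h1 := ENNReal.Tendsto.const_mul ((hu t ht).2)
    (Or.inr (ENNReal.ofReal_ne_top (r := (1 + (2 * Real.pi * R) ^ 2) ^ |r / 2|)))
  rw [mul_zero] at h1
  refine tendsto_of_tendsto_of_tendsto_of_le_of_le' tendsto_const_nhds h1
    (Eventually.of_forall fun _ ↦ zero_le) ?_
  filter_upwards [self_mem_nhdsWithin] with t' ht'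
  rw [edist_eq_enorm_sub]
  refine enorm_le_sobolevNorm_of_ae_eq R r ((hg t' ht').sub (hg t ht)) ?_
  filter_upwards [Lp.coeFn_sub (w t') (w t), hw t' ht', hw t ht] with ξ h2 h3 h4
  rw [h2, Pi.sub_apply, h3, h4]

/-- A Sobolev time derivative is a derivative in `L²` of a ball on the frequency side. -/
theorem HasTimeDerivInSobolev.hasDerivWithinAt_ball {r R : ℝ} {u v : ℝ → 𝓢'(Rn n, ℂ)}
    (hu : HasTimeDerivInSobolev r u v) {g k : ℝ → Rn n → ℂ}
    (hg : ∀ t, 0 ≤ t → HasFourierFunction (u t) (g t))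
    (hk : ∀ t, 0 ≤ t → HasFourierFunction (v t) (k t))
    {w y : ℝ → Lp ℂ 2 (ballMeasure n R)} (hw : ∀ t, 0 ≤ t → w t =ᵐ[ballMeasure n R] g t)
    (hy : ∀ t, 0 ≤ t → y t =ᵐ[ballMeasure n R] k t) {t : ℝ} (ht : 0 ≤ t) :
    HasDerivWithinAt w (y t) (Set.Ici 0) t := by
  rw [hasDerivWithinAt_iff_tendsto_slope, tendsto_iff_edist_tendsto_0]
  have h1 := ENNReal.Tendsto.const_mul (hu t ht)
    (Or.inr (ENNReal.ofReal_ne_top (r := (1 + (2 * Real.pi * R) ^ 2) ^ |r / 2|)))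
  rw [mul_zero] at h1
  refine tendsto_of_tendsto_of_tendsto_of_le_of_le' tendsto_const_nhds h1
    (Eventually.of_forall fun _ ↦ zero_le) ?_
  filter_upwards [self_mem_nhdsWithin] with t' ht'
  rw [edist_eq_enorm_sub]
  refine enorm_le_sobolevNorm_of_ae_eq R r
    ((((hg t' ht'.1).sub (hg t ht)).smul _).sub (hk t ht)) ?_
  rw [slope_def_module]
  filter_upwards [Lp.coeFn_sub ((t' - t)⁻¹ • (w t' - w t)) (y t),
    Lp.coeFn_smul (t' - t)⁻¹ (w t' - w t), Lp.coeFn_sub (w t') (w t), hw t' ht'.1, hw t ht,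
    hy t ht] with ξ h2 h3 h4 h5 h6 h7
  rw [h2, Pi.sub_apply, h3, Pi.smul_apply, h4, Pi.sub_apply, h5, h6, h7, Complex.real_smul]

theorem IsSobolevSolution.hasDerivAt_ballPairing {τ δ γ s R : ℝ} (hτ : 0 < τ)
    {f : Fin 3 → 𝓢'(Rn n, ℂ)} {φ : Fin 3 → ℝ → 𝓢'(Rn n, ℂ)} (hφ : IsSobolevSolution τ δ γ s f φ)
    {g : Fin 3 → ℝ → Rn n → ℂ} (hg : ∀ k t, 0 ≤ t → HasFourierFunction (φ k t) (g k t))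
    {w : ℝ → Fin 3 → Lp ℂ 2 (ballMeasure n R)}
    (hw : ∀ k t, 0 ≤ t → w t k =ᵐ[ballMeasure n R] g k t)
    {θ : 𝓢(Rn n, ℂ)} (hθ : tsupport θ ⊆ Metric.ball 0 R) {t : ℝ} (ht : 0 < t) :
    HasDerivAt (fun r ↦ ballPairing R θ (w r 2))
      (ballPairing R θ (modeGenerator τ δ γ (ballMul n R) (w t) 2)) t := by
  obtain ⟨d, hd, heq⟩ := hφ.equation (𝓕 θ) t ht
  have hloc : (fun r ↦ ballPairing R θ (w r 2)) =ᶠ[𝓝 t] fun r ↦ (φ 2 r) (𝓕 θ) := by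
    filter_upwards [lt_mem_nhds ht] with r hr
    exact ballPairing_eq_fourier hθ (hg 2 r hr.le) (hw 2 r hr.le)
  refine (hd.congr_of_eventuallyEq hloc).congr_deriv ?_
  have hlap : ∀ k, ballPairing R θ (ballMul n R (w t k)) = -(Δ (φ k t)) (𝓕 θ) := fun k ↦ by
    refine (ballPairing_eq_fourier hθ (hg k t ht.le).laplacian.neg ?_)
    refine (ballMul_ae_eq_symbol R (hw k t ht.le)).trans (Eventually.of_forall fun ξ ↦ ?_)
    simp
  rw [modeGenerator_apply_two, map_neg, map_smul, map_add, map_add, map_add, map_smul, map_smul,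
    hlap, hlap, ballPairing_eq_fourier hθ (hg 2 t ht.le) (hw 2 t ht.le),
    ballPairing_eq_fourier hθ (hg 1 t ht.le) (hw 1 t ht.le)]
  simp only [Complex.real_smul]
  have hτc : (τ : ℂ) ≠ 0 := by exact_mod_cast hτ.ne'
  rw [Complex.ofReal_inv]
  field_simp
  linear_combination heq

/-- On a ball, the Fourier transform of a Sobolev solution is a solution of the mode equation. -/
theorem IsSobolevSolution.ae_mode_ball {τ δ γ s : ℝ} (hτ : 0 < τ) (R : ℝ)
    {f : Fin 3 → Lp ℂ 1 (volume : Measure (Rn n))} {φ : Fin 3 → ℝ → 𝓢'(Rn n, ℂ)}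
    (hφ : IsSobolevSolution τ δ γ s (fun k ↦ (f k : 𝓢'(Rn n, ℂ))) φ)
    {g : Fin 3 → ℝ → Rn n → ℂ} (hg : ∀ k t, 0 ≤ t → HasFourierFunction (φ k t) (g k t))
    (hg2 : ∀ k t, 0 ≤ t → MemLp (g k t) 2 (ballMeasure n R)) {t : ℝ} (ht : 0 ≤ t) (k : Fin 3) :
    ∀ᵐ ξ ∂(ballMeasure n R), ∃ u : Fin 3 → ℝ → ℂ,
      IsModeSolution τ δ γ ((2 * Real.pi * ‖ξ‖) ^ 2) u ∧
      (∀ l, u l 0 = Real.Lp.fourierTransform (f l) ξ) ∧ g k t ξ = u k t := by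
  classical
  set w : ℝ → Fin 3 → Lp ℂ 2 (ballMeasure n R) :=
    fun t k ↦ if h : 0 ≤ t then (hg2 k t h).toLp (g k t) else 0 with hwdef
  have hw : ∀ k t, 0 ≤ t → w t k =ᵐ[ballMeasure n R] g k t := fun k t h ↦ by
    simp only [hwdef, dif_pos h]
    exact (hg2 k t h).coeFn_toLp
  have hcont : ∀ k, ContinuousOn (fun t ↦ w t k) (Set.Ici 0) := fun k ↦
    (hφ.cont k).continuousOn_ball (hg k) (hw k)
  set G := modeGenerator τ δ γ (ballMul n R) with hG
  have hWd : ∀ t, 0 ≤ t → HasDerivWithinAt w (G (w t)) (Set.Ici 0) t := by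
    intro t ht
    rw [hasDerivWithinAt_pi]
    intro i
    fin_cases i
    · exact hφ.deriv_zero.hasDerivWithinAt_ball (hg 0) (hg 1) (hw 0) (hw 1) ht
    · exact hφ.deriv_one.hasDerivWithinAt_ball (hg 1) (hg 2) (hw 1) (hw 2) ht
    -- No strong derivative of the second time derivative is assumed. It is recovered from the
    -- distributional equation, whose remaining terms are continuous in L² of the ball.
    · refine hasDerivWithinAt_of_separating (w := fun t ↦ w t 2) (v := fun t ↦ G (w t) 2)
        (fun θ : {θ : 𝓢(Rn n, ℂ) // tsupport θ ⊆ Metric.ball 0 R} ↦ ballPairing R θ.1)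
        (fun y hy ↦ eq_zero_of_ballPairing_eq_zero hy) (hcont 2) ?_ ?_ ht
      · have : ContinuousOn w (Set.Ici 0) := continuousOn_pi.2 hcont
        exact (continuous_apply 2).comp_continuousOn (G.continuous.comp_continuousOn this)
      · exact fun θ t ht ↦ hφ.hasDerivAt_ballPairing hτ hg hw θ.2 ht
  -- A comparison flow in the bounded continuous functions, started from the continuous transforms
  -- of the L¹ data. Evaluation at ξ is continuous there, so inside the ball each ξ yields a scalar
  -- mode.
  obtain ⟨U, hU0, hU⟩ := exists_linear_flow
    (modeGenerator τ δ γ (ContinuousLinearMap.mul ℝ (BoundedContinuousFunction (Rn n) ℂ)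
      (truncatedSymbol n R))) (fun l ↦ Real.Lp.fourierTransform (f l))
  have hUk : ∀ t l, HasDerivAt (fun r ↦ U r l) (modeGenerator τ δ γ (ContinuousLinearMap.mul ℝ
      (BoundedContinuousFunction (Rn n) ℂ) (truncatedSymbol n R)) (U t) l) t :=
    fun t l ↦ hasDerivAt_pi.1 (hU t) l
  set T := BoundedContinuousFunction.toLp 2 (ballMeasure n R) ℝ (E := ℂ) with hT
  have hTU : ∀ t, 0 ≤ t → HasDerivWithinAt (fun r l ↦ T (U r l)) (G (fun l ↦ T (U t l)))
      (Set.Ici 0) t := by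
    intro t _
    refine HasDerivAt.hasDerivWithinAt ?_
    rw [hasDerivAt_pi]
    intro i
    refine (T.hasFDerivAt.comp_hasDerivAt t (hUk t i)).congr_deriv ?_
    fin_cases i
    · rfl
    · rfl
    · simp only [hG, Fin.reduceFinMk, modeGenerator_apply_two, map_neg, map_smul, map_add]
      rw [hT, ballMul_toLp, ballMul_toLp]
      rfl
  have hinit : w 0 = fun l ↦ T (U 0 l) := by
    funext l
    refine Lp.ext ?_
    have h1 : g l 0 =ᵐ[volume] Real.Lp.fourierTransform (f l) := by
      refine (hg l 0 le_rfl).ae_unique ?_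
      rw [hφ.initial l]
      exact hasFourierFunction_of_Lp_one (f l)
    filter_upwards [hw l 0 le_rfl, ae_restrict_of_ae h1,
      BoundedContinuousFunction.coeFn_toLp 2 (ballMeasure n R) ℝ (U 0 l)] with ξ h2 h3 h4
    rw [h2, h3, h4, hU0]
  have hEq : w t = fun l ↦ T (U t l) :=
    linear_flow_unique G (W := fun t l ↦ T (U t l)) hinit hWd hTU ht
  filter_upwards [hw k t ht, BoundedContinuousFunction.coeFn_toLp 2 (ballMeasure n R) ℝ (U t k),
    ae_restrict_mem measurableSet_ball] with ξ h1 h2 h3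
  have hev : ∀ t l, HasDerivAt (fun r ↦ U r l ξ) ((modeGenerator τ δ γ (ContinuousLinearMap.mul ℝ
      (BoundedContinuousFunction (Rn n) ℂ) (truncatedSymbol n R)) (U t) l) ξ) t := fun t l ↦
    (BoundedContinuousFunction.evalCLM ℝ ξ (β := ℂ)).hasFDerivAt.comp_hasDerivAt t (hUk t l)
  refine ⟨fun l r ↦ U r l ξ, ⟨fun r ↦ hev r 0, fun r ↦ hev r 1, fun r ↦ ?_⟩, fun l ↦ ?_, ?_⟩
  · refine (hev r 2).congr_deriv ?_
    rw [modeGenerator_apply_two]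
    simp only [BoundedContinuousFunction.coe_neg, BoundedContinuousFunction.coe_smul,
      BoundedContinuousFunction.coe_add, Pi.neg_apply, Pi.add_apply,
      ContinuousLinearMap.mul_apply', BoundedContinuousFunction.coe_mul, Pi.mul_apply,
      truncatedSymbol_apply h3, Complex.real_smul]
    push_cast
    ring
  · simp only [hU0]
  · rw [← h1, hEq]
    exact h2

/-- The Fourier transform of a Sobolev solution is, at almost every frequency, a solution of the
mode equation with the Fourier transforms of the data as initial values. -/
theorem IsSobolevSolution.exists_ae_mode {τ δ γ s : ℝ} (hτ : 0 < τ)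
    {f : Fin 3 → Lp ℂ 1 (volume : Measure (Rn n))} {φ : Fin 3 → ℝ → 𝓢'(Rn n, ℂ)}
    (hφ : IsSobolevSolution τ δ γ s (fun k ↦ (f k : 𝓢'(Rn n, ℂ))) φ) {t : ℝ} (ht : 0 ≤ t)
    (k : Fin 3) :
    ∃ g : Rn n → ℂ, HasFourierFunction (φ k t) g ∧ ∀ᵐ ξ, ∃ u : Fin 3 → ℝ → ℂ,
      IsModeSolution τ δ γ ((2 * Real.pi * ‖ξ‖) ^ 2) u ∧
      (∀ l, u l 0 = Real.Lp.fourierTransform (f l) ξ) ∧ g ξ = u k t := by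
  have hex : ∀ k t, ∃ g : Rn n → ℂ, 0 ≤ t → HasFourierFunction (φ k t) g ∧ ∀ R,
      MemLp g 2 (ballMeasure n R) := fun k t ↦ by
    by_cases h : 0 ≤ t
    · obtain ⟨g, hg1, hg2⟩ := exists_hasFourierFunction_of_memSobolev ((hφ.cont k) t h).1
      exact ⟨g, fun _ ↦ ⟨hg1, fun R ↦ memLp_ballMeasure_of_memSobolev R hg2⟩⟩
    · exact ⟨0, fun h' ↦ absurd h' h⟩
  choose g hg using hex
  refine ⟨g k t, (hg k t ht).1, ?_⟩
  -- Balls of natural radius exhaust the space, so only countably many null sets have to be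
  -- discarded.
  have hball : ∀ N : ℕ, ∀ᵐ ξ : Rn n, ξ ∈ Metric.ball (0 : Rn n) N → ∃ u : Fin 3 → ℝ → ℂ,
      IsModeSolution τ δ γ ((2 * Real.pi * ‖ξ‖) ^ 2) u ∧
      (∀ l, u l 0 = Real.Lp.fourierTransform (f l) ξ) ∧ g k t ξ = u k t := fun N ↦
    (ae_restrict_iff' measurableSet_ball).1
      (hφ.ae_mode_ball hτ N (fun k t h ↦ (hg k t h).1) (fun k t h ↦ (hg k t h).2 N) ht k)
  filter_upwards [ae_all_iff.2 hball] with ξ hξ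
  obtain ⟨N, hN⟩ := exists_nat_gt ‖ξ‖
  exact hξ N (mem_ball_zero_iff.2 hN)

end Representation

/-! ### Scaling and concentration of Gaussian weights. -/

section GaussianWeights

theorem exists_exp_neg_le_rpow (β : ℝ) {c : ℝ} (hc : 0 < c) :
    ∃ C : ℝ, 0 < C ∧ ∀ t : ℝ, 0 ≤ t → Real.exp (-c * t) ≤ C * (1 + t) ^ (-β) := by
  obtain ⟨N, hN⟩ := exists_nat_ge β
  refine ⟨N.factorial / c ^ N * Real.exp c, by positivity, fun t ht ↦ ?_⟩
  have h1 : (1 + t) ^ β ≤ (1 + t) ^ N := by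
    rw [← Real.rpow_natCast]
    exact Real.rpow_le_rpow_of_exponent_le (by linarith) hN
  have h2 := Real.pow_div_factorial_le_exp (c * (1 + t)) (by positivity) N
  rw [div_le_iff₀ (by positivity), mul_pow] at h2
  rw [Real.rpow_neg (by positivity), ← div_eq_mul_inv, le_div_iff₀ (by positivity)]
  have h3 : Real.exp (-c * t) * Real.exp (c * (1 + t)) = Real.exp c := by
    rw [← Real.exp_add]; congr 1; ring
  calc Real.exp (-c * t) * (1 + t) ^ β ≤ Real.exp (-c * t) * (1 + t) ^ N := by gcongr
    _ = Real.exp (-c * t) * (c ^ N * (1 + t) ^ N) / c ^ N := by field_simp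
    _ ≤ Real.exp (-c * t) * (Real.exp (c * (1 + t)) * N.factorial) / c ^ N := by gcongr
    _ = N.factorial / c ^ N * (Real.exp (-c * t) * Real.exp (c * (1 + t))) := by ring
    _ = _ := by rw [h3]

variable {n : ℕ}

/-- The weight `ρ^a exp (-κ ρ²)`, with `ρ = 2 π |ξ|`. -/
noncomputable def gaussianWeight (a κ : ℝ) (ξ : Rn n) : ℝ :=
  (2 * Real.pi * ‖ξ‖) ^ a * Real.exp (-κ * (2 * Real.pi * ‖ξ‖) ^ 2)

theorem gaussianWeight_nonneg (a κ : ℝ) (ξ : Rn n) : 0 ≤ gaussianWeight a κ ξ := by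
  unfold gaussianWeight; positivity

theorem measurable_gaussianWeight (a κ : ℝ) : Measurable (gaussianWeight a κ : Rn n → ℝ) := by
  unfold gaussianWeight
  fun_prop

/-- In polar coordinates the square behaves like y^(n-1+2a) near 0, which is integrable exactly when
n + 2a > 0; the Gaussian handles infinity. -/
theorem memLp_gaussianWeight (hn : 1 ≤ n) {a κ : ℝ} (ha : 0 < (n : ℝ) + 2 * a) (hκ : 0 < κ) :
    MemLp (gaussianWeight a κ : Rn n → ℝ) 2 volume := by
  rw [memLp_two_iff_integrable_sq (measurable_gaussianWeight a κ).aestronglyMeasurable]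
  have hfin : Module.finrank ℝ (Rn n) = n := finrank_euclideanSpace_fin
  have : Nontrivial (Rn n) := Module.nontrivial_of_finrank_pos (R := ℝ) (by rw [hfin]; omega)
  have key := integrable_fun_norm_addHaar (volume : Measure (Rn n))
    (f := fun y : ℝ ↦ ((2 * Real.pi * y) ^ a * Real.exp (-κ * (2 * Real.pi * y) ^ 2)) ^ 2)
  refine key.2 ?_
  rw [hfin]
  have hb : 0 < 2 * κ * (2 * Real.pi) ^ 2 := by positivity
  have hInt := integrableOn_rpow_mul_exp_neg_mul_sq hb (s := (n : ℝ) - 1 + 2 * a) (by linarith)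
  refine IntegrableOn.congr_fun (hInt.const_mul ((2 * Real.pi) ^ (2 * a))) (fun y hy ↦ ?_) measurableSet_Ioi
  have hy0 : 0 < y := hy
  simp only [smul_eq_mul]
  have h1 : y ^ ((n : ℝ) - 1 + 2 * a) = y ^ (n - 1) * y ^ (2 * a) := by
    rw [Real.rpow_add hy0, ← Real.rpow_natCast, Nat.cast_sub hn, Nat.cast_one]
  have h2 : ((2 * Real.pi * y) ^ a) ^ 2 = (2 * Real.pi) ^ (2 * a) * y ^ (2 * a) := by
    rw [← Real.rpow_natCast, ← Real.rpow_mul (by positivity), Real.mul_rpow (by positivity) hy0.le]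
    push_cast
    rw [mul_comm a 2]
  have h3 : Real.exp (-κ * (2 * Real.pi * y) ^ 2) ^ 2 =
      Real.exp (-(2 * κ * (2 * Real.pi) ^ 2) * y ^ 2) := by
    rw [← Real.exp_nat_mul]; congr 1; push_cast; ring
  rw [mul_pow ((2 * Real.pi * y) ^ a), h1, h2, h3]
  ring

theorem eLpNorm_two_comp_smul {F : Type*} [NormedAddCommGroup F] (h : Rn n → F) {R : ℝ}
    (hR : 0 < R) :
    eLpNorm (fun ξ ↦ h (R • ξ)) 2 volume =
      ENNReal.ofReal (R ^ (-(n : ℝ) / 2)) * eLpNorm h 2 volume := by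
  have hemb : MeasurableEmbedding (fun ξ : Rn n ↦ R • ξ) :=
    (Homeomorph.smulOfNeZero R hR.ne').measurableEmbedding
  have h1 := hemb.eLpNorm_map_measure (g := h) (p := 2) (μ := volume)
  have h2 : Measure.map (fun ξ : Rn n ↦ R • ξ) volume =
      ENNReal.ofReal |(R ^ n)⁻¹| • (volume : Measure (Rn n)) := by
    have := Measure.map_addHaar_smul (volume : Measure (Rn n)) hR.ne'
    rw [finrank_euclideanSpace_fin] at this
    exact this
  rw [h2, eLpNorm_smul_measure_of_ne_top (by norm_num)] at h1
  change eLpNorm (h ∘ fun ξ ↦ R • ξ) 2 volume = _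
  rw [← h1, smul_eq_mul]
  congr 1
  rw [ENNReal.ofReal_rpow_of_nonneg (abs_nonneg _) (by positivity), abs_of_pos (by positivity)]
  congr 1
  rw [← Real.rpow_natCast, ← Real.rpow_neg hR.le, ← Real.rpow_mul hR.le]
  congr 1
  norm_num
  ring

theorem gaussianWeight_smul {a κ T : ℝ} (hT : 0 < T) (ξ : Rn n) :
    gaussianWeight a (κ * T) ξ = T ^ (-a / 2) * gaussianWeight a κ (√T • ξ) := by
  unfold gaussianWeight
  have h1 : 2 * Real.pi * ‖√T • ξ‖ = √T * (2 * Real.pi * ‖ξ‖) := by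
    rw [norm_smul, Real.norm_of_nonneg (Real.sqrt_nonneg _)]; ring
  rw [h1, Real.mul_rpow (Real.sqrt_nonneg _) (by positivity), mul_pow √T, Real.sq_sqrt hT.le]
  have h2 : T ^ (-a / 2) * √T ^ a = 1 := by
    rw [Real.sqrt_eq_rpow, ← Real.rpow_mul hT.le, ← Real.rpow_add hT]
    ring_nf
    exact Real.rpow_zero _
  rw [← mul_assoc, ← mul_assoc, h2, one_mul]
  congr 2
  ring

/-- The substitution ξ → ξ/√T gives T^(-a/2) by homogeneity of the weight and T^(-n/4) from the
Jacobian under the square root. All the decay rates come from this identity. -/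
theorem eLpNorm_gaussianWeight_mul_comp {F : Type*} [NormedAddCommGroup F] [NormedSpace ℝ F]
    {a κ T : ℝ} (hT : 0 < T) (h : Rn n → F) :
    eLpNorm (fun ξ ↦ gaussianWeight a (κ * T) ξ • h ξ) 2 volume =
      ENNReal.ofReal (T ^ (-(((n : ℝ) + 2 * a) / 4))) *
        eLpNorm (fun ξ ↦ gaussianWeight a κ ξ • h ((√T)⁻¹ • ξ)) 2 volume := by
  have hs : 0 < √T := Real.sqrt_pos.2 hT
  have h1 : (fun ξ ↦ gaussianWeight a (κ * T) ξ • h ξ) =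
      T ^ (-a / 2) • fun ξ ↦ (fun η ↦ gaussianWeight a κ η • h ((√T)⁻¹ • η)) (√T • ξ) := by
    funext ξ
    simp only [Pi.smul_apply]
    rw [smul_smul (√T)⁻¹, inv_mul_cancel₀ hs.ne', one_smul, gaussianWeight_smul hT, mul_smul]
  rw [h1, eLpNorm_const_smul,
    eLpNorm_two_comp_smul (fun η ↦ gaussianWeight a κ η • h ((√T)⁻¹ • η)) hs, ← mul_assoc]
  congr 1
  rw [Real.enorm_of_nonneg (by positivity), ← ENNReal.ofReal_mul (by positivity)]
  congr 1
  rw [Real.sqrt_eq_rpow, ← Real.rpow_mul hT.le, ← Real.rpow_add hT]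
  congr 1
  ring

theorem eLpNorm_gaussianWeight {a κ T : ℝ} (hT : 0 < T) :
    eLpNorm (gaussianWeight a (κ * T) : Rn n → ℝ) 2 volume =
      ENNReal.ofReal (T ^ (-(((n : ℝ) + 2 * a) / 4))) *
        eLpNorm (gaussianWeight a κ : Rn n → ℝ) 2 volume := by
  simpa using eLpNorm_gaussianWeight_mul_comp (n := n) (a := a) (κ := κ) hT (fun _ ↦ (1 : ℝ))

/-- Concentration at zero frequency of the Gaussian weights. -/
theorem tendsto_eLpNorm_gaussianWeight_mul_sub (hn : 1 ≤ n) {a κ : ℝ}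
    (ha : 0 < (n : ℝ) + 2 * a) (hκ : 0 < κ) (h : BoundedContinuousFunction (Rn n) ℂ) :
    Tendsto (fun T : ℝ ↦ ENNReal.ofReal (T ^ (((n : ℝ) + 2 * a) / 4)) *
      eLpNorm (fun ξ ↦ gaussianWeight a (κ * T) ξ • (h ξ - h 0)) 2 volume) atTop (𝓝 0) := by
  have hW := memLp_gaussianWeight hn ha hκ
  have hlim : Tendsto (fun T : ℝ ↦
      eLpNorm (fun ξ ↦ gaussianWeight a κ ξ • (h ((√T)⁻¹ • ξ) - h 0)) 2 volume) atTop (𝓝 0) := by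
    -- After rescaling, the integrand tends to 0 pointwise by continuity of h at 0 and is dominated
    -- by 2‖h‖ times the fixed weight.
    have hsq : Tendsto (fun T : ℝ ↦
        ∫⁻ ξ : Rn n, ‖gaussianWeight a κ ξ • (h ((√T)⁻¹ • ξ) - h 0)‖ₑ ^ (2 : ℝ)) atTop
        (𝓝 (∫⁻ _ : Rn n, 0)) := by
      refine tendsto_lintegral_filter_of_dominated_convergence
        (fun ξ ↦ ‖gaussianWeight a κ ξ * (2 * ‖h‖)‖ₑ ^ (2 : ℝ)) ?_ ?_ ?_ ?_
      · refine Eventually.of_forall fun T ↦ ?_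
        have : Measurable fun ξ : Rn n ↦ gaussianWeight a κ ξ • (h ((√T)⁻¹ • ξ) - h 0) := by
          refine (measurable_gaussianWeight a κ).smul ?_
          have : Continuous fun ξ : Rn n ↦ h ((√T)⁻¹ • ξ) - h 0 := by fun_prop
          exact this.measurable
        fun_prop
      · refine Eventually.of_forall fun T ↦ Eventually.of_forall fun ξ ↦ ?_
        refine ENNReal.rpow_le_rpow ?_ (by norm_num)
        rw [enorm_smul, enorm_mul]
        gcongr
        rw [Real.enorm_of_nonneg (by positivity), ← ofReal_norm]
        refine ENNReal.ofReal_le_ofReal ((norm_sub_le _ _).trans ?_)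
        linarith [h.norm_coe_le_norm ((√T)⁻¹ • ξ), h.norm_coe_le_norm 0]
      · have := hW.mul_const (2 * ‖h‖)
        have h2 := (eLpNorm_lt_top_iff_lintegral_rpow_enorm_lt_top (by norm_num) (by norm_num)).1
          this.2
        exact h2.ne
      · refine Eventually.of_forall fun ξ ↦ ?_
        have h1 : Tendsto (fun T : ℝ ↦ (√T)⁻¹ • ξ) atTop (𝓝 ((0 : ℝ) • ξ)) :=
          (tendsto_inv_atTop_zero.comp Real.tendsto_sqrt_atTop).smul_const ξ
        rw [zero_smul] at h1
        have h2 : Tendsto (fun T : ℝ ↦ gaussianWeight a κ ξ • (h ((√T)⁻¹ • ξ) - h 0)) atTop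
            (𝓝 (gaussianWeight a κ ξ • (h 0 - h 0))) :=
          (((h.continuous.tendsto 0).comp h1).sub_const _).const_smul _
        rw [sub_self, smul_zero] at h2
        have h3 := (ENNReal.continuous_rpow_const (y := 2)).tendsto _ |>.comp h2.enorm
        simpa [Function.comp_def] using h3
    rw [lintegral_zero] at hsq
    have h4 := (ENNReal.continuous_rpow_const (y := 1 / 2)).tendsto _ |>.comp hsq
    rw [ENNReal.zero_rpow_of_pos (by norm_num)] at h4
    refine h4.congr fun T ↦ ?_
    rw [eLpNorm_eq_lintegral_rpow_enorm_toReal (by norm_num) (by norm_num)]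
    simp
  refine hlim.congr' ?_
  filter_upwards [eventually_gt_atTop 0] with T hT
  rw [eLpNorm_gaussianWeight_mul_comp hT, ← mul_assoc, ← ENNReal.ofReal_mul (by positivity),
    ← Real.rpow_add hT, add_neg_cancel, Real.rpow_zero, ENNReal.ofReal_one, one_mul]

end GaussianWeights

/-! ### Pointwise bounds for the transformed solution, and the high frequency part of the data. -/

section FrequencyBounds

/-- The low and high frequency estimates of the mode equation with common constants. -/
theorem exists_mode_bounds {τ δ γ : ℝ} (hτ : 0 < τ) (hδ : 0 < δ) (hγ : 0 < γ) (j : Fin 3) :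
    ∃ e C c : ℝ, 0 < e ∧ e ≤ 1 ∧ 0 < C ∧ 0 < c ∧ ∀ ρ : ℝ, 0 < ρ → ∀ u : Fin 3 → ℝ → ℂ,
      IsModeSolution τ δ γ (ρ ^ 2) u → ∀ t : ℝ, 0 ≤ t →
      (ρ ^ 2 ≤ e → ‖u j t - (((-(ρ ^ 2 / γ)) ^ (j : ℕ) * Real.exp (-(ρ ^ 2 / γ) * t) : ℝ) : ℂ) *
          ((γ * u 0 0 + u 1 0 + τ * u 2 0) / γ)‖ ≤
        C * ((ρ ^ 2) ^ ((j : ℕ) + 1) * Real.exp (-c * ρ ^ 2 * t) + Real.exp (-c * t)) *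
          (‖u 0 0‖ + ‖u 1 0‖ + ‖u 2 0‖)) ∧
      (e ≤ ρ ^ 2 → ρ ^ (2 - ((j : ℕ) : ℝ)) * ‖u j t‖ ≤ C * Real.exp (-c * t) *
        (ρ ^ (max 1 (2 - ((j : ℕ) : ℝ))) * ‖u 0 0‖ + ρ * ‖u 1 0‖ + ‖u 2 0‖)) := by
  obtain ⟨e, C₁, c₁, he, he1, hC₁, hc₁, H₁⟩ := exists_mode_asymptotics_low hτ hδ hγ
  obtain ⟨C₂, c₂, hC₂, hc₂, H₂⟩ := exists_mode_decay_high hτ hδ hγ he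
  refine ⟨e, C₁ + C₂, min c₁ c₂, he, he1, by positivity, by positivity, fun ρ hρ u hu t ht ↦
    ⟨fun hρe ↦ ?_, fun hρe ↦ ?_⟩⟩
  · have hx : 0 < ρ ^ 2 := by positivity
    refine (H₁ (ρ ^ 2) hx hρe u hu t ht j).trans ?_
    have hc : -c₁ ≤ -min c₁ c₂ := neg_le_neg (min_le_left _ _)
    gcongr
    linarith
  · have hexp : Real.exp (-c₂ * t) ≤ Real.exp (-min c₁ c₂ * t) :=
      Real.exp_le_exp.2 (mul_le_mul_of_nonneg_right (neg_le_neg (min_le_right _ _)) ht)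
    have hC : C₂ ≤ C₁ + C₂ := by linarith
    obtain ⟨h0, h1, h2⟩ := H₂ ρ hρ hρe u hu t ht
    fin_cases j
    · have e1 : max (1 : ℝ) (2 - ((0 : ℕ) : ℝ)) = (2 : ℕ) := by norm_num
      have e2 : (2 : ℝ) - ((0 : ℕ) : ℝ) = (2 : ℕ) := by norm_num
      simp only [Fin.zero_eta, e1]
      rw [e2, Real.rpow_natCast]
      exact h0.trans (by gcongr)
    · have e1 : max (1 : ℝ) (2 - ((1 : ℕ) : ℝ)) = 1 := by norm_num
      have e2 : (2 : ℝ) - ((1 : ℕ) : ℝ) = 1 := by norm_num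
      simp only [Fin.mk_one, e1]
      rw [e2, Real.rpow_one]
      exact h1.trans (by gcongr)
    · have e1 : max (1 : ℝ) (2 - ((2 : ℕ) : ℝ)) = 1 := by norm_num
      have e2 : (2 : ℝ) - ((2 : ℕ) : ℝ) = 0 := by norm_num
      simp only [Fin.reduceFinMk, e1]
      rw [e2, Real.rpow_zero, Real.rpow_one, one_mul]
      exact h2.trans (by gcongr)

variable {n : ℕ}

/-- The Fourier transform of `γ⁻¹ (γ f₀ + f₁ + τ f₂)`. -/
noncomputable def slowAmplitude (τ γ : ℝ) (f : Fin 3 → Lp ℂ 1 (volume : Measure (Rn n))) :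
    BoundedContinuousFunction (Rn n) ℂ :=
  (γ : ℂ)⁻¹ • ((γ : ℂ) • Real.Lp.fourierTransform (f 0) + Real.Lp.fourierTransform (f 1)
    + (τ : ℂ) • Real.Lp.fourierTransform (f 2))

theorem slowAmplitude_apply (τ γ : ℝ) (f : Fin 3 → Lp ℂ 1 (volume : Measure (Rn n))) (ξ : Rn n) :
    slowAmplitude τ γ f ξ = (γ * Real.Lp.fourierTransform (f 0) ξ
      + Real.Lp.fourierTransform (f 1) ξ + τ * Real.Lp.fourierTransform (f 2) ξ) / γ := by
  rw [div_eq_inv_mul]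
  rfl

theorem slowAmplitude_zero (τ γ : ℝ) (f : Fin 3 → Lp ℂ 1 (volume : Measure (Rn n))) :
    slowAmplitude τ γ f 0 = combinedMoment τ γ f / γ := by
  have h0 : ∀ l, Real.Lp.fourierTransform (f l) 0 = ∫ x, f l x := fun l ↦ by
    rw [Real.Lp.fourierTransform_apply, Real.fourier_eq]
    simp
  have hi : ∀ l, Integrable (f l : Rn n → ℂ) := fun l ↦ L1.integrable_coeFn (f l)
  have h01 : Integrable fun x ↦ (γ : ℂ) * f 0 x + f 1 x := ((hi 0).const_mul _).add (hi 1)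
  rw [slowAmplitude_apply, h0, h0, h0, combinedMoment, integral_add h01 ((hi 2).const_mul _),
    integral_add ((hi 0).const_mul _) (hi 1), integral_const_mul, integral_const_mul]

theorem norm_fourierTransform_le (f : Lp ℂ 1 (volume : Measure (Rn n))) (ξ : Rn n) :
    ‖Real.Lp.fourierTransform f ξ‖ ≤ ‖f‖ := by
  rw [Real.Lp.fourierTransform_apply, Real.fourier_eq]
  refine (norm_integral_le_integral_norm _).trans ?_
  simp_rw [Circle.norm_smul]
  exact (L1.norm_eq_integral_norm f).symm.le

theorem norm_slowAmplitude_le {τ γ : ℝ} (hτ : 0 < τ) (hγ : 0 < γ)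
    (f : Fin 3 → Lp ℂ 1 (volume : Measure (Rn n))) (ξ : Rn n) :
    ‖slowAmplitude τ γ f ξ‖ ≤ (γ + 1 + τ) / γ * (‖f 0‖ + ‖f 1‖ + ‖f 2‖) := by
  rw [slowAmplitude_apply, norm_div, Complex.norm_real, Real.norm_of_nonneg hγ.le,
    div_mul_eq_mul_div]
  gcongr
  refine (norm_add₃_le).trans ?_
  rw [norm_mul, norm_mul, Complex.norm_real, Complex.norm_real, Real.norm_of_nonneg hγ.le,
    Real.norm_of_nonneg hτ.le]
  have h0 := mul_le_mul_of_nonneg_left (norm_fourierTransform_le (f 0) ξ) hγ.le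
  have h1 := norm_fourierTransform_le (f 1) ξ
  have h2 := mul_le_mul_of_nonneg_left (norm_fourierTransform_le (f 2) ξ) hτ.le
  have : 0 ≤ γ * ‖f 1‖ := by positivity
  have : 0 ≤ γ * ‖f 2‖ := by positivity
  have : 0 ≤ τ * ‖f 1‖ := by positivity
  have : 0 ≤ τ * ‖f 0‖ := by positivity
  have : 0 ≤ ‖f 0‖ := norm_nonneg _
  have : 0 ≤ ‖f 2‖ := norm_nonneg _
  linarith

/-- The part of the datum `f` at angular frequencies with `ρ² ≥ e`, with the weight `ρ^q`. -/
noncomputable def highFrequencyPart (e q : ℝ) (f : Lp ℂ 1 (volume : Measure (Rn n))) :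
    Rn n → ℝ :=
  {ξ : Rn n | e ≤ (2 * Real.pi * ‖ξ‖) ^ 2}.indicator
    fun ξ ↦ (2 * Real.pi * ‖ξ‖) ^ q * ‖Real.Lp.fourierTransform f ξ‖

theorem measurable_highFrequencyPart (e q : ℝ) (f : Lp ℂ 1 (volume : Measure (Rn n))) :
    Measurable (highFrequencyPart e q f) := by
  refine Measurable.indicator ?_ (measurableSet_le measurable_const (by fun_prop))
  have : Measurable (Real.Lp.fourierTransform f) :=
    (Real.Lp.fourierTransform f).continuous.measurable
  fun_prop

theorem highFrequencyPart_nonneg (e q : ℝ) (f : Lp ℂ 1 (volume : Measure (Rn n))) (ξ : Rn n) :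
    0 ≤ highFrequencyPart e q f ξ :=
  Set.indicator_nonneg (fun ξ _ ↦ by positivity) ξ

/-- The contributions of the three data at high frequency. -/
noncomputable def highFrequencyData (e s : ℝ) (j : Fin 3)
    (f : Fin 3 → Lp ℂ 1 (volume : Measure (Rn n))) (ξ : Rn n) : ℝ :=
  highFrequencyPart e (s + max 1 (2 - ((j : ℕ) : ℝ))) (f 0) ξ
    + highFrequencyPart e (s + 1) (f 1) ξ + highFrequencyPart e s (f 2) ξ

theorem measurable_highFrequencyData (e s : ℝ) (j : Fin 3)
    (f : Fin 3 → Lp ℂ 1 (volume : Measure (Rn n))) : Measurable (highFrequencyData e s j f) :=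
  ((measurable_highFrequencyPart e _ (f 0)).add (measurable_highFrequencyPart e _ (f 1))).add
    (measurable_highFrequencyPart e _ (f 2))

theorem highFrequencyData_nonneg (e s : ℝ) (j : Fin 3)
    (f : Fin 3 → Lp ℂ 1 (volume : Measure (Rn n))) (ξ : Rn n) :
    0 ≤ highFrequencyData e s j f ξ :=
  add_nonneg (add_nonneg (highFrequencyPart_nonneg _ _ _ _) (highFrequencyPart_nonneg _ _ _ _))
    (highFrequencyPart_nonneg _ _ _ _)

theorem eLpNorm_highFrequencyPart_le_hom (e q : ℝ) (f : Lp ℂ 1 (volume : Measure (Rn n))) :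
    eLpNorm (highFrequencyPart e q f) 2 volume ≤ homSobolevNorm q (f : 𝓢'(Rn n, ℂ)) := by
  rw [homSobolevNorm, (hasFourierFunction_of_Lp_one f).weightedFourierNorm_eq]
  refine eLpNorm_mono fun ξ ↦ ?_
  rw [highFrequencyPart]
  refine (norm_indicator_le_norm_self _ _).trans (le_of_eq ?_)
  rw [norm_mul, norm_norm, norm_mul, Complex.norm_real]

/-- For ρ² ≥ e the quotient (1+ρ²)/ρ² lies between 1 and 1 + 1/e, so ρ^q is controlled by
(1+ρ²)^(q/2) for q of either sign. -/
theorem eLpNorm_highFrequencyPart_le_sobolev {e : ℝ} (he : 0 < e) (q : ℝ)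
    (f : Lp ℂ 1 (volume : Measure (Rn n))) :
    eLpNorm (highFrequencyPart e q f) 2 volume ≤
      ENNReal.ofReal ((1 + 1 / e) ^ |q / 2|) * sobolevNorm q (f : 𝓢'(Rn n, ℂ)) := by
  rw [sobolevNorm, (hasFourierFunction_of_Lp_one f).weightedFourierNorm_eq]
  refine eLpNorm_le_mul_eLpNorm_of_ae_le_mul (Eventually.of_forall fun ξ ↦ ?_) 2
  rw [Real.norm_of_nonneg (highFrequencyPart_nonneg _ _ _ _), highFrequencyPart, norm_mul,
    Complex.norm_real, Real.norm_of_nonneg (by positivity)]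
  refine Set.indicator_apply_le' (fun hξ ↦ ?_) (fun _ ↦ by positivity)
  have hx : e ≤ (2 * Real.pi * ‖ξ‖) ^ 2 := hξ
  have hρ : 0 ≤ 2 * Real.pi * ‖ξ‖ := by positivity
  generalize 2 * Real.pi * ‖ξ‖ = ρ at hx hρ
  have hx0 : 0 < ρ ^ 2 := he.trans_le hx
  rw [← mul_assoc]
  gcongr
  have h1 : ρ ^ q = (1 + ρ ^ 2) ^ (q / 2) * ((1 + ρ ^ 2) / ρ ^ 2) ^ (-(q / 2)) := by
    rw [Real.rpow_neg (by positivity), Real.div_rpow (by positivity) (by positivity), inv_div,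
      mul_div_cancel₀ _ (by positivity), ← Real.rpow_natCast, ← Real.rpow_mul hρ]
    congr 1
    push_cast
    ring
  have h2 : 1 ≤ (1 + ρ ^ 2) / ρ ^ 2 := by rw [le_div_iff₀ hx0]; linarith
  have h3 : (1 + ρ ^ 2) / ρ ^ 2 ≤ 1 + 1 / e := by
    rw [add_div, div_self hx0.ne', add_comm]
    gcongr
  rw [h1, mul_comm]
  gcongr
  calc ((1 + ρ ^ 2) / ρ ^ 2) ^ (-(q / 2)) ≤ ((1 + ρ ^ 2) / ρ ^ 2) ^ |q / 2| :=
        Real.rpow_le_rpow_of_exponent_le h2 (neg_le_abs _)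
    _ ≤ _ := by gcongr

/-- High frequency data are controlled by any data norm that controls each of its parts. -/
theorem eLpNorm_highFrequencyData_le {e s : ℝ} {j : Fin 3} {K : ℝ≥0∞}
    {N : ℝ → 𝓢'(Rn n, ℂ) → ℝ≥0∞} {f : Fin 3 → Lp ℂ 1 (volume : Measure (Rn n))}
    (h0 : eLpNorm (highFrequencyPart e (s + max 1 (2 - ((j : ℕ) : ℝ))) (f 0)) 2 volume ≤
      K * N (s + max 1 (2 - ((j : ℕ) : ℝ))) (f 0 : 𝓢'(Rn n, ℂ)))
    (h1 : eLpNorm (highFrequencyPart e (s + 1) (f 1)) 2 volume ≤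
      K * N (s + 1) (f 1 : 𝓢'(Rn n, ℂ)))
    (h2 : eLpNorm (highFrequencyPart e s (f 2)) 2 volume ≤ K * N s (f 2 : 𝓢'(Rn n, ℂ))) :
    eLpNorm (highFrequencyData e s j f) 2 volume ≤ K * dataNorm N s j f := by
  have m0 := (measurable_highFrequencyPart e (s + max 1 (2 - ((j : ℕ) : ℝ))) (f 0))
  have m1 := (measurable_highFrequencyPart e (s + 1) (f 1))
  have m2 := (measurable_highFrequencyPart e s (f 2))
  have key : eLpNorm (highFrequencyData e s j f) 2 volume ≤
      eLpNorm (highFrequencyPart e (s + max 1 (2 - ((j : ℕ) : ℝ))) (f 0)) 2 volume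
        + eLpNorm (highFrequencyPart e (s + 1) (f 1)) 2 volume
        + eLpNorm (highFrequencyPart e s (f 2)) 2 volume := by
    refine (eLpNorm_add_le (f := highFrequencyPart e (s + max 1 (2 - ((j : ℕ) : ℝ))) (f 0)
      + highFrequencyPart e (s + 1) (f 1)) (m0.add m1).aestronglyMeasurable
      m2.aestronglyMeasurable (by norm_num)).trans ?_
    gcongr
    exact eLpNorm_add_le m0.aestronglyMeasurable m1.aestronglyMeasurable (by norm_num)
  refine key.trans ?_
  rw [dataNorm, mul_add, mul_add]
  gcongr
  · exact h0.trans (by gcongr; exact le_self_add)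
  · exact h1.trans (by gcongr; exact le_self_add)
  · exact h2.trans (by gcongr; exact le_self_add)

theorem sum_enorm_le_dataNorm (N : ℝ → 𝓢'(Rn n, ℂ) → ℝ≥0∞) (s : ℝ) (j : Fin 3)
    (f : Fin 3 → Lp ℂ 1 (volume : Measure (Rn n))) :
    ENNReal.ofReal (‖f 0‖ + ‖f 1‖ + ‖f 2‖) ≤ dataNorm N s j f := by
  rw [ENNReal.ofReal_add (by positivity) (by positivity),
    ENNReal.ofReal_add (by positivity) (by positivity), ofReal_norm, ofReal_norm, ofReal_norm,
    dataNorm]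
  gcongr <;> exact le_add_self

theorem sobolevNorm_ne_top_of_memSobolev {r : ℝ} {u : 𝓢'(Rn n, ℂ)}
    (hu : TemperedDistribution.MemSobolev r 2 u) : sobolevNorm r u ≠ ∞ := by
  obtain ⟨g, hg, hg2⟩ := exists_hasFourierFunction_of_memSobolev hu
  rw [sobolevNorm, hg.weightedFourierNorm_eq]
  exact hg2.2.ne

/-- The index max{1, 2-j} is at most 2, so the assumed regularity of the data suffices. Finiteness
is needed for the profile, where the high frequency contribution must tend to 0. -/
theorem dataNorm_sobolevNorm_ne_top {s : ℝ} (j : Fin 3)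
    {f : Fin 3 → Lp ℂ 1 (volume : Measure (Rn n))}
    (hf : ∀ k : Fin 3, TemperedDistribution.MemSobolev (s + 2 - ((k : ℕ) : ℝ)) 2
      (f k : 𝓢'(Rn n, ℂ))) : dataNorm sobolevNorm s j f ≠ ∞ := by
  have h0 : sobolevNorm (s + max 1 (2 - ((j : ℕ) : ℝ))) (f 0 : 𝓢'(Rn n, ℂ)) ≠ ∞ := by
    refine sobolevNorm_ne_top_of_memSobolev ((hf 0).mono ?_)
    have hj : (0 : ℝ) ≤ ((j : ℕ) : ℝ) := Nat.cast_nonneg _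
    have : max 1 (2 - ((j : ℕ) : ℝ)) ≤ 2 := max_le (by norm_num) (by linarith)
    simp only [Fin.val_zero, Nat.cast_zero]
    linarith
  have h1 : sobolevNorm (s + 1) (f 1 : 𝓢'(Rn n, ℂ)) ≠ ∞ := by
    refine sobolevNorm_ne_top_of_memSobolev ((hf 1).mono ?_)
    simp only [Fin.val_one, Nat.cast_one]
    linarith
  have h2 : sobolevNorm s (f 2 : 𝓢'(Rn n, ℂ)) ≠ ∞ := by
    refine sobolevNorm_ne_top_of_memSobolev ((hf 2).mono ?_)
    simp only [Fin.val_two, Nat.cast_ofNat]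
    linarith
  rw [dataNorm]
  simp only [ne_eq, ENNReal.add_eq_top, h0, h1, h2, enorm_ne_top, or_self, not_false_eq_true]

theorem ae_norm_pos (hn : 1 ≤ n) : ∀ᵐ ξ : Rn n, 0 < ‖ξ‖ := by
  have hfin : Module.finrank ℝ (Rn n) = n := finrank_euclideanSpace_fin
  have : Nontrivial (Rn n) := Module.nontrivial_of_finrank_pos (R := ℝ) (by rw [hfin]; omega)
  filter_upwards [Measure.ae_ne volume (0 : Rn n)] with ξ hξ
  exact norm_pos_iff.2 hξ

/-- Pointwise estimates of the Fourier transform of a Sobolev solution. -/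
theorem exists_fourier_bounds (hn : 1 ≤ n) {τ δ γ : ℝ} (hτ : 0 < τ) (hδ : 0 < δ) (hγ : 0 < γ)
    (s : ℝ) (j : Fin 3) :
    ∃ e C c : ℝ, 0 < e ∧ e ≤ 1 ∧ 0 < C ∧ 0 < c ∧
      ∀ (f : Fin 3 → Lp ℂ 1 (volume : Measure (Rn n))) (φ : Fin 3 → ℝ → 𝓢'(Rn n, ℂ)),
      IsSobolevSolution τ δ γ s (fun k ↦ (f k : 𝓢'(Rn n, ℂ))) φ → ∀ t : ℝ, 0 ≤ t →
      ∃ g : Rn n → ℂ, HasFourierFunction (φ j t) g ∧ ∀ᵐ ξ, 0 < 2 * Real.pi * ‖ξ‖ ∧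
        ((2 * Real.pi * ‖ξ‖) ^ 2 ≤ e →
          ‖g ξ - (((-((2 * Real.pi * ‖ξ‖) ^ 2 / γ)) ^ (j : ℕ) *
            Real.exp (-((2 * Real.pi * ‖ξ‖) ^ 2 / γ) * t) : ℝ) : ℂ) * slowAmplitude τ γ f ξ‖ ≤
          C * (((2 * Real.pi * ‖ξ‖) ^ 2) ^ ((j : ℕ) + 1) *
            Real.exp (-c * (2 * Real.pi * ‖ξ‖) ^ 2 * t) + Real.exp (-c * t)) *
            (‖f 0‖ + ‖f 1‖ + ‖f 2‖)) ∧
        (e ≤ (2 * Real.pi * ‖ξ‖) ^ 2 →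
          (2 * Real.pi * ‖ξ‖) ^ (s + 2 - ((j : ℕ) : ℝ)) * ‖g ξ‖ ≤
          C * Real.exp (-c * t) * highFrequencyData e s j f ξ) := by
  obtain ⟨e, C, c, he, he1, hC, hc, H⟩ := exists_mode_bounds hτ hδ hγ j
  refine ⟨e, C, c, he, he1, hC, hc, fun f φ hφ t ht ↦ ?_⟩
  obtain ⟨g, hg, hmode⟩ := hφ.exists_ae_mode hτ ht j
  refine ⟨g, hg, ?_⟩
  filter_upwards [hmode, ae_norm_pos hn] with ξ ⟨u, hu, hu0, hgu⟩ hξ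
  have hρ : 0 < 2 * Real.pi * ‖ξ‖ := by positivity
  obtain ⟨hlow, hhigh⟩ := H _ hρ u hu t ht
  refine ⟨hρ, fun hx ↦ ?_, fun hx ↦ ?_⟩
  · rw [hgu, slowAmplitude_apply, ← hu0 0, ← hu0 1, ← hu0 2]
    refine (hlow hx).trans ?_
    have h0 : ‖u 0 0‖ ≤ ‖f 0‖ := by rw [hu0 0]; exact norm_fourierTransform_le _ _
    have h1 : ‖u 1 0‖ ≤ ‖f 1‖ := by rw [hu0 1]; exact norm_fourierTransform_le _ _
    have h2 : ‖u 2 0‖ ≤ ‖f 2‖ := by rw [hu0 2]; exact norm_fourierTransform_le _ _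
    gcongr
  · have hmem : ξ ∈ {ξ : Rn n | e ≤ (2 * Real.pi * ‖ξ‖) ^ 2} := hx
    have h := hhigh hx
    rw [hgu, highFrequencyData, highFrequencyPart, highFrequencyPart, highFrequencyPart,
      Set.indicator_of_mem hmem, Set.indicator_of_mem hmem, Set.indicator_of_mem hmem, ← hu0 0,
      ← hu0 1, ← hu0 2]
    generalize 2 * Real.pi * ‖ξ‖ = ρ at hρ h
    have e1 : ρ ^ (s + 2 - ((j : ℕ) : ℝ)) = ρ ^ s * ρ ^ (2 - ((j : ℕ) : ℝ)) := by
      rw [← Real.rpow_add hρ]; congr 1; ring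
    rw [e1, Real.rpow_add hρ, Real.rpow_add hρ, Real.rpow_one]
    calc ρ ^ s * ρ ^ (2 - ((j : ℕ) : ℝ)) * ‖u j t‖ = ρ ^ s * (ρ ^ (2 - ((j : ℕ) : ℝ)) * ‖u j t‖) :=
          by ring
      _ ≤ ρ ^ s * (C * Real.exp (-c * t) *
        (ρ ^ (max 1 (2 - ((j : ℕ) : ℝ))) * ‖u 0 0‖ + ρ * ‖u 1 0‖ + ‖u 2 0‖)) := by gcongr
      _ = _ := by ring

end FrequencyBounds

/-! ### Upper bounds. -/

section DecayEstimates

theorem rpow_mul_sq_pow {ρ : ℝ} (hρ : 0 < ρ) (r : ℝ) (k : ℕ) :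
    ρ ^ r * (ρ ^ 2) ^ k = ρ ^ (r + 2 * k) := by
  rw [← pow_mul, ← Real.rpow_natCast, ← Real.rpow_add hρ]
  push_cast
  rfl

theorem norm_diffusive_symbol {γ : ℝ} (hγ : 0 < γ) (x t : ℝ) (hx : 0 ≤ x) (j : ℕ) :
    ‖(((-(x / γ)) ^ j * Real.exp (-(x / γ) * t) : ℝ) : ℂ)‖ =
      (γ ^ j)⁻¹ * x ^ j * Real.exp (-(1 / γ) * x * t) := by
  rw [Complex.norm_real, norm_mul, norm_pow, norm_neg, Real.norm_of_nonneg (by positivity),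
    Real.norm_of_nonneg (Real.exp_pos _).le, div_pow]
  congr 1
  · field_simp
  · congr 1; ring

/-- Low frequency upper bound with Gaussian weights. -/
theorem low_frequency_bound {γ C c c' W M ρ r t : ℝ} {j : ℕ} {g A : ℂ} (hγ : 0 < γ) (hC : 0 < C)
    (hc' : 0 < c') (hcc : c' ≤ c) (hcγ : c' ≤ 1 / γ) (hW : 0 < W) (hM : 0 ≤ M) (hρ : 0 < ρ)
    (ht : 0 ≤ t) (hρ1 : ρ ^ 2 ≤ 1) (hA : ‖A‖ ≤ W * M)
    (hg : ‖g - (((-(ρ ^ 2 / γ)) ^ j * Real.exp (-(ρ ^ 2 / γ) * t) : ℝ) : ℂ) * A‖ ≤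
      C * ((ρ ^ 2) ^ (j + 1) * Real.exp (-c * ρ ^ 2 * t) + Real.exp (-c * t)) * M) :
    ρ ^ r * ‖g‖ ≤ (Real.exp c' * ((γ ^ j)⁻¹ * W + C) * M) *
        (ρ ^ (r + 2 * j) * Real.exp (-(c' * (1 + t)) * ρ ^ 2))
      + (C * Real.exp 1 * Real.exp (-c * t) * M) * (ρ ^ r * Real.exp (-1 * ρ ^ 2)) := by
  have hx : 0 < ρ ^ 2 := by positivity
  have hp := norm_diffusive_symbol hγ (ρ ^ 2) t hx.le j
  -- Replacing t by 1 + t costs only the factor exp(c') because ρ ≤ 1, and avoids the singularity of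
  -- the scaling at t = 0.
  have hE : ∀ b, c' ≤ b → Real.exp (-b * ρ ^ 2 * t) ≤
      Real.exp c' * Real.exp (-(c' * (1 + t)) * ρ ^ 2) := fun b hb ↦ by
    rw [← Real.exp_add]
    apply Real.exp_le_exp.2
    have h1 := mul_le_mul_of_nonneg_right hb (mul_nonneg hx.le ht)
    have h2 := mul_le_mul_of_nonneg_left hρ1 hc'.le
    linarith
  -- On ρ ≤ 1 the constant 1 is majorised by a Gaussian, so the exponentially small error can be
  -- measured by ρ^r exp(-ρ²).
  have h1 : 1 ≤ Real.exp 1 * Real.exp (-1 * ρ ^ 2) := by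
    rw [← Real.exp_add]
    exact Real.one_le_exp (by linarith)
  have hxj : (ρ ^ 2) ^ (j + 1) ≤ (ρ ^ 2) ^ j :=
    pow_le_pow_of_le_one hx.le hρ1 (Nat.le_succ j)
  set p : ℂ := (((-(ρ ^ 2 / γ)) ^ j * Real.exp (-(ρ ^ 2 / γ) * t) : ℝ) : ℂ)
  set G := Real.exp (-(c' * (1 + t)) * ρ ^ 2)
  have hgn : ‖g‖ ≤ (γ ^ j)⁻¹ * (ρ ^ 2) ^ j * (Real.exp c' * G) * (W * M)
      + C * ((ρ ^ 2) ^ j * (Real.exp c' * G)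
        + Real.exp (-c * t) * (Real.exp 1 * Real.exp (-1 * ρ ^ 2))) * M := by
    calc ‖g‖ = ‖p * A + (g - p * A)‖ := by rw [add_sub_cancel]
      _ ≤ ‖p‖ * ‖A‖ + ‖g - p * A‖ := (norm_add_le _ _).trans (by rw [norm_mul])
      _ ≤ (γ ^ j)⁻¹ * (ρ ^ 2) ^ j * Real.exp (-(1 / γ) * ρ ^ 2 * t) * (W * M)
        + C * ((ρ ^ 2) ^ (j + 1) * Real.exp (-c * ρ ^ 2 * t) + Real.exp (-c * t) * 1) * M := by
          rw [hp, mul_one]; gcongr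
      _ ≤ _ := by
        gcongr
        · exact hE _ hcγ
        · exact hE _ hcc
  rw [← rpow_mul_sq_pow hρ]
  calc ρ ^ r * ‖g‖ ≤ _ := mul_le_mul_of_nonneg_left hgn (by positivity)
    _ = _ := by ring

/-- Low frequency bound of the distance from the slow mode with Gaussian weights. -/
theorem low_frequency_remainder_bound {C c c' M ρ r t : ℝ} {j : ℕ} {d : ℂ} (hC : 0 < C)
    (hcc : c' ≤ c) (hM : 0 ≤ M) (hρ : 0 < ρ) (ht : 0 ≤ t) (hρ1 : ρ ^ 2 ≤ 1)
    (hd : ‖d‖ ≤ C * ((ρ ^ 2) ^ (j + 1) * Real.exp (-c * ρ ^ 2 * t) + Real.exp (-c * t)) * M) :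
    ρ ^ r * ‖d‖ ≤ (C * M) * (ρ ^ (r + 2 * (j + 1 : ℕ)) * Real.exp (-(c' * t) * ρ ^ 2))
      + (C * Real.exp 1 * Real.exp (-c * t) * M) * (ρ ^ r * Real.exp (-1 * ρ ^ 2)) := by
  have hx : 0 < ρ ^ 2 := by positivity
  have h1 : 1 ≤ Real.exp 1 * Real.exp (-1 * ρ ^ 2) := by
    rw [← Real.exp_add]
    exact Real.one_le_exp (by linarith)
  have h2 : Real.exp (-c * ρ ^ 2 * t) ≤ Real.exp (-(c' * t) * ρ ^ 2) := by
    apply Real.exp_le_exp.2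
    have := mul_le_mul_of_nonneg_right hcc (mul_nonneg hx.le ht)
    linarith
  have h3 : ‖d‖ ≤ C * ((ρ ^ 2) ^ (j + 1) * Real.exp (-(c' * t) * ρ ^ 2)
      + Real.exp (-c * t) * (Real.exp 1 * Real.exp (-1 * ρ ^ 2))) * M := by
    refine hd.trans ?_
    rw [← mul_one (Real.exp (-c * t)), mul_assoc (Real.exp (-c * t)), one_mul]
    gcongr
  rw [← rpow_mul_sq_pow hρ]
  calc ρ ^ r * ‖d‖ ≤ _ := mul_le_mul_of_nonneg_left h3 (by positivity)
    _ = _ := by ring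

/-- At high frequencies the diffusive symbol is of lower order. -/
theorem high_frequency_remainder_bound {γ e c' W M ρ r t B : ℝ} {j : ℕ} {g A : ℂ} (hγ : 0 < γ)
    (he : 0 < e) (hcγ : c' ≤ 1 / γ) (hρ : 0 < ρ)
    (ht : 0 ≤ t) (hρe : e ≤ ρ ^ 2) (hA : ‖A‖ ≤ W * M) (hg : ρ ^ r * ‖g‖ ≤ B) :
    ρ ^ r * ‖g - (((-(ρ ^ 2 / γ)) ^ j * Real.exp (-(ρ ^ 2 / γ) * t) : ℝ) : ℂ) * A‖ ≤
      ((γ ^ j)⁻¹ * W / e * M) * (ρ ^ (r + 2 * (j + 1 : ℕ)) * Real.exp (-(c' * t) * ρ ^ 2)) + B := by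
  have hx : 0 < ρ ^ 2 := by positivity
  have hp := norm_diffusive_symbol hγ (ρ ^ 2) t hx.le j
  set p : ℂ := (((-(ρ ^ 2 / γ)) ^ j * Real.exp (-(ρ ^ 2 / γ) * t) : ℝ) : ℂ)
  have h2 : Real.exp (-(1 / γ) * ρ ^ 2 * t) ≤ Real.exp (-(c' * t) * ρ ^ 2) := by
    apply Real.exp_le_exp.2
    have := mul_le_mul_of_nonneg_right hcγ (mul_nonneg hx.le ht)
    linarith
  -- Since ρ² ≥ e, one more power of ρ² can be inserted; the diffusive tail then fits under the same
  -- weight of order j + 1 as the low frequency error.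
  have h3 : (ρ ^ 2) ^ j ≤ (ρ ^ 2) ^ (j + 1) / e := by
    rw [le_div_iff₀ he, pow_succ]
    exact mul_le_mul_of_nonneg_left hρe (by positivity)
  have h4 : ‖p‖ * ‖A‖ ≤
      (γ ^ j)⁻¹ * ((ρ ^ 2) ^ (j + 1) / e) * Real.exp (-(c' * t) * ρ ^ 2) * (W * M) := by
    rw [hp]
    gcongr
  rw [← rpow_mul_sq_pow hρ]
  calc ρ ^ r * ‖g - p * A‖ ≤ ρ ^ r * (‖p‖ * ‖A‖ + ‖g‖) := by
        gcongr
        refine (norm_sub_le _ _).trans ?_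
        rw [norm_mul, add_comm]
    _ = ρ ^ r * (‖p‖ * ‖A‖) + ρ ^ r * ‖g‖ := by ring
    _ ≤ ρ ^ r * ((γ ^ j)⁻¹ * ((ρ ^ 2) ^ (j + 1) / e) * Real.exp (-(c' * t) * ρ ^ 2) * (W * M)) + B :=
        add_le_add (mul_le_mul_of_nonneg_left h4 (by positivity)) hg
    _ = _ := by ring

variable {n : ℕ}

theorem eLpNorm_two_le_of_norm_le_add {F : Rn n → ℂ} {w₁ w₂ w₃ : Rn n → ℝ} {a b d : ℝ}
    (ha : 0 ≤ a) (hb : 0 ≤ b) (hd : 0 ≤ d) (h₁ : Measurable w₁) (h₂ : Measurable w₂)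
    (h₃ : Measurable w₃) (hF : ∀ᵐ ξ, ‖F ξ‖ ≤ a * w₁ ξ + b * w₂ ξ + d * w₃ ξ) :
    eLpNorm F 2 volume ≤ ENNReal.ofReal a * eLpNorm w₁ 2 volume
      + ENNReal.ofReal b * eLpNorm w₂ 2 volume + ENNReal.ofReal d * eLpNorm w₃ 2 volume := by
  have hs : ∀ {k : ℝ} (w : Rn n → ℝ), 0 ≤ k →
      ENNReal.ofReal k * eLpNorm w 2 volume = eLpNorm (k • w) 2 volume := fun w hk ↦ by
    rw [eLpNorm_const_smul, Real.enorm_of_nonneg hk]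
  rw [hs w₁ ha, hs w₂ hb, hs w₃ hd]
  have m₁ : AEStronglyMeasurable (a • w₁) volume := (h₁.const_smul a).aestronglyMeasurable
  have m₂ : AEStronglyMeasurable (b • w₂) volume := (h₂.const_smul b).aestronglyMeasurable
  have m₃ : AEStronglyMeasurable (d • w₃) volume := (h₃.const_smul d).aestronglyMeasurable
  calc eLpNorm F 2 volume ≤ eLpNorm (a • w₁ + b • w₂ + d • w₃) 2 volume := by
        refine eLpNorm_mono_ae_real ?_
        filter_upwards [hF] with ξ hξ
        simpa using hξ
    _ ≤ eLpNorm (a • w₁ + b • w₂) 2 volume + eLpNorm (d • w₃) 2 volume :=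
        eLpNorm_add_le (m₁.add m₂) m₃ (by norm_num)
    _ ≤ _ := by
        gcongr
        exact eLpNorm_add_le m₁ m₂ (by norm_num)

/-- Decay of the solution in terms of the high frequency part and the `L¹` norm of the data. -/
theorem exists_homSobolevNorm_le (hn : 1 ≤ n) {τ δ γ : ℝ} (hτ : 0 < τ) (hδ : 0 < δ) (hγ : 0 < γ)
    (s : ℝ) (j : Fin 3) (hr : 0 < (n : ℝ) + 2 * (s + 2 - ((j : ℕ) : ℝ))) :
    ∃ e C : ℝ, 0 < e ∧ 0 < C ∧
      ∀ (f : Fin 3 → Lp ℂ 1 (volume : Measure (Rn n))) (φ : Fin 3 → ℝ → 𝓢'(Rn n, ℂ)),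
      IsSobolevSolution τ δ γ s (fun k ↦ (f k : 𝓢'(Rn n, ℂ))) φ → ∀ t : ℝ, 0 ≤ t →
      homSobolevNorm (s + 2 - ((j : ℕ) : ℝ)) (φ j t) ≤
        ENNReal.ofReal (C * (1 + t) ^ (-decayRate n s j)) *
          (ENNReal.ofReal (‖f 0‖ + ‖f 1‖ + ‖f 2‖) + eLpNorm (highFrequencyData e s j f) 2 volume) := by
  obtain ⟨e, C, c, he, he1, hC, hc, H⟩ := exists_fourier_bounds hn hτ hδ hγ s j
  obtain ⟨D, hD, hexp⟩ := exists_exp_neg_le_rpow (decayRate n s j) hc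
  set r : ℝ := s + 2 - ((j : ℕ) : ℝ) with hrdef
  have hj : (0 : ℝ) ≤ ((j : ℕ) : ℝ) := Nat.cast_nonneg _
  have hra : 0 < (n : ℝ) + 2 * (r + 2 * ((j : ℕ) : ℝ)) := by linarith
  set c' := min c (1 / γ) with hc'def
  have hc' : 0 < c' := by positivity
  have hG₁ := memLp_gaussianWeight hn hra hc'
  have hG₂ := memLp_gaussianWeight hn hr one_pos
  have hrate : ((n : ℝ) + 2 * (r + 2 * ((j : ℕ) : ℝ))) / 4 = decayRate n s j := by
    rw [decayRate, hrdef]; ring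
  set V₁ := (eLpNorm (gaussianWeight (n := n) (r + 2 * ((j : ℕ) : ℝ)) c') 2 volume).toReal
  set V₂ := (eLpNorm (gaussianWeight (n := n) r 1) 2 volume).toReal
  have hV₁ : eLpNorm (gaussianWeight (n := n) (r + 2 * ((j : ℕ) : ℝ)) c') 2 volume =
    ENNReal.ofReal V₁ := (ENNReal.ofReal_toReal hG₁.2.ne).symm
  have hV₂ : eLpNorm (gaussianWeight (n := n) r 1) 2 volume =
    ENNReal.ofReal V₂ := (ENNReal.ofReal_toReal hG₂.2.ne).symm
  have hV₁0 : 0 ≤ V₁ := ENNReal.toReal_nonneg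
  have hV₂0 : 0 ≤ V₂ := ENNReal.toReal_nonneg
  set W := (γ + 1 + τ) / γ
  have hW : 0 < W := by positivity
  set K₁ := Real.exp c' * ((γ ^ (j : ℕ))⁻¹ * W + C)
  have hK₁ : 0 < K₁ := by positivity
  refine ⟨e, K₁ * V₁ + C * Real.exp 1 * D * V₂ + C * D, he, by positivity, fun f φ hφ t ht ↦ ?_⟩
  obtain ⟨g, hg, hgb⟩ := H f φ hφ t ht
  set M := ‖f 0‖ + ‖f 1‖ + ‖f 2‖
  have hM : 0 ≤ M := by positivity
  rw [homSobolevNorm, hg.weightedFourierNorm_eq]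
  have key : eLpNorm (fun ξ ↦ (((2 * Real.pi * ‖ξ‖) ^ r : ℝ) : ℂ) * g ξ) 2 volume ≤
      ENNReal.ofReal (K₁ * M) *
        eLpNorm (gaussianWeight (n := n) (r + 2 * ((j : ℕ) : ℝ)) (c' * (1 + t))) 2 volume
      + ENNReal.ofReal (C * Real.exp 1 * Real.exp (-c * t) * M) *
        eLpNorm (gaussianWeight (n := n) r 1) 2 volume
      + ENNReal.ofReal (C * Real.exp (-c * t)) * eLpNorm (highFrequencyData e s j f) 2 volume := by
    refine eLpNorm_two_le_of_norm_le_add (by positivity) (by positivity) (by positivity)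
      (measurable_gaussianWeight _ _) (measurable_gaussianWeight _ _)
      (measurable_highFrequencyData _ _ _ _) ?_
    filter_upwards [hgb] with ξ ⟨hρ, hlow, hhigh⟩
    rw [norm_mul, Complex.norm_real, Real.norm_of_nonneg (by positivity)]
    have w₁ := gaussianWeight_nonneg (r + 2 * ((j : ℕ) : ℝ)) (c' * (1 + t)) ξ
    have w₂ := gaussianWeight_nonneg r 1 ξ
    have w₃ := highFrequencyData_nonneg e s j f ξ
    rcases le_total ((2 * Real.pi * ‖ξ‖) ^ 2) e with hx | hx
    · refine (low_frequency_bound hγ hC hc' (min_le_left _ _) (min_le_right _ _) hW hM hρ ht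
        (hx.trans he1) (norm_slowAmplitude_le hτ hγ f ξ) (hlow hx)).trans ?_
      exact le_add_of_nonneg_right (by positivity)
    · refine (hhigh hx).trans ?_
      exact le_add_of_nonneg_left (by positivity)
  refine key.trans ?_
  -- Scaling with T = 1 + t turns the first weight into the decay rate; the other two terms carry
  -- exp(-ct), which decays faster.
  rw [eLpNorm_gaussianWeight (by positivity), hrate, hV₁, hV₂]
  have hE := hexp t ht
  set Q := (1 + t) ^ (-decayRate n s j)
  have hQ : 0 ≤ Q := by positivity
  rw [← ENNReal.ofReal_mul (by positivity), ← ENNReal.ofReal_mul (by positivity),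
    ← ENNReal.ofReal_mul (by positivity), ← ENNReal.ofReal_add (by positivity) (by positivity),
    mul_add (ENNReal.ofReal _), ← ENNReal.ofReal_mul (by positivity)]
  refine add_le_add (ENNReal.ofReal_le_ofReal ?_) (mul_le_mul_left (ENNReal.ofReal_le_ofReal ?_) _)
  · calc K₁ * M * (Q * V₁) + C * Real.exp 1 * Real.exp (-c * t) * M * V₂
        ≤ K₁ * M * (Q * V₁) + C * Real.exp 1 * (D * Q) * M * V₂ := by gcongr
      _ ≤ K₁ * M * (Q * V₁) + C * Real.exp 1 * (D * Q) * M * V₂ + C * D * Q * M :=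
        le_add_of_nonneg_right (by positivity)
      _ = _ := by ring
  · calc C * Real.exp (-c * t) ≤ C * (D * Q) := by gcongr
      _ ≤ C * (D * Q) + (K₁ * V₁ + C * Real.exp 1 * D * V₂) * Q :=
        le_add_of_nonneg_right (by positivity)
      _ = _ := by ring

end DecayEstimates

/-! ### Convergence to the diffusion profile. -/

section AsymptoticProfile

variable {n : ℕ}

theorem exists_eLpNorm_highFrequencyData_le_sobolev {e : ℝ} (he : 0 < e) (s : ℝ) (j : Fin 3) :
    ∃ K : ℝ, 0 < K ∧ ∀ f : Fin 3 → Lp ℂ 1 (volume : Measure (Rn n)),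
      eLpNorm (highFrequencyData e s j f) 2 volume ≤
        ENNReal.ofReal K * dataNorm sobolevNorm s j f := by
  set m := |(s + max 1 (2 - ((j : ℕ) : ℝ))) / 2| + |(s + 1) / 2| + |s / 2|
  have hle : ∀ q : ℝ, |q / 2| ≤ m → ∀ u : Lp ℂ 1 (volume : Measure (Rn n)),
      eLpNorm (highFrequencyPart e q u) 2 volume ≤
        ENNReal.ofReal ((1 + 1 / e) ^ m) * sobolevNorm q (u : 𝓢'(Rn n, ℂ)) := fun q hq u ↦ by
    refine (eLpNorm_highFrequencyPart_le_sobolev he q u).trans ?_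
    gcongr
    exact le_add_of_nonneg_right (by positivity)
  have h0 : 0 ≤ |(s + max 1 (2 - ((j : ℕ) : ℝ))) / 2| := abs_nonneg _
  have h1 : 0 ≤ |(s + 1) / 2| := abs_nonneg _
  have h2 : 0 ≤ |s / 2| := abs_nonneg _
  exact ⟨(1 + 1 / e) ^ m, by positivity, fun f ↦ eLpNorm_highFrequencyData_le
    (hle _ (by linarith) _) (hle _ (by linarith) _) (hle _ (by linarith) _)⟩

/-- The distance of the solution from the slow mode, weighted by the decay rate. -/
theorem tendsto_homSobolevNorm_sub_profile (hn : 1 ≤ n) {τ δ γ : ℝ} (hτ : 0 < τ) (hδ : 0 < δ)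
    (hγ : 0 < γ) (s : ℝ) (j : Fin 3) (hr : 0 < (n : ℝ) + 2 * (s + 2 - ((j : ℕ) : ℝ)))
    {f : Fin 3 → Lp ℂ 1 (volume : Measure (Rn n))}
    (hf : ∀ k : Fin 3, TemperedDistribution.MemSobolev (s + 2 - ((k : ℕ) : ℝ)) 2
      (f k : 𝓢'(Rn n, ℂ))) {φ : Fin 3 → ℝ → 𝓢'(Rn n, ℂ)}
    (hφ : IsSobolevSolution τ δ γ s (fun k ↦ (f k : 𝓢'(Rn n, ℂ))) φ) :
    Tendsto (fun t : ℝ ↦ ENNReal.ofReal (t ^ decayRate n s j) *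
      homSobolevNorm (s + 2 - ((j : ℕ) : ℝ))
        (φ j t - combinedMoment τ γ f • diffusionProfile n γ j t)) atTop (𝓝 0) := by
  obtain ⟨e, C, c, he, he1, hC, hc, H⟩ := exists_fourier_bounds hn hτ hδ hγ s j
  obtain ⟨K₃, _, hK₃⟩ := exists_eLpNorm_highFrequencyData_le_sobolev (n := n) he s j
  have hHfin : eLpNorm (highFrequencyData e s j f) 2 volume ≠ ∞ := ((hK₃ f).trans_lt
    (ENNReal.mul_lt_top ENNReal.ofReal_lt_top (dataNorm_sobolevNorm_ne_top j hf).lt_top)).ne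
  set r : ℝ := s + 2 - ((j : ℕ) : ℝ) with hrdef
  have hj : (0 : ℝ) ≤ ((j : ℕ) : ℝ) := Nat.cast_nonneg _
  have hra : 0 < (n : ℝ) + 2 * (r + 2 * ((j : ℕ) : ℝ)) := by linarith
  have hra' : 0 < (n : ℝ) + 2 * (r + 2 * (((j : ℕ) + 1 : ℕ) : ℝ)) := by push_cast; linarith
  set c' := min c (1 / γ) with hc'def
  have hc' : 0 < c' := by positivity
  have hG₁ := memLp_gaussianWeight hn hra' hc'
  have hG₂ := memLp_gaussianWeight hn hr one_pos
  have hrate : ((n : ℝ) + 2 * (r + 2 * ((j : ℕ) : ℝ))) / 4 = decayRate n s j := by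
    rw [decayRate, hrdef]; ring
  have hrate' : ((n : ℝ) + 2 * (r + 2 * (((j : ℕ) + 1 : ℕ) : ℝ))) / 4 = decayRate n s j + 1 := by
    rw [decayRate, hrdef]; push_cast; ring
  set V₁ := (eLpNorm (gaussianWeight (n := n) (r + 2 * (((j : ℕ) + 1 : ℕ) : ℝ)) c') 2 volume).toReal
  set V₂ := (eLpNorm (gaussianWeight (n := n) r 1) 2 volume).toReal
  set V₃ := (eLpNorm (highFrequencyData e s j f) 2 volume).toReal
  have hV₁ : eLpNorm (gaussianWeight (n := n) (r + 2 * (((j : ℕ) + 1 : ℕ) : ℝ)) c') 2 volume =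
    ENNReal.ofReal V₁ := (ENNReal.ofReal_toReal hG₁.2.ne).symm
  have hV₂ : eLpNorm (gaussianWeight (n := n) r 1) 2 volume =
    ENNReal.ofReal V₂ := (ENNReal.ofReal_toReal hG₂.2.ne).symm
  have hV₃ : eLpNorm (highFrequencyData e s j f) 2 volume =
    ENNReal.ofReal V₃ := (ENNReal.ofReal_toReal hHfin).symm
  have hV₁0 : 0 ≤ V₁ := ENNReal.toReal_nonneg
  have hV₂0 : 0 ≤ V₂ := ENNReal.toReal_nonneg
  have hV₃0 : 0 ≤ V₃ := ENNReal.toReal_nonneg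
  set W := (γ + 1 + τ) / γ
  have hW : 0 < W := by positivity
  set M := ‖f 0‖ + ‖f 1‖ + ‖f 2‖
  have hM : 0 ≤ M := by positivity
  set K := (C + (γ ^ (j : ℕ))⁻¹ * W / e) * M
  have hK : 0 ≤ K := by positivity
  set A := slowAmplitude τ γ f with hA
  set β := decayRate n s j
  have hbound : ∀ t : ℝ, 0 < t → ENNReal.ofReal (t ^ β) * homSobolevNorm r
      (φ j t - combinedMoment τ γ f • diffusionProfile n γ j t) ≤
      ENNReal.ofReal (K * V₁ * t⁻¹ + (C * Real.exp 1 * M * V₂ + C * V₃) * (t ^ β * Real.exp (-c * t)))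
      + ENNReal.ofReal ((γ ^ (j : ℕ))⁻¹) * (ENNReal.ofReal (t ^ β) *
        eLpNorm (fun ξ ↦ gaussianWeight (r + 2 * ((j : ℕ) : ℝ)) (1 / γ * t) ξ • (A ξ - A 0))
          2 volume) := by
    intro t ht
    obtain ⟨g, hg, hgb⟩ := H f φ hφ t ht.le
    set p : Rn n → ℂ := fun ξ ↦ (((-((2 * Real.pi * ‖ξ‖) ^ 2 / γ)) ^ (j : ℕ) *
            Real.exp (-((2 * Real.pi * ‖ξ‖) ^ 2 / γ) * t) : ℝ) : ℂ) with hp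
    have hsub := hg.sub ((hasFourierFunction_diffusionProfile (n := n) hγ ht (j : ℕ)).smul
      (combinedMoment τ γ f))
    rw [homSobolevNorm, hsub.weightedFourierNorm_eq]
    have hpmeas : Measurable p := by fun_prop
    have hAmeas : Measurable A := A.continuous.measurable
    have hgmeas : AEStronglyMeasurable g volume := hg.locallyIntegrable.aestronglyMeasurable
    have hwmeas : Measurable fun ξ : Rn n ↦ (((2 * Real.pi * ‖ξ‖) ^ r : ℝ) : ℂ) := by fun_prop
    -- Since A(0) = P/γ, the profile is p·A(0). The first summand is the mode error, which gains an
    -- extra t⁻¹; the second is the variation of A near frequency 0, for which continuity alone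
    -- gives convergence without a rate.
    have hsplit : (fun ξ : Rn n ↦ (((2 * Real.pi * ‖ξ‖) ^ r : ℝ) : ℂ) *
        (g ξ - combinedMoment τ γ f * (p ξ * ((γ⁻¹ : ℝ) : ℂ)))) =
        (fun ξ : Rn n ↦ (((2 * Real.pi * ‖ξ‖) ^ r : ℝ) : ℂ) * (g ξ - p ξ * A ξ)) +
        fun ξ : Rn n ↦ (((2 * Real.pi * ‖ξ‖) ^ r : ℝ) : ℂ) * (p ξ * (A ξ - A 0)) := by
      funext ξ
      rw [Pi.add_apply, hA, slowAmplitude_zero]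
      push_cast
      ring
    have h₁ : eLpNorm (fun ξ : Rn n ↦ (((2 * Real.pi * ‖ξ‖) ^ r : ℝ) : ℂ) * (g ξ - p ξ * A ξ))
        2 volume ≤ ENNReal.ofReal K *
        eLpNorm (gaussianWeight (n := n) (r + 2 * (((j : ℕ) + 1 : ℕ) : ℝ)) (c' * t)) 2 volume
      + ENNReal.ofReal (C * Real.exp 1 * Real.exp (-c * t) * M) *
        eLpNorm (gaussianWeight (n := n) r 1) 2 volume
      + ENNReal.ofReal (C * Real.exp (-c * t)) * eLpNorm (highFrequencyData e s j f) 2 volume := by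
      refine eLpNorm_two_le_of_norm_le_add (by positivity) (by positivity) (by positivity)
        (measurable_gaussianWeight _ _) (measurable_gaussianWeight _ _)
        (measurable_highFrequencyData _ _ _ _) ?_
      filter_upwards [hgb] with ξ ⟨hρ, hlow, hhigh⟩
      rw [norm_mul, Complex.norm_real, Real.norm_of_nonneg (by positivity)]
      have w₁ := gaussianWeight_nonneg (r + 2 * (((j : ℕ) + 1 : ℕ) : ℝ)) (c' * t) ξ
      have w₂ := gaussianWeight_nonneg r 1 ξ
      have w₃ := highFrequencyData_nonneg e s j f ξ
      have hK' : K = C * M + (γ ^ (j : ℕ))⁻¹ * W / e * M := add_mul _ _ _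
      rcases le_total ((2 * Real.pi * ‖ξ‖) ^ 2) e with hx | hx
      · have h := low_frequency_remainder_bound (r := r) hC (min_le_left c (1 / γ)) hM hρ ht.le
          (hx.trans he1) (hlow hx)
        refine h.trans ?_
        have h₀ : 0 ≤ (γ ^ (j : ℕ))⁻¹ * W / e * M *
          gaussianWeight (r + 2 * (((j : ℕ) + 1 : ℕ) : ℝ)) (c' * t) ξ := by positivity
        have h₁ : 0 ≤ C * Real.exp (-c * t) * highFrequencyData e s j f ξ := by positivity
        rw [hK', add_mul]
        unfold gaussianWeight at h₀ ⊢
        linarith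
      · have h := high_frequency_remainder_bound (j := (j : ℕ)) hγ he (min_le_right c (1 / γ))
          hρ ht.le hx (norm_slowAmplitude_le hτ hγ f ξ) (hhigh hx)
        refine h.trans ?_
        have h₀ : 0 ≤ C * M *
          gaussianWeight (r + 2 * (((j : ℕ) + 1 : ℕ) : ℝ)) (c' * t) ξ := by positivity
        have h₁ : 0 ≤ C * Real.exp 1 * Real.exp (-c * t) * M * gaussianWeight r 1 ξ := by positivity
        rw [hK', add_mul]
        unfold gaussianWeight at h₀ h₁ ⊢
        linarith
    have h₂ : eLpNorm (fun ξ : Rn n ↦ (((2 * Real.pi * ‖ξ‖) ^ r : ℝ) : ℂ) * (p ξ * (A ξ - A 0)))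
        2 volume ≤ ENNReal.ofReal ((γ ^ (j : ℕ))⁻¹) *
        eLpNorm (fun ξ ↦ gaussianWeight (r + 2 * ((j : ℕ) : ℝ)) (1 / γ * t) ξ • (A ξ - A 0))
          2 volume := by
      refine eLpNorm_le_mul_eLpNorm_of_ae_le_mul ?_ 2
      filter_upwards [hgb] with ξ ⟨hρ, _, _⟩
      rw [norm_mul, norm_mul, norm_smul, Complex.norm_real, Real.norm_of_nonneg (by positivity), hp,
        norm_diffusive_symbol hγ _ t (by positivity), Real.norm_of_nonneg (gaussianWeight_nonneg _ _ _),
        gaussianWeight, ← rpow_mul_sq_pow hρ]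
      refine le_of_eq ?_
      rw [show -(1 / γ) * (2 * Real.pi * ‖ξ‖) ^ 2 * t = -(1 / γ * t) * (2 * Real.pi * ‖ξ‖) ^ 2 by ring]
      ring
    have hadd := eLpNorm_add_le (p := 2) (μ := (volume : Measure (Rn n)))
      (hwmeas.aestronglyMeasurable.mul (hgmeas.sub (hpmeas.mul hAmeas).aestronglyMeasurable))
      (hwmeas.mul (hpmeas.mul (hAmeas.sub_const (A 0)))).aestronglyMeasurable (by norm_num)
    rw [hsplit]
    calc _ ≤ ENNReal.ofReal (t ^ β) * _ := mul_le_mul_right (hadd.trans (add_le_add h₁ h₂)) _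
      _ = _ := by
        rw [eLpNorm_gaussianWeight ht, hrate', hV₁, hV₂, hV₃, mul_add (ENNReal.ofReal (t ^ β)),
          mul_left_comm (ENNReal.ofReal (t ^ β)) (ENNReal.ofReal ((γ ^ (j : ℕ))⁻¹)),
          ← ENNReal.ofReal_mul (by positivity), ← ENNReal.ofReal_mul (by positivity),
          ← ENNReal.ofReal_mul (by positivity), ← ENNReal.ofReal_mul (by positivity),
          ← ENNReal.ofReal_add (by positivity) (by positivity),
          ← ENNReal.ofReal_add (by positivity) (by positivity),
          ← ENNReal.ofReal_mul (by positivity)]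
        congr 2
        have : t ^ (-(β + 1)) = (t ^ β)⁻¹ * t⁻¹ := by
          rw [Real.rpow_neg ht.le, Real.rpow_add ht, Real.rpow_one, mul_inv]
        rw [this]
        have : t ^ β ≠ 0 := (Real.rpow_pos_of_pos ht β).ne'
        field_simp
        ring
  have hlim₁ : Tendsto (fun t : ℝ ↦ ENNReal.ofReal (K * V₁ * t⁻¹
      + (C * Real.exp 1 * M * V₂ + C * V₃) * (t ^ β * Real.exp (-c * t)))) atTop (𝓝 0) := by
    rw [← ENNReal.ofReal_zero]
    refine ENNReal.tendsto_ofReal ?_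
    have h1 := (tendsto_inv_atTop_zero (𝕜 := ℝ)).const_mul (K * V₁)
    have h2 := (tendsto_rpow_mul_exp_neg_mul_atTop_nhds_zero β c hc).const_mul
      (C * Real.exp 1 * M * V₂ + C * V₃)
    simpa using h1.add h2
  have hlim₂ := ENNReal.Tendsto.const_mul (a := ENNReal.ofReal ((γ ^ (j : ℕ))⁻¹))
    (tendsto_eLpNorm_gaussianWeight_mul_sub hn hra (one_div_pos.2 hγ) A) (Or.inr ENNReal.ofReal_ne_top)
  rw [hrate] at hlim₂
  have hlim := hlim₁.add hlim₂
  rw [mul_zero, add_zero] at hlim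
  refine tendsto_of_tendsto_of_tendsto_of_le_of_le' tendsto_const_nhds hlim
    (Eventually.of_forall fun _ ↦ zero_le) ?_
  filter_upwards [eventually_gt_atTop 0] with t ht using hbound t ht

end AsymptoticProfile

/-! ### Lower bound from frequencies of size t^(-1/2). -/

section LowerBound

/-- The annulus `1 ≤ 2 π |η| ≤ 2`. -/
def unitAnnulus (n : ℕ) : Set (Rn n) :=
  {η | 1 ≤ 2 * Real.pi * ‖η‖ ∧ 2 * Real.pi * ‖η‖ ≤ 2}

variable {n : ℕ}

theorem measurableSet_unitAnnulus : MeasurableSet (unitAnnulus n) := by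
  have h1 : MeasurableSet {η : Rn n | 1 ≤ 2 * Real.pi * ‖η‖} :=
    measurableSet_le measurable_const (by fun_prop)
  have h2 : MeasurableSet {η : Rn n | 2 * Real.pi * ‖η‖ ≤ 2} :=
    measurableSet_le (by fun_prop) measurable_const
  exact h1.inter h2

theorem volume_unitAnnulus_ne_top : volume (unitAnnulus n) ≠ ∞ := by
  have hsub : unitAnnulus n ⊆ Metric.closedBall 0 1 := fun η hη ↦ by
    rw [mem_closedBall_zero_iff]
    have h1 := hη.2
    have h2 := mul_le_mul_of_nonneg_right Real.pi_gt_three.le (norm_nonneg η)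
    linarith [norm_nonneg η]
  exact ((measure_mono hsub).trans_lt measure_closedBall_lt_top).ne

theorem volume_unitAnnulus_pos (hn : 1 ≤ n) : 0 < volume (unitAnnulus n) := by
  have hfin : Module.finrank ℝ (Rn n) = n := finrank_euclideanSpace_fin
  have : Nontrivial (Rn n) := Module.nontrivial_of_finrank_pos (R := ℝ) (by rw [hfin]; omega)
  have h1 : IsOpen {η : Rn n | 1 < 2 * Real.pi * ‖η‖} := isOpen_lt continuous_const (by fun_prop)
  have h2 : IsOpen {η : Rn n | 2 * Real.pi * ‖η‖ < 2} := isOpen_lt (by fun_prop) continuous_const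
  have hopen : IsOpen {η : Rn n | 1 < 2 * Real.pi * ‖η‖ ∧ 2 * Real.pi * ‖η‖ < 2} := h1.inter h2
  obtain ⟨η, hη⟩ := exists_norm_eq (Rn n) (c := 3 / (4 * Real.pi)) (by positivity)
  have hne : {η : Rn n | 1 < 2 * Real.pi * ‖η‖ ∧ 2 * Real.pi * ‖η‖ < 2}.Nonempty := by
    refine ⟨η, ?_⟩
    have : 2 * Real.pi * ‖η‖ = 3 / 2 := by rw [hη]; field_simp; norm_num
    rw [Set.mem_ofPred_eq, this]
    norm_num
  exact (hopen.measure_pos volume hne).trans_le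
    (measure_mono fun η hη ↦ ⟨hη.1.le, hη.2.le⟩)

theorem two_rpow_neg_abs_le {y : ℝ} (h1 : 1 ≤ y) (h2 : y ≤ 2) (r : ℝ) :
    (2 : ℝ) ^ (-|r|) ≤ y ^ r :=
  calc (2 : ℝ) ^ (-|r|) ≤ y ^ (-|r|) :=
        Real.rpow_le_rpow_of_nonpos (by linarith) h2 (neg_nonpos.2 (abs_nonneg r))
    _ ≤ y ^ r := Real.rpow_le_rpow_of_exponent_le h1 (neg_abs_le r)

/-- Pointwise lower bound at frequencies of size `t ^ (-1/2)`. -/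
theorem annulus_lower_bound {γ C c M ρ r t P : ℝ} {j : ℕ} {g A A₀ : ℂ} (hγ : 0 < γ) (hC : 0 < C)
    (hc : 0 < c) (hM : 0 ≤ M) (hρ : 0 < ρ) (ht : 0 < t) (hP : 0 ≤ P)
    (h1 : 1 ≤ √t * ρ) (h2 : √t * ρ ≤ 2) (hA₀ : ‖A₀‖ = P / γ) (hA : ‖A - A₀‖ ≤ P / (2 * γ))
    (hlarge : C * M * (4 ^ (j + 1) * t⁻¹ + t ^ j * Real.exp (-c * t)) ≤
      (γ ^ j)⁻¹ * Real.exp (-(4 / γ)) / (4 * γ) * P)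
    (hg : ‖g - (((-(ρ ^ 2 / γ)) ^ j * Real.exp (-(ρ ^ 2 / γ) * t) : ℝ) : ℂ) * A‖ ≤
      C * ((ρ ^ 2) ^ (j + 1) * Real.exp (-c * ρ ^ 2 * t) + Real.exp (-c * t)) * M) :
    2 ^ (-|r|) * ((γ ^ j)⁻¹ * Real.exp (-(4 / γ)) / (4 * γ)) * t ^ (-r / 2 - j) * P ≤
      ρ ^ r * ‖g‖ := by
  have hs : 0 < √t := Real.sqrt_pos.2 ht
  have hst : √t ^ 2 = t := Real.sq_sqrt ht.le
  have hx : 0 < ρ ^ 2 := by positivity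
  have hxt : (√t * ρ) ^ 2 = t * ρ ^ 2 := by rw [mul_pow, hst]
  have hx1 : 1 ≤ t * ρ ^ 2 := by rw [← hxt]; exact one_le_pow₀ h1
  have hx4 : t * ρ ^ 2 ≤ 4 := by
    rw [← hxt]
    calc (√t * ρ) ^ 2 ≤ 2 ^ 2 := by gcongr
      _ = 4 := by norm_num
  have hp := norm_diffusive_symbol hγ (ρ ^ 2) t hx.le j
  set p : ℂ := (((-(ρ ^ 2 / γ)) ^ j * Real.exp (-(ρ ^ 2 / γ) * t) : ℝ) : ℂ)
  have htj : 0 < t ^ j := by positivity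
  have hplow : (γ ^ j)⁻¹ * (t ^ j)⁻¹ * Real.exp (-(4 / γ)) ≤ ‖p‖ := by
    rw [hp]
    gcongr
    · rw [inv_le_iff_one_le_mul₀ htj, ← mul_pow, mul_comm]
      exact one_le_pow₀ hx1
    · have : 1 / γ * (t * ρ ^ 2) ≤ 1 / γ * 4 := by gcongr
      have h4 : 4 / γ = 1 / γ * 4 := by ring
      rw [h4]
      linarith
  have herr : C * ((ρ ^ 2) ^ (j + 1) * Real.exp (-c * ρ ^ 2 * t) + Real.exp (-c * t)) * M ≤
      (t ^ j)⁻¹ * (C * M * (4 ^ (j + 1) * t⁻¹ + t ^ j * Real.exp (-c * t))) := by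
    have e1 : Real.exp (-c * ρ ^ 2 * t) ≤ 1 := Real.exp_le_one_iff.2 (by
      have : 0 < c * ρ ^ 2 * t := by positivity
      linarith)
    have e2 : ρ ^ 2 ≤ 4 * t⁻¹ := by rw [← div_eq_mul_inv, le_div_iff₀ ht]; linarith
    calc C * ((ρ ^ 2) ^ (j + 1) * Real.exp (-c * ρ ^ 2 * t) + Real.exp (-c * t)) * M
        ≤ C * ((4 * t⁻¹) ^ (j + 1) * 1 + Real.exp (-c * t)) * M := by gcongr
      _ = _ := by
        rw [mul_pow, inv_pow, pow_succ t, mul_inv]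
        field_simp
  -- Half of ‖A₀‖ survives in ‖A‖, and `hlarge` bounds the error by half of the resulting main term;
  -- hence the denominator 4γ.
  have hgl : (γ ^ j)⁻¹ * Real.exp (-(4 / γ)) / (4 * γ) * (t ^ j)⁻¹ * P ≤ ‖g‖ := by
    have hAl : P / (2 * γ) ≤ ‖A‖ := by
      have h := norm_sub_norm_le A₀ (A₀ - A)
      rw [sub_sub_cancel, hA₀, norm_sub_rev] at h
      have : P / γ = P / (2 * γ) + P / (2 * γ) := by field_simp; norm_num
      linarith
    have h3 : ‖p‖ * ‖A‖ - ‖g - p * A‖ ≤ ‖g‖ := by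
      have h := norm_sub_norm_le (p * A) (p * A - g)
      rw [sub_sub_cancel, norm_mul, norm_sub_rev] at h
      exact h
    have h4 : (γ ^ j)⁻¹ * (t ^ j)⁻¹ * Real.exp (-(4 / γ)) * (P / (2 * γ)) ≤ ‖p‖ * ‖A‖ := by gcongr
    have h5 := mul_le_mul_of_nonneg_left hlarge (inv_nonneg.2 htj.le)
    have h6 : (γ ^ j)⁻¹ * (t ^ j)⁻¹ * Real.exp (-(4 / γ)) * (P / (2 * γ)) =
        2 * ((t ^ j)⁻¹ * ((γ ^ j)⁻¹ * Real.exp (-(4 / γ)) / (4 * γ) * P)) := by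
      field_simp; ring
    have h7 : (γ ^ j)⁻¹ * Real.exp (-(4 / γ)) / (4 * γ) * (t ^ j)⁻¹ * P =
        (t ^ j)⁻¹ * ((γ ^ j)⁻¹ * Real.exp (-(4 / γ)) / (4 * γ) * P) := by ring
    linarith
  have hρr : 2 ^ (-|r|) * t ^ (-r / 2) ≤ ρ ^ r := by
    have h := two_rpow_neg_abs_le h1 h2 r
    rw [Real.mul_rpow hs.le hρ.le, Real.sqrt_eq_rpow, ← Real.rpow_mul ht.le] at h
    have h' : t ^ (1 / 2 * r) * t ^ (-r / 2) = 1 := by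
      rw [← Real.rpow_add ht]; ring_nf; exact Real.rpow_zero _
    calc 2 ^ (-|r|) * t ^ (-r / 2) ≤ t ^ (1 / 2 * r) * ρ ^ r * t ^ (-r / 2) := by gcongr
      _ = t ^ (1 / 2 * r) * t ^ (-r / 2) * ρ ^ r := by ring
      _ = ρ ^ r := by rw [h', one_mul]
  have htp : t ^ (-r / 2 - (j : ℝ)) = t ^ (-r / 2) * (t ^ j)⁻¹ := by
    rw [Real.rpow_sub ht, Real.rpow_natCast, div_eq_mul_inv]
  rw [htp]
  calc _ = 2 ^ (-|r|) * t ^ (-r / 2) *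
        ((γ ^ j)⁻¹ * Real.exp (-(4 / γ)) / (4 * γ) * (t ^ j)⁻¹ * P) := by ring
    _ ≤ _ := by gcongr

/-- Lower bound of the solution for large times. -/
theorem exists_le_homSobolevNorm (hn : 1 ≤ n) {τ δ γ : ℝ} (hτ : 0 < τ) (hδ : 0 < δ) (hγ : 0 < γ)
    (s : ℝ) (j : Fin 3) :
    ∃ c : ℝ, 0 < c ∧
      ∀ (f : Fin 3 → Lp ℂ 1 (volume : Measure (Rn n))) (φ : Fin 3 → ℝ → 𝓢'(Rn n, ℂ)),
      IsSobolevSolution τ δ γ s (fun k ↦ (f k : 𝓢'(Rn n, ℂ))) φ →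
      combinedMoment τ γ f ≠ 0 → ∀ᶠ t : ℝ in atTop,
        ENNReal.ofReal (c * t ^ (-decayRate n s j) * ‖combinedMoment τ γ f‖) ≤
          homSobolevNorm (s + 2 - ((j : ℕ) : ℝ)) (φ j t) := by
  obtain ⟨e, C, c, he, he1, hC, hc, H⟩ := exists_fourier_bounds hn hτ hδ hγ s j
  set r : ℝ := s + 2 - ((j : ℕ) : ℝ) with hrdef
  set V := eLpNorm ((unitAnnulus n).indicator fun _ ↦ (1 : ℝ)) 2 volume with hVdef
  have hV : V = volume (unitAnnulus n) ^ (1 / 2 : ℝ) := by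
    rw [hVdef, eLpNorm_indicator_const measurableSet_unitAnnulus (by norm_num) (by norm_num)]
    simp
  have hVtop : V ≠ ∞ := by
    rw [hV]; exact ENNReal.rpow_ne_top_of_nonneg (by norm_num) volume_unitAnnulus_ne_top
  have hV0 : V ≠ 0 := by
    rw [hV]; exact (ENNReal.rpow_pos (volume_unitAnnulus_pos hn) volume_unitAnnulus_ne_top).ne'
  set κ := (2 : ℝ) ^ (-|r|) * ((γ ^ (j : ℕ))⁻¹ * Real.exp (-(4 / γ)) / (4 * γ)) with hκdef
  have hκ : 0 < κ := by positivity
  have hVpos : 0 < V.toReal := ENNReal.toReal_pos hV0 hVtop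
  -- The constant involves only the parameters and the annulus; the data enter only through how
  -- large t has to be.
  refine ⟨κ * V.toReal, by positivity, fun f φ hφ hP ↦ ?_⟩
  set M := ‖f 0‖ + ‖f 1‖ + ‖f 2‖
  have hM : 0 ≤ M := by positivity
  set P := ‖combinedMoment τ γ f‖
  have hPpos : 0 < P := norm_pos_iff.2 hP
  set A := slowAmplitude τ γ f with hA
  have hA₀ : ‖A 0‖ = P / γ := by
    rw [hA, slowAmplitude_zero, norm_div, Complex.norm_real, Real.norm_of_nonneg hγ.le]
  obtain ⟨η, hη, hAη⟩ := Metric.continuous_iff.1 A.continuous 0 (P / (2 * γ)) (by positivity)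
  have hlarge : ∀ᶠ t : ℝ in atTop,
      C * M * (4 ^ ((j : ℕ) + 1) * t⁻¹ + t ^ (j : ℕ) * Real.exp (-c * t)) ≤
        (γ ^ (j : ℕ))⁻¹ * Real.exp (-(4 / γ)) / (4 * γ) * P := by
    have l1 := (tendsto_inv_atTop_zero (𝕜 := ℝ)).const_mul (4 ^ ((j : ℕ) + 1))
    have l2 := tendsto_rpow_mul_exp_neg_mul_atTop_nhds_zero ((j : ℕ) : ℝ) c hc
    simp only [Real.rpow_natCast] at l2
    have l3 := (l1.add l2).const_mul (C * M)
    rw [mul_zero, add_zero, mul_zero] at l3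
    exact l3.eventually_le_const (by positivity)
  -- On the annulus ρ ≤ 2/√t, so for large t these frequencies lie both in the low frequency zone ρ²
  -- ≤ e and where A is within P/(2γ) of A(0).
  have hsmall : ∀ᶠ t : ℝ in atTop, 2 * (√t)⁻¹ < min η (√e) := by
    have l1 := (tendsto_inv_atTop_zero.comp Real.tendsto_sqrt_atTop).const_mul (2 : ℝ)
    rw [mul_zero] at l1
    exact l1.eventually_lt_const (lt_min hη (Real.sqrt_pos.2 he))
  filter_upwards [eventually_gt_atTop 0, hlarge, hsmall] with t ht htl hts
  have hs : 0 < √t := Real.sqrt_pos.2 ht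
  obtain ⟨g, hg, hgb⟩ := H f φ hφ t ht.le
  rw [homSobolevNorm, hg.weightedFourierNorm_eq]
  have hscale := eLpNorm_two_comp_smul ((unitAnnulus n).indicator fun _ ↦ (1 : ℝ)) hs
  have key : eLpNorm ((κ * t ^ (-r / 2 - ((j : ℕ) : ℝ)) * P) •
      fun ξ ↦ (unitAnnulus n).indicator (fun _ ↦ (1 : ℝ)) (√t • ξ)) 2 volume ≤
      eLpNorm (fun ξ ↦ (((2 * Real.pi * ‖ξ‖) ^ r : ℝ) : ℂ) * g ξ) 2 volume := by
    refine eLpNorm_mono_ae ?_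
    filter_upwards [hgb] with ξ ⟨hρ, hlow, _⟩
    rw [Pi.smul_apply, smul_eq_mul, norm_mul, Real.norm_of_nonneg (by positivity)]
    by_cases hmem : √t • ξ ∈ unitAnnulus n
    · rw [Set.indicator_of_mem hmem, norm_one, mul_one, norm_mul, Complex.norm_real,
        Real.norm_of_nonneg (by positivity)]
      have hnorm : 2 * Real.pi * ‖√t • ξ‖ = √t * (2 * Real.pi * ‖ξ‖) := by
        rw [norm_smul, Real.norm_of_nonneg hs.le]; ring
      obtain ⟨h1, h2⟩ := hmem
      rw [hnorm] at h1 h2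
      have hρle : 2 * Real.pi * ‖ξ‖ ≤ 2 * (√t)⁻¹ := by
        rw [← div_eq_mul_inv, le_div_iff₀ hs]; linarith
      have hρlt := hρle.trans_lt hts
      have hρe : (2 * Real.pi * ‖ξ‖) ^ 2 ≤ e := by
        have := (hρlt.trans_le (min_le_right _ _)).le
        calc (2 * Real.pi * ‖ξ‖) ^ 2 ≤ √e ^ 2 := by gcongr
          _ = e := Real.sq_sqrt he.le
      have hξη : dist ξ 0 < η := by
        rw [dist_zero_right]
        have h3 := hρlt.trans_le (min_le_left _ _)
        have h4 := mul_le_mul_of_nonneg_right Real.pi_gt_three.le (norm_nonneg ξ)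
        linarith [norm_nonneg ξ]
      have hAξ : ‖A ξ - A 0‖ ≤ P / (2 * γ) := by
        rw [← dist_eq_norm]; exact (hAη ξ hξη).le
      exact annulus_lower_bound hγ hC hc hM hρ ht hPpos.le h1 h2 hA₀ hAξ htl (hlow hρe)
    · rw [Set.indicator_of_notMem hmem, norm_zero, mul_zero]
      exact norm_nonneg _
  refine le_trans (le_of_eq ?_) key
  rw [eLpNorm_const_smul, Real.enorm_of_nonneg (by positivity), hscale, ← hVdef,
    ← ENNReal.ofReal_toReal hVtop, ← ENNReal.ofReal_mul (by positivity),
    ← ENNReal.ofReal_mul (by positivity)]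
  congr 1
  have hpow : t ^ (-decayRate n s j) = t ^ (-r / 2 - ((j : ℕ) : ℝ)) * √t ^ (-(n : ℝ) / 2) := by
    rw [Real.sqrt_eq_rpow, ← Real.rpow_mul ht.le, ← Real.rpow_add ht]
    congr 1
    rw [decayRate, hrdef]
    ring
  rw [hpow, ENNReal.toReal_ofReal ENNReal.toReal_nonneg]
  ring

end LowerBound

/-! ### The main theorem. -/

theorem theorem3p1 (n : ℕ) (hn : 1 ≤ n) (τ δ γ s : ℝ) (hτ : 0 < τ) (hδ : 0 < δ) (hγ : 0 < γ)
    (hγτ : γ ≠ 1 / (4 * τ)) (j : Fin 3)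
    (hrate : 0 < (n : ℝ) + 2 * s + 4 + 2 * ((j : ℕ) : ℝ)) :
    ∃ C c : ℝ, 0 < C ∧ 0 < c ∧
      ∀ f : Fin 3 → Lp ℂ 1 (volume : Measure (Rn n)),
        (∀ k : Fin 3, TemperedDistribution.MemSobolev (s + 2 - ((k : ℕ) : ℝ)) 2
          (f k : 𝓢'(Rn n, ℂ))) →
        ∀ φ : Fin 3 → ℝ → 𝓢'(Rn n, ℂ),
          IsSobolevSolution τ δ γ s (fun k ↦ (f k : 𝓢'(Rn n, ℂ))) φ →
          -- upper bounds and asymptotic profile, where `|ξ|^{s+2-j}` is square integrable near `0`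
          -- (for `s + 2 - j ≤ -n/2` the norm on the left is infinite in general)
          (0 < (n : ℝ) + 2 * (s + 2 - ((j : ℕ) : ℝ)) →
            -- upper bound, with inhomogeneous and with homogeneous Sobolev norms of the data
            (∀ t : ℝ, 0 ≤ t →
              homSobolevNorm (s + 2 - ((j : ℕ) : ℝ)) (φ j t) ≤
                ENNReal.ofReal (C * (1 + t) ^ (-decayRate n s j)) *
                  dataNorm sobolevNorm s j f) ∧
            (∀ t : ℝ, 0 ≤ t →
              homSobolevNorm (s + 2 - ((j : ℕ) : ℝ)) (φ j t) ≤
                ENNReal.ofReal (C * (1 + t) ^ (-decayRate n s j)) *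
                  dataNorm homSobolevNorm s j f) ∧
            -- asymptotic profile
            Tendsto (fun t : ℝ ↦ ENNReal.ofReal (t ^ decayRate n s j) *
                homSobolevNorm (s + 2 - ((j : ℕ) : ℝ))
                  (φ j t - combinedMoment τ γ f • diffusionProfile n γ j t))
              atTop (𝓝 0)) ∧
          -- lower bound
          (combinedMoment τ γ f ≠ 0 → ∀ᶠ t : ℝ in atTop,
            ENNReal.ofReal (c * t ^ (-decayRate n s j) * ‖combinedMoment τ γ f‖) ≤
              homSobolevNorm (s + 2 - ((j : ℕ) : ℝ)) (φ j t)) := by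
  obtain ⟨c, hc, hlower⟩ := exists_le_homSobolevNorm hn hτ hδ hγ s j
  -- The condition concerns the parameters only, so it is decided before C is chosen; when it fails,
  -- (i) and (ii) are vacuous and any C serves.
  by_cases hr : 0 < (n : ℝ) + 2 * (s + 2 - ((j : ℕ) : ℝ))
  · obtain ⟨e, C, he, hC, hupper⟩ := exists_homSobolevNorm_le hn hτ hδ hγ s j hr
    obtain ⟨K, hK, hKf⟩ := exists_eLpNorm_highFrequencyData_le_sobolev (n := n) he s j
    -- The summand C(1+K) serves the inhomogeneous data norm, 2C the homogeneous one. Low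
    -- frequencies need only the L¹ norms, which both data norms contain.
    refine ⟨C * (1 + K) + 2 * C, c, by positivity, hc, fun f hf φ hφ ↦
      ⟨fun _ ↦ ⟨fun t ht ↦ ?_, fun t ht ↦ ?_,
        tendsto_homSobolevNorm_sub_profile hn hτ hδ hγ s j hr hf hφ⟩, hlower f φ hφ⟩⟩
    · refine (hupper f φ hφ t ht).trans ?_
      have h1 := sum_enorm_le_dataNorm sobolevNorm s j f
      set Q := (1 + t) ^ (-decayRate n s j)
      have hQ : 0 ≤ Q := by positivity
      calc _ ≤ ENNReal.ofReal (C * Q) * (dataNorm sobolevNorm s j f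
              + ENNReal.ofReal K * dataNorm sobolevNorm s j f) :=
            mul_le_mul_right (add_le_add h1 (hKf f)) _
        _ = ENNReal.ofReal (C * Q * (1 + K)) * dataNorm sobolevNorm s j f := by
            rw [ENNReal.ofReal_mul (p := C * Q) (by positivity), ENNReal.ofReal_add zero_le_one hK.le,
              ENNReal.ofReal_one]
            ring
        _ ≤ _ := by
            refine mul_le_mul_left (ENNReal.ofReal_le_ofReal ?_) _
            have : 0 ≤ 2 * C * Q := by positivity
            linarith
    · refine (hupper f φ hφ t ht).trans ?_
      have h1 := sum_enorm_le_dataNorm homSobolevNorm s j f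
      have h2 : eLpNorm (highFrequencyData e s j f) 2 volume ≤ 1 * dataNorm homSobolevNorm s j f :=
        eLpNorm_highFrequencyData_le
          (by rw [one_mul]; exact eLpNorm_highFrequencyPart_le_hom _ _ _)
          (by rw [one_mul]; exact eLpNorm_highFrequencyPart_le_hom _ _ _)
          (by rw [one_mul]; exact eLpNorm_highFrequencyPart_le_hom _ _ _)
      set Q := (1 + t) ^ (-decayRate n s j)
      have hQ : 0 ≤ Q := by positivity
      calc _ ≤ ENNReal.ofReal (C * Q) * (dataNorm homSobolevNorm s j f
              + 1 * dataNorm homSobolevNorm s j f) :=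
            mul_le_mul_right (add_le_add h1 h2) _
        _ = ENNReal.ofReal (C * Q * 2) * dataNorm homSobolevNorm s j f := by
            rw [ENNReal.ofReal_mul (p := C * Q) (by positivity), ENNReal.ofReal_ofNat]
            ring
        _ ≤ _ := by
            refine mul_le_mul_left (ENNReal.ofReal_le_ofReal ?_) _
            have : 0 ≤ C * (1 + K) * Q := by positivity
            linarith
  · exact ⟨1, c, one_pos, hc, fun f _ φ hφ ↦ ⟨fun h ↦ absurd h hr, hlower f φ hφ⟩⟩
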